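/- Let $p$ be a prime, $e\ge 1$ an integer and $q=p^e$. Let $\pi\colon Y\to X$ be a finite surjective morphism of Noetherian normal integral schemes of characteristic $p$ that are $F$-finite (their Frobenius endomorphisms are finite), and let $K(X)\subseteq K(Y)$ be the function fields. Let $\mathcal L$ be an invertible $\mathcal O_X$-module and $\phi\colon\mathcal L^{1/p^e}\to\mathcal O_X$ a nonzero $\mathcal O_X$-linear map, i.e. a nonzero additive map of sheaves $\phi\colon\mathcal L\to\mathcal O_X$ with $\phi(r^{q}m)=r\phi(m)$ ("$p^{-e}$-linear"). *Notation.* (i) The $\mathbb Q$-divisor $\Delta_\phi$ on $X$: at a prime divisor $E$ choose a generator $l$ of $\mathcal L_E$ and a generator $\Phi_E$ of the $\mathcal O_{X,E}^{1/p^e}$-module $\operatorname{Hom}_{\mathcal O_{X,E}}(\mathcal O_{X,E}^{1/p^e},\mathcal O_{X,E})$, and write $\phi((al)^{1/p^e})=\Phi_E((fa)^{1/p^e})$ with $f\in\mathcal O_{X,E}$; the coefficient of $E$ is $\operatorname{ord}_E(f)/(p^e-1)$. The same rule defines $\Delta_\psi$ on $Y$ for a nonzero $p^{-e}$-linear $\psi\colon\pi^*\mathcal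 L\to\mathcal O_Y$. (ii) For a nonzero $K(X)$-linear map $\mathfrak T\colon K(Y)\to K(X)$, the divisor $\mathcal R_{\mathfrak T}$ on $Y$ is the divisor of $\mathfrak T$ as a rational section of $\mathcal Hom_{\mathcal O_X}(\pi_*\mathcal O_Y,\mathcal O_X)$: at a prime divisor $C$ of $Y$ with image $D$, let $\Phi$ generate $\operatorname{Hom}_{\mathcal O_{X,D}}((\pi_*\mathcal O_Y)_D,\mathcal O_{X,D})$ over $(\pi_*\mathcal O_Y)_D$ and write $\mathfrak T=\Phi(s\,\cdot)$ with $s\in K(Y)$; the coefficient of $C$ is $\operatorname{ord}_C(s)$. (iii) The coefficient of $C$ in $\pi^*\Delta$ is the coefficient of $D$ in $\Delta$ times $\operatorname{ord}_C$ of a uniformizer of $\mathcal O_{X,D}$. (iv) A $\mathfrak T$-transpose of $\phi$ is a $p^{-e}$-linear map $\phi_{\mathfrak T}\colon\pi^*\mathcal L\to\mathcal O_Y$ with $\mathfrak T\circ\phi_{\mathfrak T}=\phi\circ\mathfrak T^{1/p^e}$, i.e. $\mathfrak T(\phi_{\mathfrak T}(s\otimes l))=\phi(\mathfrak T(s)\,l)$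 for local sections $s$ of $\pi_*\mathcal O_Y$ and $l$ of $\mathcal L$, where on the right $\phi$ is extended to the generic stalk of $\mathcal L$. All these divisors are well defined (independent of the choices, with finitely many nonzero coefficients), and for every nonzero $K(X)$-linear map $\mathfrak T\colon K(Y)\to K(X)$: (a) $\phi$ has a $\mathfrak T$-transpose if and only if $\pi^*\Delta_\phi\ge\mathcal R_{\mathfrak T}$. (b) In that case $\Delta_{\phi_{\mathfrak T}}=\pi^*\Delta_\phi-\mathcal R_{\mathfrak T}$. In particular $K_Y+\Delta_{\phi_{\mathfrak T}}\sim_{\mathbb Q}\pi^*(K_X+\Delta_\phi)$ for all canonical divisors $K_X$, $K_Y$ of $X$, $Y$ with $\mathcal O_Y(K_Y)\cong\pi^!\mathcal O_X(K_X)$, i.e. $\pi_*\mathcal O_Y(K_Y)\cong\mathcal Hom_{\mathcal O_X}(\pi_*\mathcal O_Y,\mathcal O_X(K_X))$ as $\pi_*\mathcal O_Y$-modules. (c) If $K(Y)/K(X)$ is separable, then $\operatorname{Tr}\colon K(Y)\to K(X)$ is nonzero and $\mathcal R_{\operatorname{Tr}}=\operatorname{Ram}_\pi$, the divisor whose coefficient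 at a prime divisor $C$ of $Y$ is the length of the $\mathcal O_{Y,C}$-module $\Omega_{Y/X,C}$. Moreover $\phi$ extends to a $p^{-e}$-linear map $\bar\phi\colon\pi^*\mathcal L\to\mathcal O_Y$ if and only if $\pi^*\Delta_\phi\ge\operatorname{Ram}_\pi$, and then $\Delta_{\bar\phi}=\pi^*\Delta_\phi-\operatorname{Ram}_\pi$. -/

import Mathlib

open AlgebraicGeometry CategoryTheory TopologicalSpace

universe u

noncomputable section

namespace FrobeniusTranspose

/-! ### Normal and `F`-finite schemes -/

/-- A scheme is normal if all its local rings are integrally closed domains. -/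
def IsNormal (X : Scheme.{u}) : Prop :=
  ∀ x : X, IsDomain (X.presheaf.stalk x) ∧ IsIntegrallyClosed (X.presheaf.stalk x)

/-- An integral scheme of characteristic `p` whose Frobenius endomorphism is finite. (Frobenius is
the identity on points, so finiteness means that `a ↦ a ^ p` is a finite ring endomorphism of the
ring of sections over every affine open subset.) -/
structure IsFFinite (p : ℕ) (X : Scheme.{u}) [IsIntegral X] : Prop where
  charP : CharP X.functionField p
  finite : ∀ U : X.Opens, IsAffineOpen U →
    ∃ F : Γ(X, U) →+* Γ(X, U), (∀ a, F a = a ^ p) ∧ F.Finite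

/-! ### Weil divisors -/

/-- A prime divisor, given by its generic point: a point of codimension one. -/
abbrev PrimeDivisor (X : Scheme.{u}) : Type u := {x : X // Order.coheight x = 1}

/-- Weil divisors on a Noetherian scheme. -/
abbrev WeilDivisor (X : Scheme.{u}) : Type u := PrimeDivisor X →₀ ℤ

/-- `ℚ`-divisors on a Noetherian scheme. -/
abbrev QDivisor (X : Scheme.{u}) : Type u := PrimeDivisor X →₀ ℚ

/-- A Weil divisor regarded as a `ℚ`-divisor. -/
def WeilDivisor.toQ {X : Scheme.{u}} (D : WeilDivisor X) : QDivisor X :=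
  D.mapRange (fun n : ℤ => (n : ℚ)) Int.cast_zero

/-- `ℚ`-linear equivalence: some positive multiple of the difference is a principal divisor. -/
def QLinearEquiv {X : Scheme.{u}} [IsIntegral X] [IsLocallyNoetherian X]
    (D D' : QDivisor X) : Prop :=
  ∃ m : ℕ, 0 < m ∧ ∃ f : X.functionField, f ≠ 0 ∧
    ∀ x : PrimeDivisor X, (m : ℚ) * (D x - D' x) = (Scheme.ord f x.1 : ℚ)

/-- The sections of `𝒪_X(D)` over `U`, as a set of rational functions. -/
def divisorSections {X : Scheme.{u}} [IsIntegral X] [IsLocallyNoetherian X]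
    (D : WeilDivisor X) (U : X.Opens) : Set X.functionField :=
  {f | f ≠ 0 → ∀ z : PrimeDivisor X, z.1 ∈ U → 0 ≤ Scheme.ord f z.1 + D z}

/-- The stalk of `𝒪_X(D)` at `x`, as a submodule of the function field. (On a normal scheme the set
that spans it is already a submodule.) -/
def divisorStalk {X : Scheme.{u}} [IsIntegral X] [IsLocallyNoetherian X]
    (D : WeilDivisor X) (x : X) : Submodule (X.presheaf.stalk x) X.functionField :=
  Submodule.span _ {f | f ≠ 0 → ∀ z : PrimeDivisor X, z.1 ⤳ x → 0 ≤ Scheme.ord f z.1 + D z}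

/-! ### Canonical divisors -/

/-- The module `Ext^i_R(k, M)` for a local ring `R` with residue field `k`. -/
abbrev ExtResidue (R : Type u) [CommRing R] [IsLocalRing R] (M : Type u) [AddCommGroup M]
    [Module R M] (i : ℕ) : Type u :=
  Abelian.Ext (ModuleCat.of R (IsLocalRing.ResidueField R)) (ModuleCat.of R M) i

/-- A (Noetherian) local ring is Cohen-Macaulay if its depth is its dimension. -/
def IsCohenMacaulayLocal (R : Type u) [CommRing R] [IsLocalRing R] : Prop :=
  ∀ i : ℕ, ((i : ℕ∞) : WithBot ℕ∞) < ringKrullDim R → Subsingleton (ExtResidue R R i)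

/-- A finite module `M` over a Cohen-Macaulay local ring `R` of dimension `d` and residue field `k`
is dualizing if `Ext^d(k, M) ≅ k` and `Ext^i(k, M) = 0` for `i ≠ d`. -/
def IsDualizingModule (R : Type u) [CommRing R] [IsLocalRing R] (M : Type u) [AddCommGroup M]
    [Module R M] : Prop :=
  Module.Finite R M ∧ ∀ i : ℕ,
    (((i : ℕ∞) : WithBot ℕ∞) ≠ ringKrullDim R → Subsingleton (ExtResidue R M i)) ∧
    (((i : ℕ∞) : WithBot ℕ∞) = ringKrullDim R → Module.length R (ExtResidue R M i) = 1)

/-- `K` is a canonical divisor of the normal scheme `X`: the reflexive sheaf `𝒪_X(K)` agrees with a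
dualizing sheaf on the Cohen-Macaulay locus. -/
def IsCanonicalDivisor {X : Scheme.{u}} [IsIntegral X] [IsLocallyNoetherian X]
    (K : WeilDivisor X) : Prop :=
  ∀ x : X, IsCohenMacaulayLocal (X.presheaf.stalk x) →
    IsDualizingModule (X.presheaf.stalk x) (divisorStalk K x)

/-! ### Function fields and finite surjective morphisms -/

section Morphism

variable {X Y : Scheme.{u}} [IsIntegral X] [IsIntegral Y] (π : Y ⟶ X) [Surjective π]

lemma map_genericPoint : π (genericPoint Y) = genericPoint X := by
  have h := (genericPoint_spec Y).image π.continuous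
  apply h.eq
  rw [Set.image_univ, (Surjective.surj (f := π)).range_eq, closure_univ]
  exact genericPoint_spec X

lemma genericPoint_mem_preimage {U : X.Opens} (h : genericPoint X ∈ U) :
    genericPoint Y ∈ π ⁻¹ᵁ U := by
  change π (genericPoint Y) ∈ U
  rwa [map_genericPoint π]

/-- The inclusion of function fields `K(X) → K(Y)`. -/
def functionFieldMap : X.functionField →+* Y.functionField :=
  (π.stalkMap (genericPoint Y)).hom.comp
    (X.presheaf.stalkSpecializes (specializes_of_eq (map_genericPoint π))).hom

/-- `K(Y)` as an algebra over `K(X)`. -/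
abbrev functionFieldAlgebra : Algebra X.functionField Y.functionField :=
  (functionFieldMap π).toAlgebra

/-- The `K(X)`-linear maps `K(Y) → K(X)`. -/
abbrev RationalHom : Type u :=
  letI := functionFieldAlgebra π
  Y.functionField →ₗ[X.functionField] X.functionField

/-- The trace `K(Y) → K(X)`. -/
def rationalTrace : RationalHom π :=
  letI := functionFieldAlgebra π
  Algebra.trace X.functionField Y.functionField

/-- `K(Y)` is separable over `K(X)`. -/
def IsGenericallySeparable : Prop :=
  letI := functionFieldAlgebra π
  Algebra.IsSeparable X.functionField Y.functionField

end Morphism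

/-! ### Pull-back of divisors -/

/-- The order along `y` of a uniformizer of the local ring of `X` at the image of `y`. (It does not
depend on the uniformizer.) -/
def ramificationIndex {X Y : Scheme.{u}} [IsIntegral Y] [IsLocallyNoetherian Y] (π : Y ⟶ X)
    (y : PrimeDivisor Y) : ℤ :=
  open Classical in
  if h : ∃ t : X.presheaf.stalk (π y.1), Irreducible t then
    Scheme.ord (algebraMap (Y.presheaf.stalk y.1) Y.functionField
      ((π.stalkMap y.1).hom h.choose)) y.1
  else 0

/-- The coefficient of the pull-back of `D` along `y`: the coefficient of `D` along the image of `y`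
times the ramification index. (Under a finite surjective morphism of normal integral schemes the
image of a point of codimension one has codimension one.) -/
def pullbackCoeff {X Y : Scheme.{u}} [IsIntegral Y] [IsLocallyNoetherian Y] (π : Y ⟶ X)
    (D : QDivisor X) (y : PrimeDivisor Y) : ℚ :=
  open Classical in
  if h : Order.coheight (π y.1) = 1 then D ⟨π y.1, h⟩ * (ramificationIndex π y : ℚ) else 0

/-- The pull-back of a `ℚ`-divisor under a finite morphism. -/
def pullbackDivisor {X Y : Scheme.{u}} [IsIntegral Y] [IsLocallyNoetherian Y] (π : Y ⟶ X)
    [IsFinite π] (D : QDivisor X) : QDivisor Y :=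
  Finsupp.ofSupportFinite (pullbackCoeff π D) (by
    have hfin : ((fun y : PrimeDivisor Y => π y.1) ⁻¹'
        (Subtype.val '' (D.support : Set (PrimeDivisor X)))).Finite := by
      refine Set.Finite.preimage' (D.support.finite_toSet.image _) fun x _ => ?_
      exact Set.Finite.preimage (f := (Subtype.val : PrimeDivisor Y → Y))
        Subtype.val_injective.injOn (Scheme.Hom.finite_preimage_singleton π x)
    refine hfin.subset fun y hy => ?_
    rw [Function.mem_support, pullbackCoeff] at hy
    split_ifs at hy with h
    · exact ⟨⟨π y.1, h⟩, by simpa using left_ne_zero_of_mul hy, rfl⟩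
    · exact absurd rfl hy)

/-! ### `p^{-e}`-linear maps -/

/-- An invertible sheaf: locally isomorphic to the structure sheaf. -/
def IsInvertibleSheaf {X : Scheme.{u}} (L : X.Modules) : Prop :=
  ∀ x : X, ∃ U : X.Opens, x ∈ U ∧
    Nonempty (L.restrict U.ι ≅ (SheafOfModules.unit U.toScheme.ringCatSheaf : U.toScheme.Modules))

/-- Stalks of an `𝒪_X`-module are modules over the stalks of `𝒪_X`. -/
instance stalkModule {X : Scheme.{u}} (M : X.Modules) (x : X) :
    Module (X.presheaf.stalk x) (M.presheaf.stalk x) :=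
  PresheafOfModules.instModuleCarrierStalkCommRingCatCarrierAbPresheafOpensCarrier
    (R := X.presheaf) M.1 x

lemma germ_smul_stalkModule {X : Scheme.{u}} (M : X.Modules) (x : X) (U : X.Opens) (hx : x ∈ U)
    (r : Γ(X, U)) (m : Γ(M, U)) :
    M.presheaf.germ U x hx (r • m) = X.presheaf.germ U x hx r • M.presheaf.germ U x hx m :=
  PresheafOfModules.germ_smul (R := X.presheaf) M.1 x U hx r m

/-- An additive map `φ : M → R` is `p^{-e}`-linear, where `q = p ^ e`, if `φ (r ^ q • m) = r φ m`. -/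
def IsRootLinear (q : ℕ) {R M : Type*} [CommRing R] [AddCommGroup M] [Module R M]
    (φ : M →+ R) : Prop :=
  ∀ (r : R) (m : M), φ (r ^ q • m) = r * φ m

/-- A `p^{-e}`-linear map `M → 𝒪_X`, that is, an `𝒪_X`-linear map from `F^e_* M = M^{1/p^e}` to
`𝒪_X`; here `q = p ^ e`. -/
@[ext]
structure RootLinearMap (q : ℕ) {X : Scheme.{u}} (M : X.Modules) where
  app : ∀ U : X.Opens, Γ(M, U) →+ Γ(X, U)
  naturality : ∀ {U V : X.Opens} (i : U ⟶ V) (m : Γ(M, V)),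
    app U (M.presheaf.map i.op m) = X.presheaf.map i.op (app V m)
  isRootLinear : ∀ U : X.Opens, IsRootLinear q (app U)

instance {q : ℕ} {X : Scheme.{u}} (M : X.Modules) :
    Zero (RootLinearMap q M) :=
  ⟨⟨fun _ => 0, by simp, by intro U r m; simp⟩⟩

/-- The cocone of the maps `Γ(M, U) → Γ(X, U) → 𝒪_{X,x}`, for open neighbourhoods `U` of `x`. -/
def RootLinearMap.stalkCocone {q : ℕ} {X : Scheme.{u}} {M : X.Modules} (φ : RootLinearMap q M)
    (x : X) : Limits.Cocone ((OpenNhds.inclusion x).op ⋙ M.presheaf) where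
  pt := AddCommGrpCat.of (X.presheaf.stalk x)
  ι :=
    { app := fun U => AddCommGrpCat.ofHom
        ((X.presheaf.germ U.unop.1 x U.unop.2).hom.toAddMonoidHom.comp (φ.app U.unop.1))
      naturality := by
        intro U V i
        ext m
        have h := φ.naturality ((OpenNhds.inclusion x).map i.unop) m
        have h' := X.presheaf.germ_res_apply ((OpenNhds.inclusion x).map i.unop) x V.unop.2
          (φ.app U.unop.1 m)
        exact (congrArg (X.presheaf.germ V.unop.1 x V.unop.2) h).trans h' }

/-- The map induced by a `p^{-e}`-linear map on stalks. -/
def RootLinearMap.stalkMap {q : ℕ} {X : Scheme.{u}} {M : X.Modules} (φ : RootLinearMap q M)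
    (x : X) : M.presheaf.stalk x →+ X.presheaf.stalk x :=
  (Limits.colimit.desc ((OpenNhds.inclusion x).op ⋙ M.presheaf) (φ.stalkCocone x)).hom

lemma RootLinearMap.stalkMap_germ {q : ℕ} {X : Scheme.{u}} {M : X.Modules}
    (φ : RootLinearMap q M) (x : X) (U : X.Opens) (hx : x ∈ U) (m : Γ(M, U)) :
    φ.stalkMap x (M.presheaf.germ U x hx m) = X.presheaf.germ U x hx (φ.app U m) := by
  have h := Limits.colimit.ι_desc (F := (OpenNhds.inclusion x).op ⋙ M.presheaf)
    (RootLinearMap.stalkCocone φ x) (Opposite.op ⟨U, hx⟩)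
  exact congrArg (fun f => f.hom m) h

/-- `Φ` generates the module of `p^{-e}`-linear maps `R → R`, that is, `Hom_R(R^{1/p^e}, R)` as a
module over `R^{1/p^e}`; here `q = p ^ e`. -/
def IsRootGenerator (q : ℕ) {R : Type*} [CommRing R] (Φ : R →+ R) : Prop :=
  IsRootLinear q Φ ∧ ∀ ψ : R →+ R, IsRootLinear q ψ → ∃ g : R, ∀ a, ψ a = Φ (g * a)

/-- `Δ` is the `ℚ`-divisor associated with the nonzero `p^{-e}`-linear map `φ : L → 𝒪_X`, where `L`
is invertible and `q = p ^ e`. At a prime divisor `x`, trivialize `L_x` by a generator `l` and write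
`φ_x (a l) = Φ (f a)` with a generator `Φ`; the coefficient is the order of `f` over `q - 1`. -/
def RootLinearMap.HasDivisor {q : ℕ} {X : Scheme.{u}} [IsIntegral X] [IsLocallyNoetherian X]
    {L : X.Modules} (φ : RootLinearMap q L) (Δ : QDivisor X) : Prop :=
  ∀ x : PrimeDivisor X, ∃ l : L.presheaf.stalk x.1,
    Function.Bijective (fun a : X.presheaf.stalk x.1 => a • l) ∧
    ∃ Φ : X.presheaf.stalk x.1 →+ X.presheaf.stalk x.1, IsRootGenerator q Φ ∧
    ∃ f : X.presheaf.stalk x.1, f ≠ 0 ∧ (∀ a, φ.stalkMap x.1 (a • l) = Φ (f * a)) ∧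
      Δ x = (Scheme.ord (algebraMap _ X.functionField f) x.1 : ℚ) / ((q : ℚ) - 1)

/-! ### The divisor of a rational map, ramification, duality -/

section Rational

variable {X Y : Scheme.{u}} [IsIntegral X] [IsIntegral Y] (π : Y ⟶ X) [Surjective π]

/-- The stalk `(π_* 𝒪_Y)_x`, as a set of rational functions on `Y`. -/
def pushforwardStalk (x : X) : Set Y.functionField :=
  {z | ∃ (U : X.Opens) (_ : x ∈ U) (h : genericPoint Y ∈ π ⁻¹ᵁ U) (s : Γ(Y, π ⁻¹ᵁ U)),
    Y.presheaf.germ (π ⁻¹ᵁ U) (genericPoint Y) h s = z}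

/-- The `K(X)`-linear map `Ψ : K(Y) → K(X)` maps `(π_* 𝒪_Y)_x` to `𝒪_{X,x}`. As
`(π_* 𝒪_Y)_x` spans `K(Y)`, these `Ψ` are the elements of the dual of `(π_* 𝒪_Y)_x`. -/
def IsIntegralAt (x : X) (Ψ : RationalHom π) : Prop :=
  ∀ z ∈ pushforwardStalk π x, Ψ z ∈ Set.range (algebraMap (X.presheaf.stalk x) X.functionField)

/-- `Φ` generates the dual of `(π_* 𝒪_Y)_x` as a module over `(π_* 𝒪_Y)_x`. -/
def IsDualGenerator (x : X) (Φ : RationalHom π) : Prop :=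
  IsIntegralAt π x Φ ∧ ∀ Ψ : RationalHom π, IsIntegralAt π x Ψ →
    ∃ g ∈ pushforwardStalk π x, ∀ z, Ψ z = Φ (g * z)

/-- `R` is the divisor of the nonzero map `T`, regarded as a rational section of the rank one
reflexive `𝒪_Y`-module `Hom_{𝒪_X}(π_* 𝒪_Y, 𝒪_X) ≅ 𝒪_Y(K_Y - π^* K_X)`. At a prime divisor `y`,
write `T = Φ (s · )` with a local generator `Φ`; the coefficient is the order of `s`. -/
def RationalHom.HasDivisor [IsLocallyNoetherian Y] {π : Y ⟶ X} [Surjective π] (T : RationalHom π)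
    (R : WeilDivisor Y) : Prop :=
  ∀ y : PrimeDivisor Y, ∃ Φ : RationalHom π, IsDualGenerator π (π y.1) Φ ∧
    ∃ s : Y.functionField, s ≠ 0 ∧ (∀ z, T z = Φ (s * z)) ∧ R y = Scheme.ord s y.1

/-- `R` is the ramification divisor: its coefficient at `y` is the length of the stalk of the
relative differentials. -/
def IsRamificationDivisor {X Y : Scheme.{u}} (π : Y ⟶ X) (R : WeilDivisor Y) : Prop :=
  ∀ y : PrimeDivisor Y,
    letI := (π.stalkMap y.1).hom.toAlgebra
    ∃ n : ℕ, Module.length (Y.presheaf.stalk y.1)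
      (KaehlerDifferential (X.presheaf.stalk (π y.1)) (Y.presheaf.stalk y.1)) = n ∧ R y = n

/-- `𝒪_Y(K_Y) ≅ π^! 𝒪_X(K_X)`, that is, `π_* 𝒪_Y(K_Y) ≅ Hom_{𝒪_X}(π_* 𝒪_Y, 𝒪_X(K_X))` as
`π_* 𝒪_Y`-modules. Such an isomorphism is `z ↦ Θ (z · )` for a nonzero `Θ : K(Y) → K(X)`, since at
the generic point it is a `K(Y)`-linear isomorphism from `K(Y)` to the dual of `K(Y)`. -/
def IsUpperShriek [IsLocallyNoetherian X] [IsLocallyNoetherian Y]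
    (KX : WeilDivisor X) (KY : WeilDivisor Y) : Prop :=
  ∃ Θ : RationalHom π, Θ ≠ 0 ∧
    ∀ U : X.Opens, IsAffineOpen U → ∀ h : genericPoint Y ∈ π ⁻¹ᵁ U, ∀ z : Y.functionField,
      z ∈ divisorSections KY (π ⁻¹ᵁ U) ↔
        ∀ s : Γ(Y, π ⁻¹ᵁ U),
          Θ (z * Y.presheaf.germ (π ⁻¹ᵁ U) (genericPoint Y) h s) ∈ divisorSections KX U

end Rational

/-! ### Transposes and extensions -/

/-- The pull-back of sections, `Γ(L, U) → Γ(π^* L, π⁻¹ U)`. -/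
def pullbackSection {X Y : Scheme.{u}} (π : Y ⟶ X) (L : X.Modules) {U : X.Opens} (l : Γ(L, U)) :
    Γ((Scheme.Modules.pullback π).obj L, π ⁻¹ᵁ U) :=
  ((Scheme.Modules.pullbackPushforwardAdjunction π).unit.app L).app U l

/-- `ψ : π^* L → 𝒪_Y` is a `T`-transpose of `φ : L → 𝒪_X`, that is, `T ∘ ψ = φ ∘ α`. Here
`α : π_* π^* L → L ⊗ K(X) = L_ξ`, with `ξ` the generic point, is the map induced by `T`, which sends
a local section `s ⊗ l` of `π_* 𝒪_Y ⊗ L = π_* π^* L` to `T(s) l`. -/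
def IsTranspose {q : ℕ} {X Y : Scheme.{u}} [IsIntegral X] [IsIntegral Y] {π : Y ⟶ X}
    [Surjective π] (T : RationalHom π) {L : X.Modules} (φ : RootLinearMap q L)
    (ψ : RootLinearMap q ((Scheme.Modules.pullback π).obj L)) : Prop :=
  ∀ (U : X.Opens) (h : genericPoint X ∈ U) (s : Γ(Y, π ⁻¹ᵁ U)) (l : Γ(L, U)),
    T (Y.presheaf.germ (π ⁻¹ᵁ U) (genericPoint Y) (genericPoint_mem_preimage π h)
        (ψ.app (π ⁻¹ᵁ U) (s • pullbackSection π L l))) =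
      φ.stalkMap (genericPoint X)
        ((show X.presheaf.stalk (genericPoint X) from
          T (Y.presheaf.germ (π ⁻¹ᵁ U) (genericPoint Y) (genericPoint_mem_preimage π h) s)) •
            L.presheaf.germ U (genericPoint X) h l)

/-- `ψ : π^* L → 𝒪_Y` extends `φ : L → 𝒪_X`. -/
def IsExtension {q : ℕ} {X Y : Scheme.{u}} {π : Y ⟶ X} {L : X.Modules} (φ : RootLinearMap q L)
    (ψ : RootLinearMap q ((Scheme.Modules.pullback π).obj L)) : Prop :=
  ∀ (U : X.Opens) (l : Γ(L, U)), ψ.app (π ⁻¹ᵁ U) (pullbackSection π L l) = π.app U (φ.app U l)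

end FrobeniusTranspose

end

noncomputable section

namespace FrobeniusTranspose

variable {X Y : Scheme.{u}}

/-! ### Invertible sheaves and their pull-backs -/

/-! Everything is compared inside the function fields K = K(X) and M = K(Y). Once a local generator
of L is chosen, φ becomes a p^{-e}-linear map K → K, and a transpose is a p^{-e}-linear map ψ : M →
M with T ∘ ψ = φ ∘ T. At this level ψ always exists: a nonzero T spans Hom_K(M, K) over M, so the
K-linear functional w ↦ φ(T(w^q z)) has the form T(ψ(z) w) (`IsSemilinear.exists_eq`,
`IsSemilinear.exists_transpose`). The only question is integrality of ψ, which on a normal scheme is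
decided in codimension one (`exists_section_of_forall_coheight_one`).

All divisors are read off from one invariant: `HasOrder T 𝒜 ℬ f` says that {z | T(zℬ) ⊆ 𝒜} is f⁻¹ℬ.
Orders multiply under composition (`HasOrder.comp`, `HasOrder.of_comp`). At a prime divisor let T
have order s and φ order f. Then φ ∘ T has order s σ(f), and T ∘ ψ has order g s^q if ψ has order g;
hence g = s σ(f) / s^q. Taking valuations and dividing by q - 1 gives Δ_ψ = π^*Δ_φ - R_T, and ψ is
integral exactly when this is nonnegative. Orders exist because (π_* 𝒪_Y)_x is a semilocal Dedekind
domain, hence principal, when x has codimension one; `HasOrder.localization` carries the formula to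
𝒪_{Y,y}. If Θ realizes 𝒪_Y(K_Y) ≅ π^! 𝒪_X(K_X), then K_Y = div Θ + π^*K_X, and writing T = Θ(g · )
changes div Θ by the principal divisor div g.

In the separable case M = K · M^q and Tr(w^q) = Tr(w)^q, so extensions of φ are the same as
transposes for the trace (`forall_algebraMap_iff_forall_trace`). To identify R_Tr with the
ramification divisor, the order of one extension is computed in a second way. The discrete valuation
rings A = 𝒪_{X,x} and B = 𝒪_{Y,y} have p-bases x and y
(`exists_isRootBasis_of_isDiscreteValuationRing`), and the p-th root of the top coefficient
generates the p^{-1}-linear maps. By separability x remains a p-basis of M, so the generator for A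
extends to the top coefficient root for x on M. By the Cartier formula, passing from x to y inserts
the factor J^{p-1}, where J is the Jacobian determinant (`IsPBasis.coeff_eq_coeff_jacobian`). Thus
the extension has order J^{-(p-1)}, whereas the transposition formula gives s^{-(p-1)}; so s and J
have the same valuation. Finally Ω_{B/A} is the cokernel of the transposed Jacobian matrix, whence
its length is the order of J (`IsRootBasis.length_kaehlerDifferential`). -/

instance opensMap_final {S T : TopCat.{u}} (f : S ⟶ T) : (Opens.map f).Final where
  -- The whole space is a terminal object of each comma category. Finality is what makes the
  -- pull-back of the unit sheaf the unit sheaf.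
  out V := isConnected_of_isTerminal _ (Limits.IsTerminal.ofUniqueHom
    (Y := StructuredArrow.mk (T := Opens.map f) (Y := (⊤ : Opens T))
      (homOfLE le_top : V ⟶ (Opens.map f).obj ⊤))
    (fun Z => StructuredArrow.homMk (homOfLE le_top) (Subsingleton.elim _ _))
    (fun Z m => by ext; exact Subsingleton.elim _ _))

/-- The structure sheaf as a sheaf of modules. -/
def structureModule (X : Scheme.{u}) : X.Modules := SheafOfModules.unit X.ringCatSheaf

/-- A function, as a section of the structure sheaf regarded as a sheaf of modules. -/
def structureModule.mk {U : X.Opens} (a : Γ(X, U)) : Γ(structureModule X, U) := a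

lemma structureModule.smul_mk {U : X.Opens} (a b : Γ(X, U)) :
    a • structureModule.mk b = structureModule.mk (a * b) := rfl

lemma structureModule.map_mk {U V : X.Opens} (i : V ⟶ U) (a : Γ(X, U)) :
    (structureModule X).presheaf.map i.op (structureModule.mk a) =
      structureModule.mk (X.presheaf.map i.op a) := rfl

/-- The pull-back of the structure sheaf is the structure sheaf. -/
def pullbackUnitIso (f : Y ⟶ X) :
    (Scheme.Modules.pullback f).obj (structureModule X) ≅ structureModule Y :=
  haveI : (SheafOfModules.pushforward (Scheme.Hom.toRingCatSheafHom f)).IsRightAdjoint :=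
    inferInstanceAs (Scheme.Modules.pushforward f).IsRightAdjoint
  haveI : (Opens.map f.base).Final := opensMap_final _
  let i := @asIso _ _ _ _ _
    (SheafOfModules.instIsIsoPullbackObjUnitToUnitOfFinal f.toRingCatSheafHom)
  ⟨i.hom, i.inv, i.hom_inv_id, i.inv_hom_id⟩

/-- The map `𝒪_X → f_* 𝒪_Y`. -/
def structureModuleHom (f : Y ⟶ X) :
    structureModule X ⟶ (Scheme.Modules.pushforward f).obj (structureModule Y) :=
  SheafOfModules.unitToPushforwardObjUnit f.toRingCatSheafHom

/-- Restriction to an open set is itself a pull-back, so this is functoriality of pull-back along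
the square of `π ∣_ U` and `π`. -/
lemma nonempty_pullback_restrict_iso (π : Y ⟶ X) {L : X.Modules} {U : X.Opens}
    (i : L.restrict U.ι ≅ structureModule U.toScheme) :
    Nonempty (((Scheme.Modules.pullback π).obj L).restrict (π ⁻¹ᵁ U).ι ≅
      structureModule (π ⁻¹ᵁ U).toScheme) :=
  ⟨(Scheme.Modules.restrictFunctorIsoPullback (π ⁻¹ᵁ U).ι).app _ ≪≫
    (Scheme.Modules.pullbackComp (π ⁻¹ᵁ U).ι π).app L ≪≫
    (Scheme.Modules.pullbackCongr (morphismRestrict_ι π U).symm).app L ≪≫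
    ((Scheme.Modules.pullbackComp (π ∣_ U) U.ι).app L).symm ≪≫
    (Scheme.Modules.pullback (π ∣_ U)).mapIso
      (((Scheme.Modules.restrictFunctorIsoPullback U.ι).app L).symm ≪≫ i) ≪≫ pullbackUnitIso _⟩

/-- `l` generates `M` freely over `U`. -/
def IsGeneratingSection (M : X.Modules) (U : X.Opens) (l : Γ(M, U)) : Prop :=
  ∀ (V : X.Opens) (i : V ⟶ U), Function.Bijective fun a : Γ(X, V) => a • M.presheaf.map i.op l

lemma exists_isGeneratingSection {M : X.Modules} {U : X.Opens}
    (i : M.restrict U.ι ≅ structureModule U.toScheme) : ∃ l, IsGeneratingSection M U l := by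
  let l0 : Γ(M, U.ι ''ᵁ ⊤) := i.inv.app ⊤ (structureModule.mk 1)
  refine ⟨M.presheaf.map (eqToHom (by simp)).op l0, fun V j => ?_⟩
  obtain ⟨W, rfl⟩ : ∃ W : U.toScheme.Opens, V = U.ι ''ᵁ W :=
    ⟨U.ι ⁻¹ᵁ V, by
      simp only [Scheme.Hom.image_preimage_eq_opensRange_inf, Scheme.Opens.opensRange_ι]
      exact (inf_eq_right.mpr j.le).symm⟩
  have h1 : M.presheaf.map j.op (M.presheaf.map (eqToHom (by simp)).op l0) =
      i.inv.app W (structureModule.mk 1) := by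
    have h3 := ConcreteCategory.congr_hom ((Scheme.Modules.Hom.mapPresheaf i.inv).naturality
      (homOfLE le_top : W ⟶ ⊤).op) (structureModule.mk 1)
    have h4 := structureModule.map_mk (homOfLE le_top : W ⟶ ⊤) 1
    rw [map_one] at h4
    rw [← ConcreteCategory.comp_apply, ← Functor.map_comp]
    exact h3.symm.trans (congrArg (i.inv.app W) h4)
  rw [h1]
  have hb : Function.Bijective (i.inv.app W) :=
    Function.bijective_iff_has_inverse.mpr ⟨i.hom.app W,
      fun a => congr($(congrArg (fun f => Scheme.Modules.Hom.app f W) i.inv_hom_id) a),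
      fun a => congr($(congrArg (fun f => Scheme.Modules.Hom.app f W) i.hom_inv_id) a)⟩
  -- Scalars on the restricted module act through `appIso`, so multiplication on `M` differs from
  -- the trivialization by this bijection.
  have ha : Function.Bijective (U.ι.appIso W).hom := ConcreteCategory.bijective_of_isIso _
  refine (congrArg Function.Bijective (funext fun a => ?_)).mpr (hb.comp ha)
  have h5 := Scheme.Modules.Hom.app_smul i.inv ((U.ι.appIso W).hom a) (structureModule.mk 1)
  rw [structureModule.smul_mk, mul_one] at h5
  refine Eq.trans ?_ h5.symm
  have h7 : (U.ι.appIso W).inv ((U.ι.appIso W).hom a) = a :=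
    congr($((U.ι.appIso W).hom_inv_id) a)
  have h8 : ∀ m : Γ(M.restrict U.ι, W), ((U.ι.appIso W).hom a) • m =
      ((U.ι.appIso W).inv ((U.ι.appIso W).hom a)) • (show Γ(M, U.ι ''ᵁ W) from m) := fun m => rfl
  rw [h8, h7]

lemma IsGeneratingSection.stalk {M : X.Modules} {U : X.Opens} {l : Γ(M, U)}
    (h : IsGeneratingSection M U l) (x : X) (hx : x ∈ U) :
    Function.Bijective fun a : X.presheaf.stalk x => a • M.presheaf.germ U x hx l := by
  constructor
  · intro a b hab
    obtain ⟨V, hV, iV, a, b, rfl, rfl⟩ : ∃ (V : X.Opens) (hV : x ∈ V) (iV : V ⟶ U)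
        (a' b' : Γ(X, V)), X.presheaf.germ V x hV a' = a ∧ X.presheaf.germ V x hV b' = b := by
      obtain ⟨V₁, h₁, a, rfl⟩ := X.presheaf.exists_germ_eq a
      obtain ⟨V₂, h₂, b, rfl⟩ := X.presheaf.exists_germ_eq b
      exact ⟨V₁ ⊓ V₂ ⊓ U, ⟨⟨h₁, h₂⟩, hx⟩, homOfLE inf_le_right,
        X.presheaf.map (homOfLE (inf_le_left.trans inf_le_left)).op a,
        X.presheaf.map (homOfLE (inf_le_left.trans inf_le_right)).op b,
        X.presheaf.germ_res_apply _ _ _ _, X.presheaf.germ_res_apply _ _ _ _⟩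
    have e := M.presheaf.germ_res_apply iV x hV l
    simp only [← e, ← germ_smul_stalkModule] at hab
    obtain ⟨W, hW, i₁, i₂, h'⟩ := M.presheaf.germ_eq x hV hV _ _ hab
    obtain rfl : i₁ = i₂ := Subsingleton.elim _ _
    simp only [Scheme.Modules.map_smul, ← ConcreteCategory.comp_apply, ← Functor.map_comp,
      ← op_comp] at h'
    have := (h W (i₁ ≫ iV)).1 h'
    rw [← X.presheaf.germ_res_apply i₁ x hW, this, X.presheaf.germ_res_apply]
  · intro m
    obtain ⟨V₁, h₁, m, rfl⟩ := M.presheaf.exists_germ_eq m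
    obtain ⟨V, hV, i₁, i₂⟩ : ∃ V : X.Opens, x ∈ V ∧ V ≤ V₁ ∧ V ≤ U :=
      ⟨V₁ ⊓ U, ⟨h₁, hx⟩, inf_le_left, inf_le_right⟩
    obtain ⟨a, ha⟩ := (h V (homOfLE i₂)).2 (M.presheaf.map (homOfLE i₁).op m)
    refine ⟨X.presheaf.germ V x hV a, ?_⟩
    dsimp only at ha ⊢
    rw [← M.presheaf.germ_res_apply (homOfLE i₂) x hV l, ← germ_smul_stalkModule, ha,
      M.presheaf.germ_res_apply]

lemma IsGeneratingSection.smul_of_isUnit {M : X.Modules} {U : X.Opens} {l : Γ(M, U)}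
    (h : IsGeneratingSection M U l) {g : Γ(X, U)} (hg : IsUnit g) :
    IsGeneratingSection M U (g • l) := by
  intro V i
  have hu : IsUnit (X.presheaf.map i.op g) := hg.map (X.presheaf.map i.op).hom
  refine (congrArg Function.Bijective (funext fun a => ?_)).mpr
    ((h V i).comp (Units.mulRight_bijective hu.unit))
  simp [mul_smul]

-- The pull-back has some generator `l'` over the preimage, and the pulled-back section is `g' •
-- l'`. To see that `g'` is a unit, the adjoint `w` of L → 𝒪_U → π_* 𝒪_V is evaluated: it sends the
-- pulled-back section to a unit, and that unit is a multiple of `g'`.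
open Scheme.Modules in
lemma IsGeneratingSection.pullbackSection (π : Y ⟶ X) {L : X.Modules} {U : X.Opens}
    (i : L.restrict U.ι ≅ structureModule U.toScheme) {l : Γ(L, U)}
    (h : IsGeneratingSection L U l)  :
    IsGeneratingSection ((pullback π).obj L) (π ⁻¹ᵁ U) (pullbackSection π L l) := by
  let V := π ⁻¹ᵁ U
  let OV := structureModule V.toScheme
  let OU := structureModule U.toScheme
  let v₁ : L ⟶ (pushforward U.ι).obj OU :=
    (restrictAdjunction U.ι).unit.app L ≫ (pushforward U.ι).map i.hom
  let v₂ : (pushforward U.ι).obj OU ⟶ (pushforward π).obj ((pushforward V.ι).obj OV) :=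
    (pushforward U.ι).map (structureModuleHom (π ∣_ U)) ≫
      (pushforwardComp (π ∣_ U) U.ι).hom.app OV ≫
      (pushforwardCongr (morphismRestrict_ι π U)).hom.app OV ≫ (pushforwardComp V.ι π).inv.app OV
  let w : (pullback π).obj L ⟶ (pushforward V.ι).obj OV :=
    ((pullbackPushforwardAdjunction π).homEquiv _ _).symm (v₁ ≫ v₂)
  have hw : (pullbackPushforwardAdjunction π).unit.app L ≫ (pushforward π).map w = v₁ ≫ v₂ := by
    have := ((pullbackPushforwardAdjunction π).homEquiv _ _).apply_symm_apply (v₁ ≫ v₂)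
    rwa [Adjunction.homEquiv_unit] at this
  have hw' : w.app V (FrobeniusTranspose.pullbackSection π L l) = v₂.app U (v₁.app U l) := by
    have := congrArg (fun f => Hom.app f U) hw
    exact congr($this l)
  obtain ⟨g, hg⟩ : ∃ g : Γ(U.toScheme, U.ι ⁻¹ᵁ U), v₁.app U l = structureModule.mk g := ⟨_, rfl⟩
  -- The section of `L` corresponding to 1 is `a • l` for some `a`, which makes `a * g = 1`.
  have hgu : IsUnit g := by
    obtain ⟨a, ha⟩ := (h (U.ι ''ᵁ (U.ι ⁻¹ᵁ U)) (homOfLE (U.ι.image_preimage_le U))).2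
      (i.inv.app (U.ι ⁻¹ᵁ U) (structureModule.mk 1))
    have h1 := congrArg (i.hom.app (U.ι ⁻¹ᵁ U)) ha
    have h2 : i.hom.app (U.ι ⁻¹ᵁ U) (i.inv.app (U.ι ⁻¹ᵁ U) (structureModule.mk 1)) =
      structureModule.mk 1 := congr($(congrArg (fun f => Hom.app f (U.ι ⁻¹ᵁ U)) i.inv_hom_id) _)
    rw [h2] at h1
    have h7 : (U.ι.appIso (U.ι ⁻¹ᵁ U)).inv ((U.ι.appIso (U.ι ⁻¹ᵁ U)).hom a) = a :=
      congr($((U.ι.appIso (U.ι ⁻¹ᵁ U)).hom_inv_id) a)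
    have h8 : ∀ m : Γ(L.restrict U.ι, U.ι ⁻¹ᵁ U), ((U.ι.appIso (U.ι ⁻¹ᵁ U)).hom a) • m =
      ((U.ι.appIso (U.ι ⁻¹ᵁ U)).inv ((U.ι.appIso (U.ι ⁻¹ᵁ U)).hom a)) •
        (show Γ(L, U.ι ''ᵁ (U.ι ⁻¹ᵁ U)) from m) := fun m => rfl
    dsimp only at h1
    rw [h7] at h8
    have h3 := (congrArg (i.hom.app (U.ι ⁻¹ᵁ U)) (h8 _)).trans h1
    have h4 := (Hom.app_smul i.hom ((U.ι.appIso (U.ι ⁻¹ᵁ U)).hom a) _).symm.trans h3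
    have h5 : (U.ι.appIso (U.ι ⁻¹ᵁ U)).hom a • structureModule.mk g = structureModule.mk 1 := by
      rw [← hg]; exact h4
    exact IsUnit.of_mul_eq_one_right _ h5
  obtain ⟨u, hu, hu'⟩ : ∃ u : Γ(V.toScheme, V.ι ⁻¹ᵁ V), IsUnit u ∧
      w.app V (FrobeniusTranspose.pullbackSection π L l) = structureModule.mk u := by
    rw [hw', hg]
    refine ⟨V.toScheme.presheaf.map (eqToHom (by simp)).op ((π ∣_ U).app _ g), ?_, rfl⟩
    exact (hgu.map ((π ∣_ U).app _).hom).map (V.toScheme.presheaf.map _).hom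
  obtain ⟨j⟩ := nonempty_pullback_restrict_iso π i
  obtain ⟨l', hl'⟩ := exists_isGeneratingSection j
  obtain ⟨g', hg'⟩ := (hl' V (𝟙 V)).2 (FrobeniusTranspose.pullbackSection π L l)
  obtain ⟨k, hk⟩ : ∃ k : Γ(V.toScheme, V.ι ⁻¹ᵁ V), w.app V l' = structureModule.mk k := ⟨_, rfl⟩
  have e : ((pullback π).obj L).presheaf.map (𝟙 V : V ⟶ V).op l' = l' := by simp
  dsimp only at hg'
  rw [e] at hg'
  have h1 := Hom.app_smul w g' l'
  rw [hg', hu', hk] at h1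
  have h2 : u = V.ι.app V g' * k := h1
  rw [← hg']
  refine hl'.smul_of_isUnit ?_
  have h3 : IsUnit (V.ι.app V g') := isUnit_of_mul_isUnit_left (h2 ▸ hu)
  have : IsIso (V.ι.app V) := Scheme.Hom.isIso_app V.ι V (by simp)
  exact (isUnit_map_iff (V.ι.app V).hom g').mp h3

end FrobeniusTranspose

/-! ### Algebra in characteristic p: p-bases, the Cartier formula and differentials -/

namespace FrobeniusTranspose

/-! ### `p`-bases -/

section PBasis

set_option linter.unusedSectionVars false

variable {R S : Type*} [CommRing R] [CommRing S] [Algebra R S]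
variable {ι : Type*} [Fintype ι] [DecidableEq ι] {p : ℕ}

/-- The monomial `∏ xᵢ ^ kᵢ`. -/
def mono (x : ι → S) (k : ι → ℕ) : S := ∏ i, x i ^ k i

lemma mono_add (x : ι → S) (k l : ι → ℕ) : mono x (k + l) = mono x k * mono x l := by
  simp [mono, pow_add, Finset.prod_mul_distrib]

lemma mono_nsmul (x : ι → S) (n : ℕ) (k : ι → ℕ) : mono x (n • k) = mono x k ^ n := by
  simp [mono, pow_mul', Finset.prod_pow]

lemma mono_single (x : ι → S) (i : ι) (n : ℕ) : mono x (Pi.single i n) = x i ^ n := by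
  rw [mono, Finset.prod_eq_single i] <;> simp +contextual

lemma mono_eq_mul (x : ι → S) {k : ι → ℕ} {i : ι} (h : k i ≠ 0) :
    mono x k = mono x (k - Pi.single i 1) * x i := by
  have : k = (k - Pi.single i 1) + Pi.single i 1 := by
    ext j
    by_cases hj : j = i
    · subst hj; simp; omega
    · simp [hj]
  conv_lhs => rw [this, mono_add, mono_single, pow_one]

/-- The monomials `∏ xᵢ ^ mᵢ`, `0 ≤ mᵢ < p`, form a basis of `S` over `R`. -/
def IsPBasis (p : ℕ) (R : Type*) {S : Type*} [CommRing R] [CommRing S] [Algebra R S]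
    {ι : Type*} [Fintype ι] (x : ι → S) : Prop :=
  LinearIndependent R (fun m : ι → Fin p => mono x fun i => (m i : ℕ)) ∧
    ⊤ ≤ Submodule.span R (Set.range fun m : ι → Fin p => mono x fun i => (m i : ℕ))

namespace IsPBasis

variable {x : ι → S} (h : IsPBasis p R x)

/-- The basis of monomials. -/
def basis : Module.Basis (ι → Fin p) R S := Module.Basis.mk h.1 h.2

lemma basis_apply (m : ι → Fin p) : h.basis m = mono x fun i => (m i : ℕ) := by
  simp [basis]

variable [hp : Fact p.Prime]

/-- The exponent vector with all entries `p - 1`. -/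
def top : ι → Fin p := fun _ => ⟨p - 1, Nat.sub_lt hp.1.pos one_pos⟩

/-- The coefficient of the top monomial. -/
def coeff : S →ₗ[R] R := h.basis.coord top

end IsPBasis

variable [hp : Fact p.Prime]

/-- The reduction of an exponent vector modulo `p`. -/
def modP (k : ι → ℕ) : ι → Fin p := fun i => ⟨k i % p, Nat.mod_lt _ hp.1.pos⟩

/-- Split `k` as p · (k / p) plus the remainder: the first part contributes a p-th power, which is a
scalar. -/
lemma mono_eq_smul (hR : ∀ s : S, ∃ r : R, algebraMap R S r = s ^ p) (x : ι → S) (k : ι → ℕ) :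
    ∃ r : R, algebraMap R S r = mono x (p • fun i => k i / p) ∧
      mono x k = r • mono x fun i => (modP (p := p) k i : ℕ) := by
  obtain ⟨r, hr⟩ := hR (mono x fun i => k i / p)
  refine ⟨r, by rw [hr, mono_nsmul], ?_⟩
  rw [Algebra.smul_def, hr, ← mono_nsmul, ← mono_add]
  congr 1
  ext i
  simp [modP, Nat.div_add_mod]

namespace IsPBasis

variable {x : ι → S} (h : IsPBasis p R x) 

lemma coeff_mono_fin (m : ι → Fin p) [Decidable (m = top)] :
    h.coeff (mono x fun i => (m i : ℕ)) = if m = top then 1 else 0 := by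
  classical
  rw [coeff, ← h.basis_apply, Module.Basis.coord_apply, Module.Basis.repr_self,
    Finsupp.single_apply]

lemma coeff_mono_eq_one {k : ι → ℕ} (hk : ∀ i, k i = p - 1) : h.coeff (mono x k) = 1 := by
  classical
  have := h.coeff_mono_fin top
  rw [if_pos rfl] at this
  convert this
  exact hk _

lemma coeff_mono_eq_zero (hR : ∀ s : S, ∃ r : R, algebraMap R S r = s ^ p) {k : ι → ℕ} {i : ι}
    (hk : k i % p ≠ p - 1) : h.coeff (mono x k) = 0 := by
  classical
  obtain ⟨r, -, hr⟩ := mono_eq_smul hR x k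
  rw [hr, map_smul, coeff_mono_fin, if_neg, smul_zero]
  intro hm
  exact hk (congrArg Fin.val (congrFun hm i))

lemma adjoin_eq_top (h : IsPBasis p R x) : Algebra.adjoin R (Set.range x) = ⊤ := by
  rw [← Algebra.toSubmodule_eq_top, eq_top_iff]
  refine h.2.trans (Submodule.span_le.mpr ?_)
  rintro _ ⟨m, rfl⟩
  exact Subalgebra.prod_mem _ fun i _ => pow_mem (Algebra.subset_adjoin (Set.mem_range_self i)) _

lemma derivation_ext (h : IsPBasis p R x) {D D' : Derivation R S S} (hD : ∀ i, D (x i) = D' (x i)) : D = D' := by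
  refine Derivation.ext_of_adjoin_eq_top _ h.adjoin_eq_top ?_
  rintro _ ⟨i, rfl⟩
  exact hD i

lemma _root_.Derivation.sum_apply {κ : Type*} (s : Finset κ) (D : κ → Derivation R S S) (z : S) :
    (∑ j ∈ s, D j) z = ∑ j ∈ s, D j z := by
  rw [← Derivation.coeFnAddMonoidHom_apply, map_sum, Finset.sum_apply]
  rfl

/-- The partial derivative, as a linear map. -/
def partialLinear (i : ι) : S →ₗ[R] S :=
  h.basis.constr R fun m => (m i : ℕ) • mono x ((fun j => (m j : ℕ)) - Pi.single i 1)

variable [CharP S p]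

/-- The usual rule persists for exponents beyond p - 1 because p-th powers are scalars and `k i`
matters only modulo p; if p divides `k i`, both sides vanish. -/
lemma partialLinear_mono (hR : ∀ s : S, ∃ r : R, algebraMap R S r = s ^ p) (i : ι) (k : ι → ℕ) :
    h.partialLinear i (mono x k) = k i • mono x (k - Pi.single i 1) := by
  obtain ⟨r, hr, hk⟩ := mono_eq_smul hR x k
  have h1 : h.partialLinear i (mono x fun j => (modP (p := p) k j : ℕ)) =
      (k i % p) • mono x ((fun j => (modP (p := p) k j : ℕ)) - Pi.single i 1) := by
    rw [partialLinear, ← h.basis_apply, Module.Basis.constr_basis]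
    rfl
  rw [hk, map_smul, h1]
  have h2 : (k i % p : ℕ) • mono x ((fun j => (modP (p := p) k j : ℕ)) - Pi.single i 1) =
      k i • mono x ((fun j => (modP (p := p) k j : ℕ)) - Pi.single i 1) := by
    rw [nsmul_eq_mul, nsmul_eq_mul, CharP.cast_eq_mod S p (k i)]
  by_cases hi : k i % p = 0
  · have : (k i : S) = 0 := by rw [CharP.cast_eq_mod S p, hi, Nat.cast_zero]
    rw [h2, nsmul_eq_mul, nsmul_eq_mul, this]; simp
  · rw [h2, smul_comm, Algebra.smul_def r, hr, ← mono_add]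
    congr 2
    ext j
    by_cases hj : j = i
    · subst hj
      have := Nat.div_add_mod (k j) p
      simp only [Pi.add_apply, Pi.smul_apply, smul_eq_mul, Pi.sub_apply, modP, Pi.single_eq_same]
      omega
    · simp [hj, modP, Nat.div_add_mod]

variable (hR : ∀ s : S, ∃ r : R, algebraMap R S r = s ^ p)

/-- The partial derivatives with respect to a `p`-basis. -/
def partialDeriv (i : ι) : Derivation R S S :=
  Derivation.mk' (h.partialLinear i) (by
    intro a b
    -- Both sides of the Leibniz rule are bilinear over `R`, so monomials suffice.
    have key : ∀ k l : ι → ℕ, h.partialLinear i (mono x k * mono x l) =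
        mono x k • h.partialLinear i (mono x l) + mono x l • h.partialLinear i (mono x k) := by
      intro k l
      rw [← mono_add, h.partialLinear_mono hR, h.partialLinear_mono hR, h.partialLinear_mono hR]
      have e : ∀ k l : ι → ℕ, mono x k • l i • mono x (l - Pi.single i 1) =
          l i • mono x (k + l - Pi.single i 1) := by
        intro k l
        by_cases hl : l i = 0
        · simp [hl]
        · rw [smul_eq_mul, mul_smul_comm, ← mono_add]
          congr 2
          ext j
          by_cases hj : j = i
          · subst hj; simp; omega
          · simp [hj]
      rw [e, e, add_comm l k, ← add_smul, add_comm (l i)]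
      rfl
    induction h.2 (Submodule.mem_top (x := a)) using Submodule.span_induction with
    | mem a ha =>
      obtain ⟨m, rfl⟩ := ha
      induction h.2 (Submodule.mem_top (x := b)) using Submodule.span_induction with
      | mem b hb => obtain ⟨n, rfl⟩ := hb; exact key _ _
      | zero => simp
      | add b b' _ _ hb hb' => rw [mul_add, map_add, hb, hb', map_add, smul_add, add_smul]; abel
      | smul r b _ hb =>
        rw [mul_smul_comm, map_smul, hb, map_smul, smul_add, smul_comm, smul_assoc]
    | zero => simp
    | add a a' _ _ ha ha' => rw [add_mul, map_add, ha, ha', map_add, smul_add, add_smul]; abel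
    | smul r a _ ha =>
      rw [smul_mul_assoc, map_smul, ha, map_smul, smul_add, smul_assoc, smul_comm r b])

lemma partialDeriv_mono (i : ι) (k : ι → ℕ) :
    h.partialDeriv hR i (mono x k) = k i • mono x (k - Pi.single i 1) :=
  h.partialLinear_mono hR i k

lemma partialDeriv_self (i j : ι) :
    h.partialDeriv hR i (x j) = if i = j then 1 else 0 := by
  have := h.partialDeriv_mono hR i (Pi.single j 1)
  rw [mono_single, pow_one] at this
  rw [this]
  by_cases hij : i = j
  · subst hij; simp [mono]
  · simp [hij]

lemma derivation_eq_sum (D : Derivation R S S) (z : S) :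
    D z = ∑ j, D (x j) * h.partialDeriv hR j z := by
  have : D = ∑ j, D (x j) • h.partialDeriv hR j := by
    refine h.derivation_ext fun i => ?_
    simp [Derivation.sum_apply, partialDeriv_self]
  conv_lhs => rw [this]
  simp [Derivation.sum_apply]

/-- After differentiation the exponent of `x i` is never p - 1 modulo p. Thus the top coefficient
kills exact forms, as a Cartier operator must. -/
lemma coeff_partialDeriv (i : ι) (z : S) : h.coeff (h.partialDeriv hR i z) = 0 := by
  induction h.2 (Submodule.mem_top (x := z)) using Submodule.span_induction with
  | mem z hz =>
    obtain ⟨m, rfl⟩ := hz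
    dsimp only
    rw [partialDeriv_mono, map_nsmul]
    by_cases hm : (m i : ℕ) = 0
    · simp [hm]
    · rw [h.coeff_mono_eq_zero hR (i := i), smul_zero]
      have := (m i).2
      simp only [Pi.sub_apply, Pi.single_eq_same]
      rw [Nat.mod_eq_of_lt (by omega)]
      omega
  | zero => simp
  | add _ _ _ _ h1 h2 => rw [map_add, map_add, h1, h2, add_zero]
  | smul r _ _ h1 => rw [Derivation.map_smul, map_smul, h1, smul_zero]

end IsPBasis

/-- The sum of `u ^ (p - 1) du` over summands differs from that of the sum by an exact form. -/
lemma exists_derivation_add_pow [CharP S p] (D : Derivation R S S) (u v : S) :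
    ∃ w, (u + v) ^ (p - 1) * (D u + D v) = u ^ (p - 1) * D u + v ^ (p - 1) * D v + D w := by
  obtain ⟨n, hn⟩ : ∃ n, p = n + 1 := ⟨p - 1, (Nat.succ_pred_prime hp.1).symm⟩
  have hpp := hp.1
  have hdvd : ∀ k < n, ∃ c, (n + 1).choose (k + 1) = (n + 1) * c := fun k hk =>
    hn ▸ hpp.dvd_choose_self (k := k + 1) (by omega) (by omega)
  choose! c hc using hdvd
  have hc1 : ∀ k < n, c k * (k + 1) = n.choose k := by
    intro k hk
    have h1 := Nat.add_one_mul_choose_eq n k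
    rw [hc k hk] at h1
    exact (Nat.eq_of_mul_eq_mul_left (Nat.succ_pos n) (by rw [h1, ← mul_assoc])).symm
  have hc2 : ∀ k < n, c k * (n - k) = n.choose (k + 1) := by
    intro k hk
    have h1 := Nat.choose_mul_succ_eq n (k + 1)
    rw [hc k hk, show n + 1 - (k + 1) = n - k by omega] at h1
    refine (Nat.eq_of_mul_eq_mul_left (Nat.succ_pos n) ?_).symm
    rw [← mul_assoc, mul_comm, ← h1]
  rw [show p - 1 = n by omega]
  -- This is ((u + v)^p - u^p - v^p) / p, computed integrally: `c k` is the binomial coefficient of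
  -- p over k + 1 divided by p.
  refine ⟨∑ k ∈ Finset.range n, (c k) • (u ^ (k + 1) * v ^ (n - k)), ?_⟩
  have hD : ∀ k ∈ Finset.range n, D ((c k) • (u ^ (k + 1) * v ^ (n - k))) =
      (u ^ k * v ^ (n - k) * (n.choose k : S)) * D u +
        (u ^ (k + 1) * v ^ (n - (k + 1)) * (n.choose (k + 1) : S)) * D v := by
    intro k hk
    rw [Finset.mem_range] at hk
    rw [map_nsmul, Derivation.leibniz, Derivation.leibniz_pow, Derivation.leibniz_pow, ← hc1 k hk,
      ← hc2 k hk, Nat.sub_sub]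
    simp only [smul_eq_mul, nsmul_eq_mul, Nat.cast_mul, Nat.cast_add, Nat.cast_one,
      Nat.add_sub_cancel, Nat.cast_sub hk.le]
    ring
  rw [map_sum, Finset.sum_congr rfl hD, Finset.sum_add_distrib, ← Finset.sum_mul, ← Finset.sum_mul]
  have e1 := add_pow u v n
  have e2 := e1
  rw [Finset.sum_range_succ] at e1
  rw [Finset.sum_range_succ'] at e2
  simp only [Nat.sub_self, pow_zero, mul_one, Nat.choose_self, Nat.cast_one, Nat.sub_zero, one_mul,
    Nat.choose_zero_right] at e1 e2
  linear_combination D u * e1 + D v * e2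

namespace IsPBasis

variable {x : ι → S} (h : IsPBasis p R x) [CharP S p]
  (hR : ∀ s : S, ∃ r : R, algebraMap R S r = s ^ p)

/-- With the scaled monomial written as `y * x i`, both sides are k_i y^p x_i^(p-1), by Fermat's
k_i^p = k_i. No exact correction is needed here; it enters only through sums. -/
lemma pow_mul_partialDeriv_mono (i : ι) (r : R) (k : ι → ℕ) :
    (r • mono x k) ^ (p - 1) * h.partialDeriv hR i (r • mono x k) =
      x i ^ (p - 1) * h.partialDeriv hR i (r • mono x k) ^ p := by
  obtain ⟨n, hn⟩ : ∃ n, p = n + 1 := ⟨p - 1, (Nat.succ_pred_prime hp.1).symm⟩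
  rw [Derivation.map_smul, partialDeriv_mono]
  by_cases hk : k i = 0
  · simp [hk, hp.1.ne_zero]
  · have e : ((k i : ℕ) : S) ^ p = k i := by
      rw [← frobenius_def, map_natCast]
    rw [mono_eq_mul x hk, nsmul_eq_mul]
    simp only [Algebra.smul_def, mul_pow, e]
    rw [show p - 1 = n by omega]
    generalize (mono x (k - Pi.single i 1)) = y
    rw [hn]
    ring

/-- The Cartier formula: `u ^ (p - 1) du = x ^ (p - 1) (du / dx) ^ p dx` up to exact forms. -/
lemma exists_pow_mul_partialDeriv (i : ι) (u : S) :
    ∃ v, u ^ (p - 1) * h.partialDeriv hR i u =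
      x i ^ (p - 1) * h.partialDeriv hR i u ^ p + h.partialDeriv hR i v := by
  induction h.2 (Submodule.mem_top (x := u)) using Submodule.closure_induction with
  | zero => exact ⟨0, by simp [hp.1.ne_zero]⟩
  | add a b _ _ ha hb =>
    obtain ⟨v, hv⟩ := ha
    obtain ⟨w, hw⟩ := hb
    obtain ⟨c, hc⟩ := exists_derivation_add_pow (p := p) (h.partialDeriv hR i) a b
    refine ⟨v + w + c, ?_⟩
    rw [map_add, hc, hv, hw, add_pow_char, map_add, map_add]
    ring
  | smul_mem r m hm =>
    obtain ⟨m, rfl⟩ := hm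
    exact ⟨0, by rw [h.pow_mul_partialDeriv_mono hR, map_zero, add_zero]⟩

lemma mono_update (x : ι → S) (i : ι) (z : S) (k : ι → ℕ) :
    mono (Function.update x i z) k = mono x (k - Pi.single i (k i)) * z ^ k i := by
  have h1 : ∀ j ∈ Finset.univ.erase i, Function.update x i z j ^ k j =
      x j ^ (k - (Pi.single i (k i) : ι → ℕ)) j := by
    intro j hj
    simp [Finset.ne_of_mem_erase hj]
  rw [mono, mono, ← Finset.prod_erase_mul _ _ (Finset.mem_univ i), Finset.prod_congr rfl h1,
    ← Finset.prod_erase_mul _ (fun j => x j ^ (k - (Pi.single i (k i) : ι → ℕ)) j)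
      (Finset.mem_univ i)]
  simp

lemma coeff_mul_partialDeriv (i : ι) {w : S} (hw : h.partialDeriv hR i w = 0) (v : S) :
    h.coeff (w * h.partialDeriv hR i v) = 0 := by
  have := h.coeff_partialDeriv hR i (w * v)
  rwa [Derivation.leibniz, hw, smul_zero, add_zero] at this

lemma partialDeriv_mono_sub_single (i : ι) (k : ι → ℕ) :
    h.partialDeriv hR i (mono x (k - Pi.single i (k i))) = 0 := by
  rw [partialDeriv_mono]
  simp

/-- Since p does not divide k + 1, the form z^k dz is exact, namely d(z^(k+1)) / (k+1), and `w` is a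
constant for this derivative. -/
lemma coeff_mul_pow_eq_zero (i : ι) (z : S) {w : S} (hw : h.partialDeriv hR i w = 0) {k : ℕ}
    (hk : k % p ≠ p - 1) : h.coeff (w * (z ^ k * h.partialDeriv hR i z)) = 0 := by
  have h1 := h.coeff_mul_partialDeriv hR i hw (z ^ (k + 1))
  rw [Derivation.leibniz_pow, Nat.add_sub_cancel, smul_eq_mul, mul_smul_comm, map_nsmul] at h1
  have hcop : (k + 1).Coprime p := by
    rw [Nat.coprime_comm, hp.1.coprime_iff_not_dvd]
    intro hd
    obtain ⟨c, hc⟩ := hd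
    apply hk
    have hpos := hp.1.pos
    obtain ⟨c, rfl⟩ : ∃ d, c = d + 1 := ⟨c - 1, by rcases c with _ | c <;> simp at hc ⊢⟩
    have : k = p - 1 + p * c := by rw [Nat.mul_add] at hc; omega
    rw [this, Nat.add_mul_mod_self_left, Nat.mod_eq_of_lt (by omega)]
  obtain ⟨a, ha⟩ := Nat.exists_mul_mod_eq_one_of_coprime hcop hp.1.one_lt
  set c := h.coeff (w * (z ^ k * h.partialDeriv hR i z)) with hc
  have hpc : p • c = 0 := by
    rw [hc, ← map_nsmul, nsmul_eq_mul, CharP.cast_eq_zero, zero_mul, map_zero]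
  have h2 : ((k + 1) * a) • c = 0 := by rw [mul_comm, mul_smul, h1, smul_zero]
  rw [← Nat.mod_add_div ((k + 1) * a) p, ha.2, add_smul, one_smul, mul_comm, mul_smul, hpc, smul_zero,
    add_zero] at h2
  exact h2

/-- In the remaining exponent p - 1 the form is not exact, but the Cartier formula trades `z` for `x
i` at the cost of the scalar (∂z)^p. -/
lemma coeff_mul_pow_sub_one (i : ι) (z : S) {w : S} (hw : h.partialDeriv hR i w = 0) {c : R}
    (hc : algebraMap R S c = h.partialDeriv hR i z ^ p) :
    h.coeff (w * (z ^ (p - 1) * h.partialDeriv hR i z)) = c * h.coeff (w * x i ^ (p - 1)) := by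
  obtain ⟨v, hv⟩ := h.exists_pow_mul_partialDeriv hR i z
  rw [hv, mul_add, map_add, h.coeff_mul_partialDeriv hR i hw, add_zero, ← hc,
    ← smul_eq_mul c, ← map_smul, Algebra.smul_def]
  ring_nf

lemma mono_sub_single_mul (x : ι → S) (i : ι) (n : ℕ) (k : ι → ℕ) :
    mono x (k - Pi.single i (k i)) * x i ^ n = mono x (Function.update k i n) := by
  rw [← mono_single, ← mono_add]
  congr 1
  ext j
  by_cases hj : j = i
  · subst hj; simp
  · simp [hj]

/-- Coefficients of monomials in which one member of the `p`-basis is exchanged. -/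
lemma coeff_mono_update_eq_zero (i : ι) (z : S) {k : ι → ℕ} {j : ι} (hk : k j % p ≠ p - 1) :
    h.coeff (h.partialDeriv hR i z * mono (Function.update x i z) k) = 0 := by
  have hw := h.partialDeriv_mono_sub_single hR i k
  rw [mono_update, mul_comm, mul_assoc]
  -- If k_i ≡ p - 1, then z^(k_i) is a p-th power times z^(p-1) and the Cartier formula reduces to
  -- monomials in `x`; otherwise z^(k_i) dz is exact.
  by_cases hi : k i % p = p - 1
  · obtain ⟨c, hc⟩ := hR (h.partialDeriv hR i z)
    obtain ⟨r, hr⟩ := hR (z ^ (k i / p))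
    have e : z ^ k i = algebraMap R S r * z ^ (p - 1) := by
      conv_lhs => rw [← Nat.mod_add_div (k i) p, hi]
      rw [hr, pow_add, ← pow_mul, mul_comm p, mul_comm]
    rw [e, mul_assoc, mul_left_comm, ← Algebra.smul_def, map_smul,
      h.coeff_mul_pow_sub_one hR i z hw hc, mono_sub_single_mul,
      h.coeff_mono_eq_zero hR (i := j), mul_zero, smul_zero]
    have hj : j ≠ i := by rintro rfl; exact hk hi
    simpa [hj] using hk
  · exact h.coeff_mul_pow_eq_zero hR i z hw hi

lemma coeff_mono_update_top (i : ι) (z : S) {c : R}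
    (hc : algebraMap R S c = h.partialDeriv hR i z ^ p) {k : ι → ℕ} (hk : ∀ j, k j = p - 1) :
    h.coeff (h.partialDeriv hR i z * mono (Function.update x i z) k) = c := by
  have hw := h.partialDeriv_mono_sub_single hR i k
  rw [mono_update, mul_comm, mul_assoc, show z ^ k i = z ^ (p - 1) by rw [hk i],
    h.coeff_mul_pow_sub_one hR i z hw hc, mono_sub_single_mul, h.coeff_mono_eq_one, mul_one]
  intro j
  by_cases hj : j = i
  · subst hj; simp
  · simp [hj, hk]

/-- The complementary exponent vector. -/
def compl (m : ι → Fin p) : ι → ℕ := fun i => p - 1 - (m i : ℕ)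

lemma compl_add_self (m : ι → Fin p) (i : ι) : ((fun i => (m i : ℕ)) + compl m) i = p - 1 := by
  have := (m i).2
  simp only [compl, Pi.add_apply]
  omega

/-- The sum n_i + (p - 1 - m_i) is at most 2p - 2, so it is congruent to p - 1 only when n_i = m_i.
-/
lemma exists_compl_add_ne {m n : ι → Fin p} (hmn : n ≠ m) :
    ∃ i, ((fun i => (n i : ℕ)) + compl m) i % p ≠ p - 1 := by
  obtain ⟨i, hi⟩ := Function.ne_iff.mp hmn
  refine ⟨i, fun h => hi (Fin.ext ?_)⟩
  have h1 := (m i).2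
  have h2 := (n i).2
  simp only [compl, Pi.add_apply] at h
  have h3 := Nat.div_add_mod ((n i : ℕ) + (p - 1 - (m i : ℕ))) p
  rw [h] at h3
  rcases Nat.eq_zero_or_pos (((n i : ℕ) + (p - 1 - (m i : ℕ))) / p) with h4 | h4
  · rw [h4, mul_zero] at h3; omega
  · have := Nat.mul_le_mul_left p h4
    omega

/-- A functional that pairs the monomials in `y` perfectly shows that they are independent. -/
lemma linearIndependent_of_functional [IsDomain R] {y : ι → S} (F : S →ₗ[R] R) {c : R} (hc : c ≠ 0)
    (h₀ : ∀ (k : ι → ℕ) (j : ι), k j % p ≠ p - 1 → F (mono y k) = 0)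
    (h₁ : ∀ k : ι → ℕ, (∀ j, k j = p - 1) → F (mono y k) = c) :
    LinearIndependent R (fun m : ι → Fin p => mono y fun i => (m i : ℕ)) := by
  rw [Fintype.linearIndependent_iff]
  intro g hg m
  -- Multiplying the relation by the monomial complementary to `m` lifts the m-th term to the top
  -- exponent, and `F` annihilates all other terms.
  have h2 : F ((∑ n, g n • mono y fun i => (n i : ℕ)) * mono y (compl m)) = 0 := by
    rw [hg, zero_mul, map_zero]
  rw [Finset.sum_mul, map_sum, Finset.sum_eq_single m] at h2
  · rw [smul_mul_assoc, ← mono_add, map_smul, h₁ _ (compl_add_self m), smul_eq_mul] at h2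
    exact (mul_eq_zero.mp h2).resolve_right hc
  · intro n _ hn
    obtain ⟨i, hi⟩ := exists_compl_add_ne hn
    rw [smul_mul_assoc, ← mono_add, map_smul, h₀ _ i hi, smul_zero]
  · simp

end IsPBasis

end PBasis

/-! ### Exchange of p-bases over a field and the Jacobian -/

section Field

set_option linter.unusedSectionVars false

variable {R S : Type*} [Field R] [Field S] [Algebra R S]
variable {ι : Type*} [Fintype ι] [DecidableEq ι] {p : ℕ} [hp : Fact p.Prime] [CharP S p]

namespace IsPBasis

variable {x : ι → S} (h : IsPBasis p R x) (hR : ∀ s : S, ∃ r : R, algebraMap R S r = s ^ p)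

lemma of_linearIndependent (h : IsPBasis p R x) {y : ι → S}
    (hy : LinearIndependent R (fun m : ι → Fin p => mono y fun i => (m i : ℕ))) :
    IsPBasis p R y := by
  refine ⟨hy, ?_⟩
  have : FiniteDimensional R S := Module.Basis.finiteDimensional_of_finite h.basis
  rw [hy.span_eq_top_of_card_eq_finrank]
  rw [Module.finrank_eq_card_basis h.basis]

/-- The functional s ↦ coeff(∂_i z · s) pairs the new monomials perfectly, with nonzero value (∂_i
z)^p at the top; the count of monomials then gives spanning. -/
lemma update (i : ι) (z : S) (hz : h.partialDeriv hR i z ≠ 0) :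
    IsPBasis p R (Function.update x i z) := by
  obtain ⟨c, hc⟩ := hR (h.partialDeriv hR i z)
  have hc0 : c ≠ 0 := by
    rintro rfl
    rw [map_zero] at hc
    exact hz (pow_eq_zero_iff hp.1.ne_zero |>.mp hc.symm)
  refine h.of_linearIndependent (linearIndependent_of_functional
    (h.coeff ∘ₗ (Algebra.lmul R S (h.partialDeriv hR i z))) hc0 (fun k j hk => ?_) fun k hk => ?_)
  · exact h.coeff_mono_update_eq_zero hR i z hk
  · exact h.coeff_mono_update_top hR i z hc hk

/-- Exchanging one member of a `p`-basis. -/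
lemma coeff_update (i : ι) (z : S) (hz : h.partialDeriv hR i z ≠ 0) (s : S) :
    h.coeff s = (h.update hR i z hz).coeff (h.partialDeriv hR i z ^ (p - 1) * s) := by
  set g := h.partialDeriv hR i z with hg
  obtain ⟨c, hc⟩ := hR g
  -- On the monomials in the new p-basis both functionals vanish except at the top, where the value
  -- is `c`, that is, g^p.
  have key : h.coeff ∘ₗ (Algebra.lmul R S g) = c • (h.update hR i z hz).coeff := by
    refine (h.update hR i z hz).basis.ext fun m => ?_
    rw [basis_apply, LinearMap.smul_apply, (h.update hR i z hz).coeff_mono_fin]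
    split_ifs with hm
    · rw [smul_eq_mul, mul_one]
      refine h.coeff_mono_update_top hR i z hc fun j => ?_
      rw [hm]; rfl
    · rw [smul_zero]
      obtain ⟨j, hj⟩ := Function.ne_iff.mp hm
      refine h.coeff_mono_update_eq_zero hR i z (j := j) fun h' => hj (Fin.ext ?_)
      rwa [Nat.mod_eq_of_lt (m j).2] at h'
  -- Evaluating at g⁻¹ s and moving the scalar g^p inside leaves the factor g^(p-1).
  have h1 := congr($key (g⁻¹ * s))
  have h2 : (Algebra.lmul R S g) (g⁻¹ * s) = s := by
    simp [mul_inv_cancel_left₀ hz]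
  rw [LinearMap.comp_apply, h2, LinearMap.smul_apply, ← map_smul, Algebra.smul_def, hc] at h1
  rw [h1]
  congr 1
  have hpos : p = p - 1 + 1 := (Nat.sub_add_cancel hp.1.pos).symm
  conv_lhs => rw [hpos]
  rw [pow_succ]
  field_simp

lemma comp_perm (h : IsPBasis p R x) (σ : Equiv.Perm ι) : IsPBasis p R (x ∘ σ) := by
  refine h.of_linearIndependent ?_
  have := h.1.comp (fun m : ι → Fin p => m ∘ σ.symm) (fun m n hmn => by
    ext i
    have := congrFun hmn (σ i)
    simpa using congrArg Fin.val this)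
  have e : (fun m : ι → Fin p => mono (x ∘ σ) fun i => (m i : ℕ)) =
      (fun m : ι → Fin p => mono x fun i => (m i : ℕ)) ∘ fun m => m ∘ σ.symm :=
    funext fun m => Fintype.prod_equiv σ _ _ (by simp)
  rw [e]
  exact this

lemma coeff_comp_perm (σ : Equiv.Perm ι) (s : S) : (h.comp_perm σ).coeff s = h.coeff s := by
  suffices (h.comp_perm σ).coeff = h.coeff by rw [this]
  refine (h.comp_perm σ).basis.ext fun m => ?_
  have e : (mono (x ∘ σ) fun i => (m i : ℕ)) = mono x fun i => ((m ∘ σ.symm) i : ℕ) :=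
    Fintype.prod_equiv σ _ _ (by simp)
  rw [basis_apply, coeff_mono_fin, e, coeff_mono_fin]
  congr 1
  rw [eq_iff_iff]
  constructor
  · rintro rfl; rfl
  · intro hm
    ext i
    have := congrArg Fin.val (congrFun hm (σ i))
    simp only [Function.comp_apply, Equiv.symm_apply_apply] at this
    exact this

/-- The Jacobian matrix of `y` with respect to a `p`-basis. -/
def jacobian (y : ι → S) : Matrix ι ι S := Matrix.of fun i j => h.partialDeriv hR j (y i)

lemma jacobian_mul {x' : ι → S} (h' : IsPBasis p R x') (y : ι → S) :
    h'.jacobian hR y * h.jacobian hR x' = h.jacobian hR y := by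
  ext i j
  rw [Matrix.mul_apply]
  simp only [jacobian, Matrix.of_apply]
  rw [h'.derivation_eq_sum hR (h.partialDeriv hR j) (y i)]
  exact Finset.sum_congr rfl fun _ _ => mul_comm _ _

lemma jacobian_self : h.jacobian hR x = 1 := by
  ext i j
  simp only [jacobian, Matrix.of_apply, partialDeriv_self, Matrix.one_apply, eq_comm]

/-- The determinant is a sign; for odd p the exponent p - 1 is even, and for p = 2 the sign is
trivial. -/
lemma jacobian_perm (σ : Equiv.Perm ι) :
    (h.jacobian hR (x ∘ σ)).det ^ (p - 1) = 1 := by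
  have : h.jacobian hR (x ∘ σ) = (1 : Matrix ι ι S).submatrix σ id := by
    rw [← h.jacobian_self hR]; rfl
  rw [this, Matrix.det_permute, Matrix.det_one, mul_one]
  rcases Int.units_eq_one_or (Equiv.Perm.sign σ) with h1 | h1
  · simp [h1]
  · rw [h1]
    rcases hp.1.eq_two_or_odd' with rfl | hodd
    · have : (-1 : S) = 1 := by
        have := CharP.cast_eq_zero S 2
        rw [neg_eq_iff_add_eq_zero]
        norm_num at this ⊢
        exact this
      simp [this]
    · have : Even (p - 1) := Nat.Odd.sub_odd hodd odd_one
      simp [this.neg_one_pow]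

lemma jacobian_update (i : ι) (z : S) :
    (h.jacobian hR (Function.update x i z)).det = h.partialDeriv hR i z := by
  have : h.jacobian hR (Function.update x i z) =
      (1 : Matrix ι ι S).updateRow i fun j => h.partialDeriv hR j z := by
    rw [← h.jacobian_self hR]
    ext a b
    by_cases ha : a = i
    · subst ha; simp [jacobian]
    · simp [jacobian, ha]
  rw [this, ← Matrix.det_transpose, ← Matrix.updateCol_transpose, Matrix.transpose_one,
    ← Matrix.cramer_apply, Matrix.cramer_one]
  rfl

/-- Independence of the Cartier operator of the `p`-basis. -/
theorem coeff_eq_coeff_jacobian {y : ι → S} (h' : IsPBasis p R y) (s : S) :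
    h.coeff s = h'.coeff ((h.jacobian hR y).det ^ (p - 1) * s) := by
  classical
  induction hn : (Finset.univ.filter fun i => x i ≠ y i).card using Nat.strong_induction_on
    generalizing x s with
  | _ n ih =>
  by_cases hxy : x = y
  · subst hxy
    rw [jacobian_self, Matrix.det_one, one_pow, one_mul]
  · obtain ⟨i, hi⟩ := Function.ne_iff.mp hxy
    -- A pivot. If y_i did not depend on any x_j that is still to be exchanged, the chain rule for
    -- ∂/∂y_i applied to y_i would give 1 = 0.
    obtain ⟨j, hj, hj'⟩ : ∃ j, x j ≠ y j ∧ h.partialDeriv hR j (y i) ≠ 0 := by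
      by_contra! hcon
      have h1 := h.derivation_eq_sum hR (h'.partialDeriv hR i) (y i)
      rw [h'.partialDeriv_self, if_pos rfl, Finset.sum_eq_zero] at h1
      · exact one_ne_zero h1
      · intro j _
        by_cases hj : x j = y j
        · have : i ≠ j := by rintro rfl; exact hi hj
          rw [hj, h'.partialDeriv_self, if_neg this, zero_mul]
        · rw [hcon j hj, mul_zero]
    -- Swapping brings x_j to place i, where it is replaced by y_i. This corrects place i and spoils
    -- no place that was already correct.
    set σ := Equiv.swap i j
    have h1 := h.comp_perm σ
    have hg : h1.partialDeriv hR i (y i) = h.partialDeriv hR j (y i) := by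
      have : h1.partialDeriv hR i = h.partialDeriv hR j := by
        refine h1.derivation_ext fun k => ?_
        rw [h1.partialDeriv_self, Function.comp_apply, h.partialDeriv_self]
        have : j = σ k ↔ i = k := by
          rw [← Equiv.symm_apply_eq, Equiv.symm_swap, Equiv.swap_apply_right]
        simp [this]
      rw [this]
    have hg' : h1.partialDeriv hR i (y i) ≠ 0 := hg ▸ hj'
    have h2 := h1.update hR i (y i) hg'
    have hlt : (Finset.univ.filter fun k => Function.update (x ∘ σ) i (y i) k ≠ y k).card < n := by
      rw [← hn]
      refine Finset.card_lt_card (Finset.ssubset_iff_subset_ne.mpr ⟨?_, ?_⟩)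
      · intro k hk
        simp only [Finset.mem_filter, Finset.mem_univ, true_and] at hk ⊢
        by_cases hki : k = i
        · subst hki; exact hi
        · rw [Function.update_of_ne hki] at hk
          by_cases hkj : k = j
          · subst hkj; exact hj
          · rwa [Function.comp_apply, Equiv.swap_apply_of_ne_of_ne hki hkj] at hk
      · intro he
        have : i ∈ Finset.univ.filter fun k => x k ≠ y k := by simpa using hi
        rw [← he] at this
        simp at this
    rw [← h.coeff_comp_perm σ, h1.coeff_update hR i (y i) hg', ih _ hlt h2 _ rfl]
    congr 1
    rw [← h.jacobian_mul hR h1 y, Matrix.det_mul, mul_pow, h.jacobian_perm hR, mul_one,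
      ← h1.jacobian_mul hR h2 y, Matrix.det_mul, mul_pow, h1.jacobian_update hR, mul_assoc]

end IsPBasis

end Field

end FrobeniusTranspose

namespace FrobeniusTranspose

/-! ### `p`-bases relative to the subring of `p`-th powers -/

/-- `A` is finite over its subring of `q`-th powers. -/
def IsPowFinite (q : ℕ) (A : Type*) [CommRing A] : Prop :=
  ∃ (n : ℕ) (g : Fin n → A), ∀ z : A, ∃ c : Fin n → A, z = ∑ i, c i ^ q * g i

lemma exists_finset_of_finite {A B : Type*} [CommRing A] [CommRing B] {σ : A →+* B}
    (hσ : σ.Finite) : ∃ (n : ℕ) (g : Fin n → B), ∀ z : B, ∃ c : Fin n → A,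
      z = ∑ i, σ (c i) * g i := by
  let := σ.toAlgebra
  have : Module.Finite A B := hσ
  obtain ⟨n, g, hg⟩ := Module.Finite.exists_fin (R := A) (M := B)
  refine ⟨n, g, fun z => ?_⟩
  obtain ⟨c, hc⟩ := (Submodule.mem_span_range_iff_exists_fun A).mp
    (hg ▸ Submodule.mem_top : z ∈ Submodule.span A (Set.range g))
  exact ⟨c, by rw [← hc]; rfl⟩

lemma IsPowFinite.of_finite {q : ℕ} {A : Type*} [CommRing A] {F : A →+* A} (hF : ∀ a, F a = a ^ q)
    (hfin : F.Finite) : IsPowFinite q A := by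
  simpa only [hF, IsPowFinite] using exists_finset_of_finite hfin

lemma IsPowFinite.of_surjective {q : ℕ} {A B : Type*} [CommRing A] [CommRing B] {f : A →+* B}
    (hf : Function.Surjective f) (h : IsPowFinite q A) : IsPowFinite q B := by
  obtain ⟨n, g, hg⟩ := h
  refine ⟨n, fun i => f (g i), fun z => ?_⟩
  obtain ⟨w, rfl⟩ := hf z
  obtain ⟨c, hc⟩ := hg w
  refine ⟨fun i => f (c i), ?_⟩
  conv_lhs => rw [hc]
  simp

lemma IsPowFinite.fg_top {q : ℕ} {A R : Type*} [CommRing A] [CommRing R] [Algebra R A]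
    (h : IsPowFinite q A) (hR : ∀ s : A, ∃ r : R, algebraMap R A r = s ^ q) :
    (⊤ : Submodule R A).FG := by
  obtain ⟨n, g, hg⟩ := h
  rw [Submodule.fg_iff_exists_fin_generating_family]
  refine ⟨n, g, eq_top_iff.mpr fun z _ => ?_⟩
  obtain ⟨c, rfl⟩ := hg z
  refine Submodule.sum_mem _ fun i _ => ?_
  obtain ⟨r, hr⟩ := hR (c i)
  rw [← hr, ← Algebra.smul_def]
  exact Submodule.smul_mem _ _ (Submodule.subset_span ⟨i, rfl⟩)

/-- Every element is uniquely of the form `∑ c_m ^ p x ^ m`, `0 ≤ mᵢ < p`. -/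
def IsRootBasis (p : ℕ) {S : Type*} [CommRing S] {ι : Type*} [Fintype ι] [DecidableEq ι]
    (x : ι → S) : Prop :=
  (∀ c : (ι → Fin p) → S, ∑ m, c m ^ p * mono x (fun i => (m i : ℕ)) = 0 → c = 0) ∧
    ∀ z, ∃ c : (ι → Fin p) → S, z = ∑ m, c m ^ p * mono x fun i => (m i : ℕ)

section

set_option linter.unusedSectionVars false

variable {S : Type*} [CommRing S] {ι : Type*} [Fintype ι] [DecidableEq ι] {p : ℕ}

lemma IsRootBasis.isPBasis [IsDomain S] [hp : Fact p.Prime] {x : ι → S} (h : IsRootBasis p x)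
    {R : Type*} [CommRing R] [Algebra R S] [FaithfulSMul R S]
    (hR : ∀ s : S, ∃ r : R, algebraMap R S r = s ^ p)
    (hR' : ∀ r : R, ∃ s : S, algebraMap R S r = s ^ p) : IsPBasis p R x := by
  constructor
  · rw [Fintype.linearIndependent_iff]
    intro g hg m
    choose c hc using fun m => hR' (g m)
    have : c = 0 := h.1 c (by simpa only [← hc, ← Algebra.smul_def] using hg)
    apply FaithfulSMul.algebraMap_injective R S
    rw [hc, this, map_zero, Pi.zero_apply, zero_pow hp.1.ne_zero]
  · intro z _
    obtain ⟨c, rfl⟩ := h.2 z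
    refine Submodule.sum_mem _ fun m _ => ?_
    obtain ⟨r, hr⟩ := hR (c m)
    rw [← hr, ← Algebra.smul_def]
    exact Submodule.smul_mem _ _ (Submodule.subset_span ⟨m, rfl⟩)

lemma IsPBasis.isRootBasis [IsDomain S] [hp : Fact p.Prime] {x : ι → S}
    {R : Type*} [CommRing R] [Algebra R S] (h : IsPBasis p R x)
    (hR : ∀ s : S, ∃ r : R, algebraMap R S r = s ^ p)
    (hR' : ∀ r : R, ∃ s : S, algebraMap R S r = s ^ p) : IsRootBasis p x := by
  constructor
  · intro c hc
    choose g hg using fun m => hR (c m)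
    have := Fintype.linearIndependent_iff.mp h.1 g (by simpa only [Algebra.smul_def, hg] using hc)
    ext m
    have h1 := hg m
    rw [this m, map_zero] at h1
    exact pow_eq_zero_iff hp.1.ne_zero |>.mp h1.symm
  · intro z
    choose c hc using hR'
    refine ⟨fun m => c (h.basis.repr z m), ?_⟩
    conv_lhs => rw [← h.basis.sum_repr z]
    refine Finset.sum_congr rfl fun m _ => ?_
    rw [h.basis_apply, Algebra.smul_def, hc]

namespace IsRootBasis

variable [IsDomain S] [hp : Fact p.Prime] [CharP S p] {x : ι → S} (h : IsRootBasis p x)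

lemma unique (h : IsRootBasis p x) {c d : (ι → Fin p) → S}
    (hcd : ∑ m, c m ^ p * mono x (fun i => (m i : ℕ)) =
      ∑ m, d m ^ p * mono x (fun i => (m i : ℕ))) : c = d := by
  refine sub_eq_zero.mp (h.1 (c - d) ?_)
  simp only [Pi.sub_apply, sub_pow_char, sub_mul, Finset.sum_sub_distrib, hcd, sub_self]

/-- The `p`-th root of the coefficient of the top monomial. -/
def rootCoeff : S →+ S where
  toFun z := (h.2 z).choose IsPBasis.top
  map_zero' := by
    have := h.unique (c := (h.2 0).choose) (d := 0) (by
      rw [← (h.2 0).choose_spec]; simp [hp.1.ne_zero])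
    rw [this]; rfl
  map_add' a b := by
    have := h.unique (c := (h.2 (a + b)).choose) (d := (h.2 a).choose + (h.2 b).choose) (by
      simp only [Pi.add_apply, add_pow_char, add_mul, Finset.sum_add_distrib]
      rw [← (h.2 (a + b)).choose_spec, ← (h.2 a).choose_spec, ← (h.2 b).choose_spec])
    rw [this]; rfl

lemma rootCoeff_sum (c : (ι → Fin p) → S) :
    h.rootCoeff (∑ m, c m ^ p * mono x (fun i => (m i : ℕ))) = c IsPBasis.top := by
  have := h.unique (h.2 (∑ m, c m ^ p * mono x (fun i => (m i : ℕ)))).choose_spec.symm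
  exact congrFun this _

lemma rootCoeff_pow_mul (r z : S) : h.rootCoeff (r ^ p * z) = r * h.rootCoeff z := by
  obtain ⟨c, rfl⟩ := h.2 z
  rw [rootCoeff_sum, Finset.mul_sum]
  simp only [← mul_assoc, ← mul_pow]
  exact h.rootCoeff_sum fun m => r * c m

lemma rootCoeff_pow {R : Type*} [CommRing R] [Algebra R S] (h' : IsPBasis p R x)
    (hR : ∀ s : S, ∃ r : R, algebraMap R S r = s ^ p) (z : S) :
    h.rootCoeff z ^ p = algebraMap R S (h'.coeff z) := by
  classical
  obtain ⟨c, rfl⟩ := h.2 z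
  choose r hr using fun m => hR (c m)
  rw [rootCoeff_sum, map_sum, ← hr, Finset.sum_eq_single IsPBasis.top]
  · rw [← hr, ← Algebra.smul_def, map_smul, h'.coeff_mono_fin, if_pos rfl, smul_eq_mul, mul_one]
  · intro m _ hm
    rw [← hr, ← Algebra.smul_def, map_smul, h'.coeff_mono_fin, if_neg hm, smul_zero]
  · simp

/-- All coefficients are obtained from the functional `rootCoeff`. -/
lemma eq_sum_rootCoeff (z : S) :
    z = ∑ m : ι → Fin p, h.rootCoeff (z * mono x (IsPBasis.compl m)) ^ p * mono x (fun i => (m i : ℕ)) := by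
  set R := (frobenius S p).range
  have hR : ∀ s : S, ∃ r : R, algebraMap R S r = s ^ p := fun s => ⟨⟨_, s, rfl⟩, rfl⟩
  have hR' : ∀ r : R, ∃ s : S, algebraMap R S r = s ^ p := by
    rintro ⟨_, s, rfl⟩; exact ⟨s, rfl⟩
  have h' : IsPBasis p R x := h.isPBasis hR hR'
  obtain ⟨c, hc⟩ := h.2 z
  conv_lhs => rw [hc]
  refine Finset.sum_congr rfl fun m _ => ?_
  congr 1
  rw [h.rootCoeff_pow h' hR, hc, Finset.sum_mul, map_sum, Finset.sum_eq_single m]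
  · obtain ⟨r, hr⟩ := hR (c m)
    rw [mul_assoc, ← mono_add, ← hr, ← Algebra.smul_def, map_smul,
      h'.coeff_mono_eq_one (IsPBasis.compl_add_self m), smul_eq_mul, mul_one]
  · intro n _ hn
    obtain ⟨r, hr⟩ := hR (c n)
    obtain ⟨i, hi⟩ := IsPBasis.exists_compl_add_ne hn
    rw [mul_assoc, ← mono_add, ← hr, ← Algebra.smul_def, map_smul,
      h'.coeff_mono_eq_zero hR hi, smul_zero]
  · simp

end IsRootBasis

end

/-! ### Existence of `p`-bases -/

section Existence

set_option linter.unusedSectionVars false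

variable {p : ℕ} [hp : Fact p.Prime]

lemma mono_cons {S : Type*} [CommRing S] {n : ℕ} (y : S) (x : Fin n → S) (k : Fin (n + 1) → ℕ) :
    mono (Fin.cons y x : Fin (n + 1) → S) k = y ^ k 0 * mono x (fun i => k i.succ) := by
  simp [mono, Fin.prod_univ_succ]

/-- Induction on the degree. For `y` outside `N` the element y^p lies in `N`, so N(y) has degree p
with basis 1, y, …, y^(p-1); adjoining `y` to a p-basis over N(y) gives one over `N`. -/
lemma exists_isPBasis_of_finiteDimensional {k : Type u} [Field k] [CharP k p] (d : ℕ) :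
    ∀ (N : Type u) [Field N] [Algebra N k] [FiniteDimensional N k],
      (∀ s : k, ∃ r : N, algebraMap N k r = s ^ p) → Module.finrank N k = d →
      ∃ (n : ℕ) (x : Fin n → k), IsPBasis p N x := by
  induction d using Nat.strong_induction_on with
  | _ d ih =>
  intro N _ _ _ hN hd
  by_cases hsurj : Function.Surjective (algebraMap N k)
  · refine ⟨0, Fin.elim0, ?_, ?_⟩
    · rw [linearIndependent_unique_iff]
      simp [mono]
    · intro z _
      obtain ⟨r, rfl⟩ := hsurj z
      rw [← mul_one (algebraMap N k r), ← Algebra.smul_def]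
      exact Submodule.smul_mem _ _ (Submodule.subset_span ⟨default, by simp [mono]⟩)
  · simp only [Function.Surjective, not_forall, not_exists] at hsurj
    obtain ⟨y, hy⟩ := hsurj
    let N' := IntermediateField.adjoin N {y}
    obtain ⟨c, hc⟩ := hN y
    have hirr : Irreducible (Polynomial.X ^ p - Polynomial.C c) := by
      refine X_pow_sub_C_irreducible_of_prime hp.1 fun b hb => hy b ?_
      refine frobenius_inj k p ?_
      rw [frobenius_def, frobenius_def, ← map_pow, hb, hc]
    have hint : IsIntegral N y := Algebra.IsIntegral.isIntegral y
    have hmin : minpoly N y = Polynomial.X ^ p - Polynomial.C c :=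
      (minpoly.eq_of_irreducible_of_monic hirr (by simp [hc])
        (Polynomial.monic_X_pow_sub_C c hp.1.ne_zero)).symm
    have hdim : (IntermediateField.adjoin.powerBasis hint).dim = p := by
      rw [IntermediateField.adjoin.powerBasis_dim, hmin, Polynomial.natDegree_X_pow_sub_C]
    have hfr : Module.finrank N N' = p := by
      rw [(IntermediateField.adjoin.powerBasis hint).finrank, hdim]
    have hlt : Module.finrank N' k < d := by
      rw [← hd, ← Module.finrank_mul_finrank N N' k, hfr]
      have : 0 < Module.finrank N' k := Module.finrank_pos
      have := hp.1.one_lt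
      nlinarith
    obtain ⟨n, x, hx⟩ := ih _ hlt N' (fun s => by
      obtain ⟨r, hr⟩ := hN s
      exact ⟨algebraMap N N' r, by rw [← hr, ← IsScalarTower.algebraMap_apply]⟩) rfl
    let b := ((IntermediateField.adjoin.powerBasis hint).basis.reindex (finCongr hdim)).smulTower
      hx.basis
    let e : Fin p × (Fin n → Fin p) ≃ (Fin (n + 1) → Fin p) := Fin.consEquiv (fun _ => Fin p)
    have hb : ⇑(b.reindex e) =
        fun m : Fin (n + 1) → Fin p => mono (Fin.cons y x : Fin (n + 1) → k) fun i => (m i : ℕ) := by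
      ext m
      obtain ⟨⟨j, m⟩, rfl⟩ := e.surjective m
      rw [Module.Basis.reindex_apply, Equiv.symm_apply_apply, mono_cons]
      simp only [b, Module.Basis.smulTower_apply, hx.basis_apply, Module.Basis.reindex_apply,
        PowerBasis.basis_eq_pow, IntermediateField.adjoin.powerBasis_gen]
      rw [Algebra.smul_def, map_pow]
      rfl
    refine ⟨n + 1, Fin.cons y x, ?_, ?_⟩
    · rw [← hb]; exact (b.reindex e).linearIndependent
    · rw [← hb]; exact (b.reindex e).span_eq.ge

theorem exists_isRootBasis_of_field {k : Type u} [Field k] [CharP k p] (hk : IsPowFinite p k) :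
    ∃ (n : ℕ) (x : Fin n → k), IsRootBasis p x := by
  let N := (frobenius k p).fieldRange
  have hR : ∀ s : k, ∃ r : N, algebraMap N k r = s ^ p := fun s => ⟨⟨_, s, rfl⟩, rfl⟩
  have hR' : ∀ r : N, ∃ s : k, algebraMap N k r = s ^ p := by
    rintro ⟨_, s, rfl⟩; exact ⟨s, rfl⟩
  have : FiniteDimensional N k := ⟨hk.fg_top hR⟩
  obtain ⟨n, x, hx⟩ := exists_isPBasis_of_finiteDimensional _ N hR rfl
  exact ⟨n, x, hx.isRootBasis hR hR'⟩

/-- In the relation, the terms before the j-th are divisible by t^p by induction and those after it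
by t^(j+1); hence t^(j+1) divides t^j s_j. -/
lemma forall_dvd_of_sum_eq_zero {A : Type*} [CommRing A] [IsDomain A] {t : A} (ht : t ≠ 0)
    (s : Fin p → A) (hs : ∀ j, t ∣ s j → t ^ p ∣ s j) (h0 : ∑ j : Fin p, t ^ (j : ℕ) * s j = 0) :
    ∀ j, t ∣ s j := by
  intro j
  obtain ⟨j, hj⟩ := j
  induction j using Nat.strong_induction_on with
  | _ j ih =>
  have key : t ^ (j + 1) ∣ t ^ j * s ⟨j, hj⟩ := by
    rw [← Finset.add_sum_erase _ _ (Finset.mem_univ ⟨j, hj⟩)] at h0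
    rw [eq_neg_of_add_eq_zero_left h0, dvd_neg]
    refine Finset.dvd_sum fun i hi => ?_
    have hne : (i : ℕ) ≠ j := fun h => Finset.ne_of_mem_erase hi (Fin.ext h)
    rcases lt_or_gt_of_ne hne with hlt | hgt
    · exact (pow_dvd_pow t hj).trans ((hs i (ih i hlt i.2)).mul_left _)
    · exact (pow_dvd_pow t hgt).mul_right _
  rw [pow_succ] at key
  exact (mul_dvd_mul_iff_left (pow_ne_zero _ ht)).mp key

/-- A discrete valuation ring that is finite over its `p`-th powers has a `p`-basis. -/
theorem exists_isRootBasis_of_isDiscreteValuationRing {A : Type u} [CommRing A] [IsDomain A]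
    [IsDiscreteValuationRing A] [CharP A p] (hA : IsPowFinite p A) :
    ∃ (n : ℕ) (x : Fin n → A), IsRootBasis p x := by
  let k := IsLocalRing.ResidueField A
  let res : A →+* k := IsLocalRing.residue A
  have hres : Function.Surjective res := IsLocalRing.residue_surjective
  have : CharP k p := by
    have h0 : (p : k) = 0 := by
      rw [← map_natCast res, CharP.cast_eq_zero, map_zero]
    obtain ⟨r, hr⟩ := CharP.exists k
    rcases (Nat.dvd_prime hp.1).mp ((CharP.cast_eq_zero_iff k r p).mp h0) with rfl | rfl
    · exact absurd (CharP.cast_eq_zero k 1) (by rw [Nat.cast_one]; exact one_ne_zero)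
    · exact hr
  have hk : IsPowFinite p k := hA.of_surjective hres
  obtain ⟨n, a', ha'⟩ := exists_isRootBasis_of_field hk
  choose a ha using fun i => hres (a' i)
  obtain ⟨t, ht⟩ := IsDiscreteValuationRing.exists_irreducible A
  have hmono : ∀ m : Fin n → ℕ, res (mono a m) = mono a' m := by
    intro m
    simp [mono, map_prod, ha]
  have hker : ∀ z, res z = 0 ↔ t ∣ z := by
    intro z
    rw [IsLocalRing.residue_eq_zero_iff, ht.maximalIdeal_eq, Ideal.mem_span_singleton]
  have hsum : ∀ c : (Fin (n + 1) → Fin p) → A,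
      ∑ m, c m ^ p * mono (Fin.cons t a : Fin (n + 1) → A) (fun i => (m i : ℕ)) =
        ∑ j : Fin p, t ^ (j : ℕ) * ∑ m : Fin n → Fin p,
          c (Fin.cons j m) ^ p * mono a (fun i => (m i : ℕ)) := by
    intro c
    rw [← (Fin.consEquiv (fun _ : Fin (n + 1) => Fin p)).sum_comp, Fintype.sum_prod_type]
    refine Finset.sum_congr rfl fun j _ => ?_
    rw [Finset.mul_sum]
    refine Finset.sum_congr rfl fun m _ => ?_
    rw [mono_cons]
    change c (Fin.cons j m) ^ p * (t ^ (j : ℕ) * mono a fun i => (m i : ℕ)) = _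
    ring
  -- The p-basis consists of the uniformizer and lifts of a p-basis of the residue field.
  refine ⟨n + 1, Fin.cons t a, ?_, ?_⟩
  · have hdvd : ∀ c : (Fin (n + 1) → Fin p) → A,
        ∑ m, c m ^ p * mono (Fin.cons t a : Fin (n + 1) → A) (fun i => (m i : ℕ)) = 0 →
        ∀ m, t ∣ c m := by
      intro c hc m
      rw [hsum] at hc
      have h1 : ∀ j : Fin p, t ∣ ∑ m : Fin n → Fin p,
          c (Fin.cons j m) ^ p * mono a (fun i => (m i : ℕ)) → ∀ m, t ∣ c (Fin.cons j m) := by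
        intro j hj m
        rw [← hker, map_sum] at hj
        simp only [map_mul, map_pow, hmono] at hj
        rw [← hker]
        exact congrFun (ha'.1 _ hj) m
      have h2 := forall_dvd_of_sum_eq_zero ht.ne_zero _ (fun j hj => Finset.dvd_sum fun m _ =>
        (pow_dvd_pow_of_dvd (h1 j hj m) p).mul_right _) hc (m 0)
      have := h1 _ h2 (Fin.tail m)
      rwa [Fin.cons_self_tail] at this
    -- Infinite descent: dividing all coefficients by `t` gives another relation, so they are
    -- divisible by every power of `t`.
    have hpow : ∀ (N : ℕ) (c : (Fin (n + 1) → Fin p) → A),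
        ∑ m, c m ^ p * mono (Fin.cons t a : Fin (n + 1) → A) (fun i => (m i : ℕ)) = 0 →
        ∀ m, t ^ N ∣ c m := by
      intro N
      induction N with
      | zero => simp
      | succ N ih =>
        intro c hc m
        choose d hd using hdvd c hc
        rw [hd m, pow_succ']
        refine mul_dvd_mul_left t (ih d ?_ m)
        have h3 : t ^ p * ∑ m, d m ^ p *
            mono (Fin.cons t a : Fin (n + 1) → A) (fun i => (m i : ℕ)) = 0 := by
          rw [← hc, Finset.mul_sum]
          refine Finset.sum_congr rfl fun m _ => ?_
          rw [hd m]; ring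
        exact (mul_eq_zero.mp h3).resolve_left (pow_ne_zero _ ht.ne_zero)
    intro c hc
    ext m
    by_contra hne
    obtain ⟨N, u, hu⟩ := IsDiscreteValuationRing.eq_unit_mul_pow_irreducible hne ht
    have h4 := hpow (N + 1) c hc m
    rw [hu, (Units.isUnit u).dvd_mul_left] at h4
    exact (Nat.lt_irrefl N) ((pow_dvd_pow_iff ht.ne_zero ht.not_isUnit).mp h4)
  · set R := (frobenius A p).range
    have hR : ∀ s : A, ∃ r : R, algebraMap R A r = s ^ p := fun s => ⟨⟨_, s, rfl⟩, rfl⟩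
    -- Spanning follows from Nakayama over the local ring of p-th powers, over which `A` is finite
    -- and whose maximal ideal contains τ = t^p.
    have : IsLocalRing R := IsLocalRing.of_surjective' (frobenius A p).rangeRestrict
      (RingHom.rangeRestrict_surjective _)
    let τ : R := ⟨t ^ p, t, rfl⟩
    have hτ : τ ∈ IsLocalRing.maximalIdeal R := by
      rw [IsLocalRing.mem_maximalIdeal, mem_nonunits_iff]
      intro hu
      have := hu.map (algebraMap R A)
      exact ht.not_isUnit ((isUnit_pow_iff hp.1.ne_zero).mp this)
    let N : Submodule R A := Submodule.span R (Set.range fun m : Fin (n + 1) → Fin p =>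
      mono (Fin.cons t a : Fin (n + 1) → A) fun i => (m i : ℕ))
    have hfg : (⊤ : Submodule R A).FG := hA.fg_top hR
    -- The t-adic expansion to p digits: each induction step removes one digit, which is a
    -- combination of residue monomials and is absorbed into `N`.
    have hexp : ∀ (j : ℕ), j ≤ p → ∀ z : A, ∃ w ∈ N, ∃ v, z * t ^ (p - j) = w + t ^ p * v := by
      intro j
      induction j with
      | zero => exact fun _ z => ⟨0, N.zero_mem, z, by simp [mul_comm]⟩
      | succ j ih =>
        intro hj z
        obtain ⟨c, hc⟩ := ha'.2 (res z)
        choose c' hc' using fun m => hres (c m)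
        have h1 : t ∣ z - ∑ m : Fin n → Fin p, c' m ^ p * mono a fun i => (m i : ℕ) := by
          rw [← hker, map_sub, map_sum, sub_eq_zero, hc]
          simp only [map_mul, map_pow, hmono, hc']
        obtain ⟨z', hz'⟩ := h1
        obtain ⟨w, hw, v, hv⟩ := ih (by omega) z'
        refine ⟨w + ∑ m : Fin n → Fin p, (c' m ^ p * mono a fun i => (m i : ℕ)) * t ^ (p - (j + 1)),
          N.add_mem hw (N.sum_mem fun m _ => ?_), v, ?_⟩
        · obtain ⟨r, hr⟩ := hR (c' m)
          rw [← hr, mul_assoc, ← Algebra.smul_def]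
          refine N.smul_mem _ (Submodule.subset_span
            ⟨Fin.cons ⟨p - (j + 1), by have := hp.1.pos; omega⟩ m, ?_⟩)
          dsimp only
          rw [mono_cons, mul_comm]
          simp
        · rw [← Finset.sum_mul, eq_add_of_sub_eq hz', add_mul, add_right_comm, ← hv]
          congr 1
          rw [show p - j = p - (j + 1) + 1 by omega]
          ring
    have hle : (⊤ : Submodule R A) ≤ N ⊔ Ideal.span {τ} • ⊤ := by
      intro z _
      obtain ⟨w, hw, v, hv⟩ := hexp p le_rfl z
      rw [Nat.sub_self, pow_zero, mul_one] at hv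
      rw [hv]
      refine Submodule.add_mem_sup hw ?_
      have : t ^ p * v = τ • v := rfl
      rw [this]
      exact Submodule.smul_mem_smul (Ideal.mem_span_singleton_self τ) trivial
    have htop : (⊤ : Submodule R A) ≤ N := Submodule.le_of_le_smul_of_le_jacobson_bot hfg
      (by
        rw [IsLocalRing.jacobson_eq_maximalIdeal ⊥ bot_ne_top, Ideal.span_le]
        exact Set.singleton_subset_iff.mpr hτ) hle
    intro z
    obtain ⟨c, hc⟩ := Submodule.mem_span_range_iff_exists_fun R |>.mp
      (htop (Submodule.mem_top (x := z)))
    choose d hd using fun m => (c m).2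
    refine ⟨d, ?_⟩
    rw [← hc]
    refine Finset.sum_congr rfl fun m _ => ?_
    rw [Algebra.smul_def]
    congr 1
    exact (hd m).symm

end Existence

end FrobeniusTranspose

namespace FrobeniusTranspose

open KaehlerDifferential

/-- `T` identifies `ℬ` with the maps `ℬ → 𝒜` of the form `T (z · )`. -/
def IsDualizing {K M : Type*} [CommRing K] [CommRing M] (T : M →+ K) (𝒜 : Subring K)
    (ℬ : Subring M) : Prop :=
  ∀ z, (∀ b ∈ ℬ, T (z * b) ∈ 𝒜) ↔ z ∈ ℬ

/-! ### Transfer of `p`-bases -/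

section Transfer

set_option linter.unusedSectionVars false

variable {p : ℕ} [hp : Fact p.Prime] {ι : Type*} [Fintype ι] [DecidableEq ι]

lemma map_mono {S S' : Type*} [CommRing S] [CommRing S'] (f : S →+* S') (x : ι → S) (k : ι → ℕ) :
    f (mono x k) = mono (fun i => f (x i)) k := by
  simp [mono]

lemma IsRootBasis.map_rootCoeff {S S' : Type*} [CommRing S] [CommRing S'] [IsDomain S]
    [IsDomain S'] [CharP S p] [CharP S' p] (f : S →+* S') {x : ι → S} (h : IsRootBasis p x)
    (h' : IsRootBasis p fun i => f (x i)) (z : S) :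
    f (h.rootCoeff z) = h'.rootCoeff (f z) := by
  obtain ⟨c, rfl⟩ := h.2 z
  rw [rootCoeff_sum, map_sum]
  simp only [map_mul, map_pow, map_mono]
  rw [h'.rootCoeff_sum fun m => f (c m)]

/-- Denominators can be made p-th powers: a / b = a b^(p-1) / b^p. -/
lemma IsRootBasis.fractionField {A K : Type*} [CommRing A] [IsDomain A] [Field K] [Algebra A K]
    [IsFractionRing A K] {x : ι → A} (h : IsRootBasis p x) :
    IsRootBasis p fun i => algebraMap A K (x i) := by
  constructor
  · intro c hc
    obtain ⟨b, hb⟩ := IsLocalization.exist_integer_multiples_of_finite (nonZeroDivisors A) c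
    choose d hd using hb
    have hb0 : algebraMap A K b ≠ 0 := by
      simp
    have h0 : d = 0 := by
      refine h.1 d (IsFractionRing.injective A K ?_)
      rw [map_zero, map_sum, ← mul_zero (algebraMap A K b ^ p), ← hc, Finset.mul_sum]
      refine Finset.sum_congr rfl fun m _ => ?_
      rw [map_mul, map_pow, hd, map_mono, ← mul_assoc, ← mul_pow, Algebra.smul_def]
    ext m
    have := hd m
    rw [h0, Pi.zero_apply, map_zero, Algebra.smul_def] at this
    exact (mul_eq_zero.mp this.symm).resolve_left hb0
  · intro z
    obtain ⟨a, b, hb, rfl⟩ := IsFractionRing.div_surjective (A := A) z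
    have hb0 : algebraMap A K b ≠ 0 := by
      simpa using nonZeroDivisors.ne_zero hb
    obtain ⟨c, hc⟩ := h.2 (a * b ^ (p - 1))
    refine ⟨fun m => algebraMap A K (c m) / algebraMap A K b, ?_⟩
    have h1 := congrArg (algebraMap A K) hc
    rw [map_mul, map_pow, map_sum] at h1
    have h2 : algebraMap A K a / algebraMap A K b =
        (algebraMap A K a * algebraMap A K b ^ (p - 1)) / algebraMap A K b ^ p := by
      obtain ⟨n, hn⟩ : ∃ n, p = n + 1 := ⟨p - 1, (Nat.succ_pred_prime hp.1).symm⟩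
      simp only [hn, Nat.add_sub_cancel, pow_succ]
      field_simp
    rw [h2, h1, Finset.sum_div]
    refine Finset.sum_congr rfl fun m _ => ?_
    rw [map_mul, map_pow, map_mono, div_pow]
    ring

/-- By separability the p-th powers of a K-basis of `M` are again a K-basis. Expanding the
coordinates with respect to it in the p-basis of `K` gives the expansion over `M`. -/
lemma IsRootBasis.of_isSeparable {K M : Type*} [Field K] [Field M] [Algebra K M]
    [FiniteDimensional K M] [Algebra.IsSeparable K M] [CharP K p] [CharP M p] {x : ι → K}
    (h : IsRootBasis p x) : IsRootBasis p fun i => algebraMap K M (x i) := by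
  let v := Module.finBasis K M
  have : ExpChar K p := ExpChar.prime hp.1
  let w := v.mapPowExpCharPowOfIsSeparable p 1
  have hw : ∀ i, w i = v i ^ p := by simp [w, Module.Basis.mapPowExpCharPowOfIsSeparable]
  have key : ∀ c : Fin _ → (ι → Fin p) → K,
      ∑ m, (∑ j, c j m • v j) ^ p * mono (fun i => algebraMap K M (x i)) (fun i => (m i : ℕ)) =
        ∑ j, (∑ m, c j m ^ p * mono x (fun i => (m i : ℕ))) • w j := by
    intro c
    simp only [Finset.sum_smul, sum_pow_char, Finset.sum_mul]
    rw [Finset.sum_comm]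
    refine Finset.sum_congr rfl fun j _ => Finset.sum_congr rfl fun m _ => ?_
    rw [hw, Algebra.smul_def, Algebra.smul_def, map_mul, map_pow, map_mono, mul_pow]
    ring
  constructor
  · intro d hd
    have h1 : ∀ m, d m = ∑ j, v.repr (d m) j • v j := fun m => (v.sum_repr (d m)).symm
    have h2 := key fun j m => v.repr (d m) j
    simp only [← h1] at h2
    rw [hd] at h2
    have h3 := Fintype.linearIndependent_iff.mp w.linearIndependent _ h2.symm
    ext m
    rw [h1 m]
    refine Finset.sum_eq_zero fun j _ => ?_
    have := congrFun (h.1 _ (h3 j)) m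
    simp only [Pi.zero_apply] at this
    rw [this, zero_smul]
  · intro z
    choose c hc using fun j => h.2 (w.repr z j)
    refine ⟨fun m => ∑ j, c j m • v j, ?_⟩
    rw [key]
    simp only [← hc]
    exact (w.sum_repr z).symm

lemma IsRootBasis.card_eq {M : Type*} [Field M] [CharP M p] {n n' : ℕ} {x : Fin n → M}
    {y : Fin n' → M} (h : IsRootBasis p x) (h' : IsRootBasis p y) : n = n' := by
  let N := (frobenius M p).fieldRange
  have hR : ∀ s : M, ∃ r : N, algebraMap N M r = s ^ p := fun s => ⟨⟨_, s, rfl⟩, rfl⟩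
  have hR' : ∀ r : N, ∃ s : M, algebraMap N M r = s ^ p := by
    rintro ⟨_, s, rfl⟩; exact ⟨s, rfl⟩
  have h1 := Module.finrank_eq_card_basis (h.isPBasis hR hR').basis
  have h2 := Module.finrank_eq_card_basis (h'.isPBasis hR hR').basis
  rw [h1] at h2
  simp only [Fintype.card_fun, Fintype.card_fin] at h2
  exact Nat.pow_right_injective hp.1.two_le h2

/-- By `eq_sum_rootCoeff`, z is a combination of monomials with coefficients Φ(z x^{m'})^p, m' being
complementary to m; so z is integral as soon as these values are. -/
lemma IsRootBasis.isDualizing {A K : Type*} [CommRing A] [IsDomain A] [Field K] [Algebra A K]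
    [IsFractionRing A K] [CharP A p] [CharP K p] {x : ι → A} (h : IsRootBasis p x)
    (h' : IsRootBasis p fun i => algebraMap A K (x i)) :
    IsDualizing h'.rootCoeff (algebraMap A K).range (algebraMap A K).range := by
  intro z
  constructor
  · intro hz
    rw [h'.eq_sum_rootCoeff z]
    refine Subring.sum_mem _ fun m _ => Subring.mul_mem _ (Subring.pow_mem _ (hz _ ?_) _) ?_
    · exact ⟨_, map_mono _ _ _⟩
    · exact ⟨_, map_mono _ _ _⟩
  · rintro ⟨a, rfl⟩ _ ⟨b, rfl⟩
    exact ⟨h.rootCoeff (a * b), by rw [h.map_rootCoeff _ h', map_mul]⟩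

/-! ### Derivations -/

lemma rootRange_left {S : Type*} [CommRing S] [IsDomain S] [CharP S p] (s : S) :
    ∃ r : (frobenius S p).range, algebraMap (frobenius S p).range S r = s ^ p :=
  ⟨⟨_, s, rfl⟩, rfl⟩

lemma rootRange_right {S : Type*} [CommRing S] [IsDomain S] [CharP S p]
    (r : (frobenius S p).range) : ∃ s, algebraMap (frobenius S p).range S r = s ^ p := by
  obtain ⟨_, s, rfl⟩ := r
  exact ⟨s, rfl⟩

namespace IsRootBasis

variable {S : Type*} [CommRing S] [IsDomain S] [CharP S p] {x : ι → S} (h : IsRootBasis p x)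

/-- The partial derivatives with respect to a `p`-basis, as absolute derivations. -/
def deriv (j : ι) : Derivation ℤ S S :=
  ((h.isPBasis rootRange_left rootRange_right).partialDeriv rootRange_left j).restrictScalars ℤ

lemma _root_.Derivation.pow_char_mul {N : Type*} [AddCommGroup N] [Module S N]
    (D : Derivation ℤ S N) (c s : S) : D (c ^ p * s) = c ^ p • D s := by
  rw [D.leibniz, D.leibniz_pow, ← Nat.cast_smul_eq_nsmul S, CharP.cast_eq_zero, zero_smul,
    smul_zero, add_zero]

/-- An absolute derivation kills p-th powers, so it is determined by its values on the p-basis; it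
suffices to compare both sides there. -/
lemma derivation_eq_sum {N : Type*} [AddCommGroup N] [Module S N] (D : Derivation ℤ S N) (z : S) :
    D z = ∑ j, h.deriv j z • D (x j) := by
  have hb := h.isPBasis rootRange_left rootRange_right
  have key : ∀ D : Derivation ℤ S N, (∀ j, D (x j) = 0) → D z = 0 := by
    intro D hD
    obtain ⟨c, rfl⟩ := h.2 z
    rw [map_sum]
    refine Finset.sum_eq_zero fun m _ => ?_
    rw [D.pow_char_mul]
    suffices ∀ k : ι → ℕ, D (mono x k) = 0 by rw [this, smul_zero]
    intro k
    rw [mono]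
    refine Finset.prod_induction _ (fun s => D s = 0) (fun a b ha hb => ?_) D.map_one_eq_zero
      fun i _ => ?_
    · rw [D.leibniz, ha, hb, smul_zero, smul_zero, add_zero]
    · rw [D.leibniz_pow, hD, smul_zero, smul_zero]
  let E : Derivation ℤ S N := ∑ j, (LinearMap.toSpanSingleton S N (D (x j))).compDer (h.deriv j)
  have hE : ∀ z, E z = ∑ j, h.deriv j z • D (x j) := by
    intro z
    have : ∀ s : Finset ι, (∑ j ∈ s, (LinearMap.toSpanSingleton S N (D (x j))).compDer (h.deriv j)) z
        = ∑ j ∈ s, h.deriv j z • D (x j) := by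
      intro s
      rw [← Derivation.coeFnAddMonoidHom_apply, map_sum, Finset.sum_apply]
      rfl
    exact this _
  rw [← hE, ← sub_eq_zero, ← Derivation.sub_apply]
  refine key _ fun i => ?_
  rw [Derivation.sub_apply, hE, sub_eq_zero, Finset.sum_eq_single i]
  · rw [deriv, Derivation.restrictScalars_apply, hb.partialDeriv_self, if_pos rfl, one_smul]
  · intro j _ hj
    rw [deriv, Derivation.restrictScalars_apply, hb.partialDeriv_self, if_neg hj, zero_smul]
  · simp

lemma map_deriv {S' : Type*} [CommRing S'] [IsDomain S'] [CharP S' p] [Algebra S S']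
    (h' : IsRootBasis p fun i => algebraMap S S' (x i)) (j : ι) (z : S) :
    algebraMap S S' (h.deriv j z) = h'.deriv j (algebraMap S S' z) := by
  have : h'.deriv j (algebraMap S S' z) =
      ∑ i, h.deriv i z • h'.deriv j (algebraMap S S' (x i)) :=
    h.derivation_eq_sum ((h'.deriv j).compAlgebraMap S) z
  have hb := h'.isPBasis rootRange_left rootRange_right
  rw [this, Finset.sum_eq_single j]
  · rw [deriv, deriv, Derivation.restrictScalars_apply, Derivation.restrictScalars_apply,
      hb.partialDeriv_self, if_pos rfl, Algebra.smul_def, mul_one]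
  · intro i _ hi
    rw [deriv, deriv, Derivation.restrictScalars_apply, Derivation.restrictScalars_apply,
      hb.partialDeriv_self, if_neg (Ne.symm hi), smul_zero]
  · simp

end IsRootBasis

/-- The p-th powers of both sides are top coefficients over the field of p-th powers, where the
change of p-basis is known. -/
lemma IsRootBasis.rootCoeff_eq_rootCoeff_jacobian {M : Type*} [Field M] [CharP M p] {x y : ι → M}
    (h : IsRootBasis p x) (h' : IsRootBasis p y) (s : M) :
    h.rootCoeff s = h'.rootCoeff ((Matrix.of fun i j => h.deriv j (y i)).det ^ (p - 1) * s) := by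
  let N := (frobenius M p).fieldRange
  have hR : ∀ s : M, ∃ r : N, algebraMap N M r = s ^ p := fun s => ⟨⟨_, s, rfl⟩, rfl⟩
  have hR' : ∀ r : N, ∃ s : M, algebraMap N M r = s ^ p := by
    rintro ⟨_, s, rfl⟩; exact ⟨s, rfl⟩
  have hb := h.isPBasis hR hR'
  have hb' := h'.isPBasis hR hR'
  apply frobenius_inj M p
  rw [frobenius_def, frobenius_def, h.rootCoeff_pow hb hR, h'.rootCoeff_pow hb' hR,
    hb.coeff_eq_coeff_jacobian hR hb']
  congr 5

/-! ### The length of the module of differentials -/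

/-- By the Smith normal form the cokernel is the sum of the B / a_i, and the determinant is the
product of the a_i up to a unit. -/
lemma length_quotient_range {B : Type*} [CommRing B] [IsDomain B] [IsPrincipalIdealRing B]
    {V : Type*} [AddCommGroup V] [Module B V] (b : Module.Basis ι B V) (f : V →ₗ[B] V)
    (hf : LinearMap.det f ≠ 0) :
    Module.length B (V ⧸ LinearMap.range f) = Ring.ord B (LinearMap.det f) := by
  have := Module.Finite.of_basis b
  have := Module.Free.of_basis b
  have hinj : Function.Injective f := by
    rw [← LinearMap.ker_eq_bot, LinearMap.ker_eq_bot']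
    intro v hv
    refine b.repr.map_eq_zero_iff.mp (DFunLike.coe_injective ?_)
    refine Matrix.eq_zero_of_mulVec_eq_zero (M := LinearMap.toMatrix b b f) ?_ ?_
    · rwa [LinearMap.det_toMatrix]
    · rw [LinearMap.toMatrix_mulVec_repr, hv, map_zero, Finsupp.coe_zero]
  let N := LinearMap.range f
  let e : V ≃ₗ[B] N := LinearEquiv.ofInjective f hinj
  have hr : Module.finrank B N = Module.finrank B V := e.finrank_eq.symm
  let a := N.smithNormalFormCoeffs b hr
  let bT := N.smithNormalFormTopBasis b hr
  let bB := N.smithNormalFormBotBasis b hr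
  have hb : ∀ i, (bB i : V) = a i • bT i := N.smithNormalFormBotBasis_def b hr
  let g : V →ₗ[B] V := N.subtype ∘ₗ (bT.equiv bB (Equiv.refl _)).toLinearMap
  have hg : LinearMap.det g = ∏ i, a i := by
    rw [← LinearMap.det_toMatrix bT, ← Matrix.det_diagonal]
    congr 1
    ext i j
    rw [LinearMap.toMatrix_apply]
    simp only [g, LinearMap.comp_apply, LinearEquiv.coe_coe, Module.Basis.equiv_apply,
      Equiv.refl_apply, Submodule.subtype_apply, hb, map_smul, Module.Basis.repr_self,
      Finsupp.smul_apply, Finsupp.single_apply, Matrix.diagonal_apply]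
    by_cases hij : i = j
    · subst hij; simp
    · rw [if_neg hij, if_neg (Ne.symm hij), smul_zero]
  have hfg : f = g ∘ₗ (e ≪≫ₗ (bT.equiv bB (Equiv.refl _)).symm).toLinearMap := by
    ext v
    simp only [g, LinearMap.comp_apply, LinearEquiv.coe_coe, LinearEquiv.trans_apply,
      LinearEquiv.apply_symm_apply]
    rfl
  have hass : Associated (LinearMap.det f) (∏ i, a i) := by
    rw [hfg, LinearMap.det_comp, hg]
    exact associated_mul_unit_left _ _ (LinearEquiv.isUnit_det' _)
  have ha : ∀ i, a i ≠ 0 := by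
    intro i hi
    exact hf (hass.eq_zero_iff.mpr (Finset.prod_eq_zero (Finset.mem_univ i) hi))
  have hprod : ∀ s : Finset ι, Ring.ord B (∏ i ∈ s, a i) = ∑ i ∈ s, Ring.ord B (a i) := by
    intro s
    induction s using Finset.induction_on with
    | empty => simp
    | insert i s hi ih =>
      rw [Finset.prod_insert hi, Finset.sum_insert hi, Ring.ord_mul' _
        (mem_nonZeroDivisors_of_ne_zero (ha i)), ih]
  change Module.length B (V ⧸ N) = _
  rw [Ring.ord_eq_of_associated hass, hprod,
    (N.quotientEquivPiSpan b hr).length_eq, Module.length_pi_of_fintype]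
  rfl

/-- The absolute differentials of `B` are free on the dy_j, and the relative ones arise by killing
the dx_i. So Ω is the cokernel of the transposed Jacobian matrix. -/
lemma IsRootBasis.length_kaehlerDifferential {A B : Type*} [CommRing A] [IsDomain A] [CharP A p]
    [CommRing B] [IsDomain B] [IsPrincipalIdealRing B] [CharP B p] [Algebra A B] {x : ι → A}
    {y : ι → B} (hx : IsRootBasis p x) (hy : IsRootBasis p y)
    (hJ : (Matrix.of fun i j => hy.deriv j (algebraMap A B (x i))).det ≠ 0) :
    Module.length B (Ω[B⁄A]) =
      Ring.ord B (Matrix.of fun i j => hy.deriv j (algebraMap A B (x i))).det := by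
  set J : Matrix ι ι B := Matrix.of fun i j => hy.deriv j (algebraMap A B (x i)) with hJdef
  let f : (ι → B) →ₗ[B] (ι → B) := Matrix.toLin' J.transpose
  have hf : ∀ v j, f v j = ∑ i, v i * J i j := by
    intro v j
    simp [f, Matrix.toLin'_apply, Matrix.mulVec, dotProduct, mul_comm]
  have hdet : LinearMap.det f = J.det := by
    rw [LinearMap.det_toLin', Matrix.det_transpose]
  let Q := (ι → B) ⧸ LinearMap.range f
  let q : (ι → B) →ₗ[B] Q := (LinearMap.range f).mkQ
  -- By the chain rule the gradient of an element of `A` is a combination of the rows of the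
  -- Jacobian; this makes the gradient modulo the range an A-derivation.
  have hA : ∀ a : A, q (fun j => hy.deriv j (algebraMap A B a)) = 0 := by
    intro a
    refine (Submodule.Quotient.mk_eq_zero _).mpr ⟨fun i => algebraMap A B (hx.deriv i a), ?_⟩
    ext j
    have : hy.deriv j (algebraMap A B a) =
        ∑ i, hx.deriv i a • hy.deriv j (algebraMap A B (x i)) :=
      hx.derivation_eq_sum ((hy.deriv j).compAlgebraMap A) a
    rw [hf, this]
    simp only [Algebra.smul_def, J, Matrix.of_apply]
  have hmul : ∀ b c : B, q (fun j => hy.deriv j (b * c)) =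
      b • q (fun j => hy.deriv j c) + c • q (fun j => hy.deriv j b) := by
    intro b c
    rw [← map_smul, ← map_smul, ← map_add]
    congr 1
    ext j
    simp
  let E : Derivation A B Q := Derivation.mk'
    { toFun := fun b => q fun j => hy.deriv j b
      map_add' := fun b c => by
        rw [← map_add]
        congr 1
        ext j
        simp
      map_smul' := fun a b => by
        rw [Algebra.smul_def, hmul, hA, smul_zero, add_zero, RingHom.id_apply, algebraMap_smul] }
    hmul
  have hE : ∀ b, E b = q fun j => hy.deriv j b := fun b => rfl
  have hD : ∀ b : B, D A B b = ∑ j, hy.deriv j b • D A B (y j) :=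
    fun b => hy.derivation_eq_sum ((D A B).restrictScalars ℤ) b
  have hyd : ∀ i j, hy.deriv i (y j) = if i = j then 1 else 0 := fun i j =>
    (hy.isPBasis rootRange_left rootRange_right).partialDeriv_self rootRange_left i j
  let g : (ι → B) →ₗ[B] Ω[B⁄A] := Fintype.linearCombination B fun j => D A B (y j)
  have hg : ∀ v, g v = ∑ j, v j • D A B (y j) := fun v => rfl
  have hgf : LinearMap.range f ≤ LinearMap.ker g := by
    rintro _ ⟨v, rfl⟩
    rw [LinearMap.mem_ker, hg]
    simp only [hf, Finset.sum_smul]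
    rw [Finset.sum_comm]
    refine Finset.sum_eq_zero fun i _ => ?_
    simp only [mul_smul, ← Finset.smul_sum, J, Matrix.of_apply]
    rw [← hD, Derivation.map_algebraMap, smul_zero]
  let eqv : Ω[B⁄A] ≃ₗ[B] Q := LinearEquiv.ofLinearMap E.liftKaehlerDifferential
    ((LinearMap.range f).liftQ g hgf)
    (by
      refine Submodule.linearMap_qext _ (LinearMap.pi_ext' fun j => LinearMap.ext_ring ?_)
      simp only [LinearMap.comp_apply, Submodule.mkQ_apply, Submodule.liftQ_apply,
        LinearMap.id_apply, hg]
      rw [map_sum, Finset.sum_eq_single j]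
      · simp only [Derivation.liftKaehlerDifferential_comp_D, hE,
          LinearMap.coe_single, Pi.single_eq_same, one_smul]
        change q _ = q _
        congr 1
        ext i
        rw [hyd, Pi.single_apply]
      · intro i _ hi
        simp [hi]
      · simp)
    (by
      refine Derivation.liftKaehlerDifferential_unique _ _ ?_
      ext b
      change (LinearMap.range f).liftQ g hgf (E.liftKaehlerDifferential (D A B b)) = D A B b
      rw [Derivation.liftKaehlerDifferential_comp_D, hE, hD b]
      rfl)
  rw [eqv.length_eq, ← hdet]
  exact length_quotient_range (Pi.basisFun B ι) f (by rwa [hdet])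

/-- For a generically separable extension of discrete valuation rings, the length of the module of
differentials is the order of the Jacobian of `p`-bases, and this Jacobian measures how far the
extension of a generator of the `p⁻¹`-linear maps is from being a generator. -/
theorem exists_length_kaehlerDifferential {A B K M : Type u} [CommRing A] [IsDomain A]
    [IsDiscreteValuationRing A] [CommRing B] [IsDomain B] [IsDiscreteValuationRing B] [Field K]
    [Field M] [Algebra A K] [IsFractionRing A K] [Algebra B M] [IsFractionRing B M] [Algebra A B]
    [Algebra K M] [FiniteDimensional K M] [Algebra.IsSeparable K M]
    (hcomp : ∀ a, algebraMap B M (algebraMap A B a) = algebraMap K M (algebraMap A K a))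
    [CharP A p] [CharP B p] (hA : IsPowFinite p A) (hB : IsPowFinite p B) :
    ∃ (n : ℕ) (J : B), J ≠ 0 ∧ Module.length B (Ω[B⁄A]) = n ∧ Ring.ord B J = n ∧
      ∃ Φ : K →+ K, (∀ r z, Φ (r ^ p * z) = r * Φ z) ∧
        IsDualizing Φ (algebraMap A K).range (algebraMap A K).range ∧
        ∀ ψ : M →+ M, (∀ r z, ψ (r ^ p * z) = r * ψ z) →
          (∀ c, ψ (algebraMap K M c) = algebraMap K M (Φ c)) →
          IsDualizing (ψ.comp (AddMonoidHom.mulLeft (algebraMap B M J ^ (p - 1))))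
            (algebraMap B M).range (algebraMap B M).range := by
  have : CharP K p := charP_of_injective_algebraMap (IsFractionRing.injective A K) p
  have : CharP M p := charP_of_injective_algebraMap (IsFractionRing.injective B M) p
  obtain ⟨n, x, hx⟩ := exists_isRootBasis_of_isDiscreteValuationRing hA
  obtain ⟨n', y, hy⟩ := exists_isRootBasis_of_isDiscreteValuationRing hB
  have hxK := hx.fractionField (K := K)
  have hxM := hxK.of_isSeparable (M := M)
  have hyM := hy.fractionField (K := M)
  obtain rfl := hxM.card_eq hyM
  set J : B := (Matrix.of fun i j => hy.deriv j (algebraMap A B (x i))).det with hJ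
  have hJM : algebraMap B M J =
      (Matrix.of fun i j => hyM.deriv j (algebraMap K M (algebraMap A K (x i)))).det := by
    rw [hJ, RingHom.map_det]
    congr 1
    ext i j
    simp only [RingHom.mapMatrix_apply, Matrix.map_apply, Matrix.of_apply]
    rw [hy.map_deriv hyM, hcomp]
  have key : ∀ s, hyM.rootCoeff s = hxM.rootCoeff (algebraMap B M J ^ (p - 1) * s) := by
    intro s
    rw [hJM]
    exact hyM.rootCoeff_eq_rootCoeff_jacobian hxM s
  -- If J vanished, the top coefficient root for `y` would be zero, but it takes the value 1 on the
  -- top monomial.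
  have hJ0 : J ≠ 0 := by
    intro h0
    have h1 := key (∑ m, (Pi.single IsPBasis.top 1 : (Fin n → Fin p) → M) m ^ p *
      mono (fun i => algebraMap B M (y i)) (fun i => (m i : ℕ)))
    rw [hyM.rootCoeff_sum, h0, map_zero, zero_pow (Nat.sub_ne_zero_of_lt hp.1.one_lt), zero_mul,
      map_zero, Pi.single_eq_same] at h1
    exact one_ne_zero h1
  have hord := Ring.ord_ne_top (mem_nonZeroDivisors_of_ne_zero hJ0)
  refine ⟨(Ring.ord B J).toNat, J, hJ0, ?_, ?_, hxK.rootCoeff, hxK.rootCoeff_pow_mul,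
    hx.isDualizing hxK, ?_⟩
  · rw [ENat.natCast_toNat hord]
    exact hx.length_kaehlerDifferential hy hJ0
  · rw [ENat.natCast_toNat hord]
  · intro ψ hψ hext
    -- Any extension of Φ is determined on the monomials in `x`, which come from `K` and generate
    -- `M` over its p-th powers.
    have hψx : ∀ z, ψ z = hxM.rootCoeff z := by
      intro z
      obtain ⟨c, rfl⟩ := hxM.2 z
      rw [map_sum, map_sum]
      refine Finset.sum_congr rfl fun m _ => ?_
      rw [hψ, hxM.rootCoeff_pow_mul]
      have := hxK.map_rootCoeff (algebraMap K M) hxM (mono (fun i => algebraMap A K (x i)) fun i => (m i : ℕ))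
      rw [← map_mono, ← this, hext]
    have : ψ.comp (AddMonoidHom.mulLeft (algebraMap B M J ^ (p - 1))) = hyM.rootCoeff := by
      ext z
      rw [AddMonoidHom.comp_apply, hψx, key]
      rfl
    rw [this]
    exact hy.isDualizing hyM

end Transfer

end FrobeniusTranspose

/-! ### Duality for finite extensions and the calculus of orders -/

namespace FrobeniusTranspose

/-! ### Semilinear functionals and their orders -/

/-- `T : M → K` is linear along `σ : K → M`. -/
def IsSemilinear {K M : Type*} [CommRing K] [CommRing M] (σ : K →+* M) (T : M →+ K) : Prop :=
  ∀ c z, T (σ c * z) = c * T z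

/-- The elements `z` such that `T (z · )` maps `ℬ` to `𝒜` are those with `f z ∈ ℬ`. For invertible
`f` this means that `T = Φ (f · )`, where `Φ` generates the dual of `ℬ`. -/
def HasOrder {K M : Type*} [CommRing K] [CommRing M] (T : M →+ K) (𝒜 : Subring K)
    (ℬ : Subring M) (f : M) : Prop :=
  ∀ z, (∀ b ∈ ℬ, T (z * b) ∈ 𝒜) ↔ f * z ∈ ℬ

lemma IsDualizing.hasOrder {K M : Type*} [CommRing K] [CommRing M] {T : M →+ K} {𝒜 : Subring K}
    {ℬ : Subring M} (h : IsDualizing T 𝒜 ℬ) : HasOrder T 𝒜 ℬ 1 := fun z => by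
  rw [one_mul]
  exact h z

namespace HasOrder

variable {K M N : Type*} [Field K] [Field M] [Field N]

lemma div_mem {T : M →+ K} {𝒜 : Subring K} {ℬ : Subring M} {f f' : M} (h : HasOrder T 𝒜 ℬ f)
    (h' : HasOrder T 𝒜 ℬ f') (hf' : f' ≠ 0) : f / f' ∈ ℬ := by
  rw [div_eq_mul_inv]
  refine (h f'⁻¹).mp ((h' f'⁻¹).mpr ?_)
  rw [mul_inv_cancel₀ hf']
  exact ℬ.one_mem

lemma of_mulLeft {T : M →+ K} {𝒜 : Subring K} {ℬ : Subring M} {f g : M}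
    (h : HasOrder (T.comp (AddMonoidHom.mulLeft g)) 𝒜 ℬ f) (hg : g ≠ 0) :
    HasOrder T 𝒜 ℬ (f / g) := by
  intro z
  have := h (g⁻¹ * z)
  rw [← mul_assoc, ← div_eq_mul_inv] at this
  rw [← this]
  simp only [AddMonoidHom.comp_apply, AddMonoidHom.coe_mulLeft, ← mul_assoc,
    mul_inv_cancel₀ hg, one_mul]

lemma mulLeft {T : M →+ K} {𝒜 : Subring K} {ℬ : Subring M} {f : M}
    (h : HasOrder T 𝒜 ℬ f) (g : M) :
    HasOrder (T.comp (AddMonoidHom.mulLeft g)) 𝒜 ℬ (f * g) := by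
  intro z
  rw [mul_assoc, ← h (g * z)]
  simp only [AddMonoidHom.comp_apply, AddMonoidHom.coe_mulLeft, ← mul_assoc]

variable {𝒜 : Subring K} {ℬ : Subring M} {𝒞 : Subring N} {T : M →+ K} {S : N →+ M} {τ : M →+* N}

/-- As 𝒞 absorbs τ(ℬ), the condition on `T` can be tested on all of S(zc) · ℬ; by the order of `T`
it then says that s S(zc) = S(τ(s) z c) lies in ℬ. Both composition rules follow from this. -/
lemma forall_comp_mem_iff {s : M} (hT : HasOrder T 𝒜 ℬ s) (hS : IsSemilinear τ S)
    (hτ : ∀ b ∈ ℬ, τ b ∈ 𝒞) (z : N) :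
    (∀ c ∈ 𝒞, T (S (z * c)) ∈ 𝒜) ↔ ∀ c ∈ 𝒞, S (τ s * z * c) ∈ ℬ := by
  have h1 : ∀ c, S (τ s * z * c) = s * S (z * c) := fun c => by rw [mul_assoc, hS]
  simp only [h1]
  constructor
  · intro h c hc
    refine (hT _).mp fun b hb => ?_
    have := h (τ b * c) (𝒞.mul_mem (hτ b hb) hc)
    rwa [mul_left_comm, hS, mul_comm b] at this
  · intro h c hc
    have := (hT _).mpr (h c hc) 1 ℬ.one_mem
    rwa [mul_one] at this

lemma comp {s : M} {f : N} (hT : HasOrder T 𝒜 ℬ s) (hS : IsSemilinear τ S)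
    (hτ : ∀ b ∈ ℬ, τ b ∈ 𝒞) (h : HasOrder S ℬ 𝒞 f) : HasOrder (T.comp S) 𝒜 𝒞 (f * τ s) := by
  intro z
  rw [mul_assoc, ← h]
  exact hT.forall_comp_mem_iff hS hτ z

/-- The converse rule, which recovers the order of the inner map: substitute τ(s)⁻¹ z for z. -/
lemma of_comp {s : M} {f : N} (hT : HasOrder T 𝒜 ℬ s) (hs : s ≠ 0) (hS : IsSemilinear τ S)
    (hτ : ∀ b ∈ ℬ, τ b ∈ 𝒞) (h : HasOrder (T.comp S) 𝒜 𝒞 f) : HasOrder S ℬ 𝒞 (f / τ s) := by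
  intro z
  have hs' : τ s ≠ 0 := (map_ne_zero τ).mpr hs
  have := hT.forall_comp_mem_iff hS hτ ((τ s)⁻¹ * z)
  rw [mul_inv_cancel_left₀ hs'] at this
  rw [← this, div_eq_mul_inv, mul_assoc, ← h]
  rfl

end HasOrder

/-- `𝒜'` is the localization of `𝒜` at `𝒮`. -/
structure IsSubringLocalization {K : Type*} [Field K] (𝒮 : Submonoid K) (𝒜 𝒜' : Subring K) :
    Prop where
  le : 𝒜 ≤ 𝒜'
  mem : ∀ s ∈ 𝒮, s ∈ 𝒜
  ne_zero : ∀ s ∈ 𝒮, s ≠ 0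
  inv_mem : ∀ s ∈ 𝒮, s⁻¹ ∈ 𝒜'
  exists_mul_mem : ∀ a ∈ 𝒜', ∃ s ∈ 𝒮, s * a ∈ 𝒜

lemma IsSubringLocalization.exists_forall_mul_mem {K : Type*} [Field K] {𝒮 : Submonoid K}
    {𝒜 𝒜' : Subring K} (h : IsSubringLocalization 𝒮 𝒜 𝒜') {n : ℕ} (a : Fin n → K)
    (ha : ∀ i, a i ∈ 𝒜') : ∃ s ∈ 𝒮, ∀ i, s * a i ∈ 𝒜 := by
  choose s hs hsa using fun i => h.exists_mul_mem (a i) (ha i)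
  refine ⟨∏ i, s i, 𝒮.prod_mem fun i _ => hs i, fun i => ?_⟩
  rw [← Finset.prod_erase_mul _ _ (Finset.mem_univ i), mul_assoc]
  exact 𝒜.mul_mem (𝒜.prod_mem fun j _ => h.mem _ (hs j)) (hsa i)

/-- `ℬ` is generated by the `g i` as a module over `𝒜`. -/
def IsSpanning {K M : Type*} [CommRing K] [CommRing M] (σ : K →+* M) (𝒜 : Subring K)
    (ℬ : Subring M) {n : ℕ} (g : Fin n → M) : Prop :=
  ∀ b, b ∈ ℬ ↔ ∃ c : Fin n → K, (∀ i, c i ∈ 𝒜) ∧ b = ∑ i, σ (c i) * g i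

namespace IsSpanning

variable {K M : Type*} [Field K] [Field M] {σ : K →+* M} {𝒜 : Subring K} {ℬ : Subring M} {n : ℕ}
  {g : Fin n → M}

lemma mem (h : IsSpanning σ 𝒜 ℬ g) (i : Fin n) : g i ∈ ℬ :=
  (h _).mpr ⟨Pi.single i 1, fun j => by
    by_cases hj : j = i
    · subst hj; simp
    · simp [hj], by
    rw [Finset.sum_eq_single i]
    · simp
    · intro j _ hj; simp [hj]
    · simp⟩

lemma map_mem (h : IsSpanning σ 𝒜 ℬ g) {a : K} (ha : a ∈ 𝒜) : σ a ∈ ℬ := by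
  obtain ⟨c, hc, h1⟩ := (h 1).mp ℬ.one_mem
  refine (h _).mpr ⟨fun i => a * c i, fun i => 𝒜.mul_mem ha (hc i), ?_⟩
  conv_lhs => rw [← mul_one (σ a), h1, Finset.mul_sum]
  simp only [map_mul, mul_assoc]

lemma forall_mem_iff (h : IsSpanning σ 𝒜 ℬ g) {T : M →+ K} (hT : IsSemilinear σ T) (z : M) :
    (∀ b ∈ ℬ, T (z * b) ∈ 𝒜) ↔ ∀ i, T (z * g i) ∈ 𝒜 := by
  refine ⟨fun H i => H _ (h.mem i), fun H b hb => ?_⟩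
  obtain ⟨c, hc, rfl⟩ := (h b).mp hb
  rw [Finset.mul_sum, map_sum]
  refine 𝒜.sum_mem fun i _ => ?_
  rw [mul_left_comm, hT]
  exact 𝒜.mul_mem (hc i) (H i)

end IsSpanning

/-- Orders are compatible with localization. -/
lemma HasOrder.localization {K M : Type*} [Field K] [Field M] {σ : K →+* M} {𝒜 𝒜' : Subring K}
    {ℬ ℬ' : Subring M} {n : ℕ} {g : Fin n → M} {T : M →+ K} {f : M} (h : HasOrder T 𝒜 ℬ f)
    (hT : IsSemilinear σ T) (hg : IsSpanning σ 𝒜 ℬ g) {𝒮 : Submonoid K}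
    (h𝒜 : IsSubringLocalization 𝒮 𝒜 𝒜') (hℬ : IsSubringLocalization (𝒮.map σ) ℬ ℬ') :
    HasOrder T 𝒜' ℬ' f := by
  intro z
  constructor
  · intro hz
    -- Only finitely many values of `T` matter, so they have a common denominator; finite generation
    -- of ℬ is essential here.
    obtain ⟨s, hs, hsz⟩ := h𝒜.exists_forall_mul_mem (fun i => T (z * g i))
      fun i => hz _ (hℬ.le (hg.mem i))
    have h1 : f * (σ s * z) ∈ ℬ := by
      refine (h _).mp ((hg.forall_mem_iff hT _).mpr fun i => ?_)
      rw [mul_assoc, hT]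
      exact hsz i
    have h2 : f * z = (σ s)⁻¹ * (f * (σ s * z)) := by
      have := hℬ.ne_zero (σ s) ⟨s, hs, rfl⟩
      field_simp
    rw [h2]
    exact ℬ'.mul_mem (hℬ.inv_mem _ ⟨s, hs, rfl⟩) (hℬ.le h1)
  · intro hz b hb
    obtain ⟨_, ⟨s, hs, rfl⟩, hsz⟩ := hℬ.exists_mul_mem _ hz
    obtain ⟨_, ⟨t, ht, rfl⟩, htb⟩ := hℬ.exists_mul_mem _ hb
    have h1 := (h (σ s * z)).mpr (by rwa [mul_left_comm]) _ htb
    rw [show σ s * z * (σ t * b) = σ s * (σ t * (z * b)) by ring, hT, hT] at h1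
    have h2 : T (z * b) = s⁻¹ * (t⁻¹ * (s * (t * T (z * b)))) := by
      have hs0 := h𝒜.ne_zero s hs
      have ht0 := h𝒜.ne_zero t ht
      field_simp
    rw [h2]
    exact 𝒜'.mul_mem (h𝒜.inv_mem s hs) (𝒜'.mul_mem (h𝒜.inv_mem t ht) (h𝒜.le h1))

/-! ### Duality for finite field extensions -/

section Duality

variable {K M : Type*} [Field K] [Field M] {σ : K →+* M} {T : M →+ K}

lemma eq_zero_of_forall (hT0 : T ≠ 0) {g : M}
    (hg : ∀ z, T (g * z) = 0) : g = 0 := by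
  by_contra h0
  refine hT0 (AddMonoidHom.ext fun z => ?_)
  have := hg (g⁻¹ * z)
  rwa [mul_inv_cancel_left₀ h0] at this

lemma eq_of_forall (hT0 : T ≠ 0) {g g' : M}
    (hg : ∀ z, T (g * z) = T (g' * z)) : g = g' := by
  rw [← sub_eq_zero]
  refine eq_zero_of_forall hT0 fun z => ?_
  rw [sub_mul, map_sub, hg, sub_self]

/-- The map g ↦ T(g · ) from `M` to its dual is injective as `T` is nonzero, and both sides have the
same dimension over `K`. -/
lemma IsSemilinear.exists_eq (hσ : σ.Finite) (hT : IsSemilinear σ T) (hT0 : T ≠ 0) {Ψ : M →+ K}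
    (hΨ : IsSemilinear σ Ψ) : ∃ g, ∀ z, Ψ z = T (g * z) := by
  let := σ.toAlgebra
  have : FiniteDimensional K M := hσ
  have smul_def : ∀ (c : K) (z : M), c • z = σ c * z := fun c z => Algebra.smul_def c z
  let F : M →ₗ[K] Module.Dual K M :=
    { toFun := fun g =>
        { toFun := fun z => T (g * z)
          map_add' := fun a b => by rw [mul_add, map_add]
          map_smul' := fun c a => by rw [smul_def, mul_left_comm, hT]; rfl }
      map_add' := fun a b => by ext z; simp [add_mul]
      map_smul' := fun c a => by
        ext z
        simp only [LinearMap.coe_mk, AddHom.coe_mk, RingHom.id_apply, LinearMap.smul_apply]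
        rw [smul_def, mul_assoc, hT]; rfl }
  have hF : Function.Injective F := fun g g' h =>
    eq_of_forall hT0 fun z => LinearMap.congr_fun h z
  have hF' : Function.Surjective F := by
    refine (LinearMap.injective_iff_surjective_of_finrank_eq_finrank ?_).mp hF
    exact Subspace.dual_finrank_eq.symm
  obtain ⟨g, hg⟩ := hF'
    { toFun := Ψ
      map_add' := Ψ.map_add
      map_smul' := fun c a => by rw [smul_def, hΨ]; rfl }
  exact ⟨g, fun z => (LinearMap.congr_fun hg z).symm⟩

/-- Dual bases. -/
lemma IsSemilinear.exists_dual_basis (hσ : σ.Finite) (hT : IsSemilinear σ T) (hT0 : T ≠ 0) :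
    ∃ (d : ℕ) (m m' : Fin d → M), (∀ z, ∃ c : Fin d → K, z = ∑ i, σ (c i) * m i) ∧
      ∀ z, z = ∑ i, σ (T (z * m i)) * m' i := by
  let := σ.toAlgebra
  have : FiniteDimensional K M := hσ
  have smul_def : ∀ (c : K) (z : M), c • z = σ c * z := fun c z => Algebra.smul_def c z
  let b := Module.finBasis K M
  have h1 : ∀ i, ∃ g, ∀ z, b.repr z i = T (g * z) := fun i =>
    hT.exists_eq hσ hT0 (Ψ := (b.coord i).toAddMonoidHom) fun c z => by
      rw [← smul_def]
      exact (b.coord i).map_smul c z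
  choose m hm using h1
  have h2 : ∀ z, z = ∑ i, σ (T (z * m i)) * b i := by
    intro z
    conv_lhs => rw [← b.sum_repr z]
    refine Finset.sum_congr rfl fun i _ => ?_
    rw [smul_def, hm, mul_comm z]
  refine ⟨_, b, m, fun z => ⟨b.repr z, ?_⟩, fun z => ?_⟩
  · conv_lhs => rw [← b.sum_repr z]
    exact Finset.sum_congr rfl fun i _ => smul_def _ _
  -- The dual expansion follows from the first one by symmetry of the form (z, w) ↦ T(zw), by
  -- testing against w.
  · refine eq_of_forall hT0 fun w => ?_
    conv_lhs => rw [h2 w]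
    rw [Finset.mul_sum, map_sum, Finset.sum_mul, map_sum]
    refine Finset.sum_congr rfl fun i _ => ?_
    rw [mul_left_comm, hT, mul_assoc, hT, mul_comm w, mul_comm]

/-- Almost everywhere, `T` generates the dual. -/
lemma IsSemilinear.exists_finite_hasOrder_one (hσ : σ.Finite) (hT : IsSemilinear σ T) (hT0 : T ≠ 0)
    {n : ℕ} {g : Fin n → M} (hg : ∀ z, ∃ c : Fin n → K, z = ∑ i, σ (c i) * g i) :
    ∃ F : Set K, F.Finite ∧ ∀ (𝒜 : Subring K) (ℬ : Subring M), F ⊆ 𝒜 → IsSpanning σ 𝒜 ℬ g →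
      HasOrder T 𝒜 ℬ 1 := by
  obtain ⟨d, m, m', hm, hm'⟩ := hT.exists_dual_basis hσ hT0
  choose a ha using hm
  choose b hb using hg
  -- Once 𝒜 contains the transition coefficients between `g` and `m`, the Gram matrix of `m` and the
  -- coordinates of `m'` in `g`, the dual bases are bases over 𝒜 and the duality holds integrally.
  refine ⟨Set.range (fun x : Fin n × Fin d => a (g x.1) x.2) ∪
    Set.range (fun x : Fin d × Fin n => b (m x.1) x.2) ∪
    Set.range (fun x : Fin d × Fin d => T (m x.1 * m x.2)) ∪
    Set.range (fun x : Fin d × Fin n => b (m' x.1) x.2),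
    (((Set.finite_range _).union (Set.finite_range _)).union (Set.finite_range _)).union
      (Set.finite_range _), fun 𝒜 ℬ hF hℬ z => ?_⟩
  have h1 : ∀ i j, a (g i) j ∈ 𝒜 := fun i j => hF (Or.inl (Or.inl (Or.inl ⟨(i, j), rfl⟩)))
  have h2 : ∀ i j, b (m i) j ∈ 𝒜 := fun i j => hF (Or.inl (Or.inl (Or.inr ⟨(i, j), rfl⟩)))
  have h3 : ∀ i j, T (m i * m j) ∈ 𝒜 := fun i j => hF (Or.inl (Or.inr ⟨(i, j), rfl⟩))
  have h4 : ∀ i j, b (m' i) j ∈ 𝒜 := fun i j => hF (Or.inr ⟨(i, j), rfl⟩)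
  have hmℬ : ∀ i, m i ∈ ℬ := fun i => (hℬ _).mpr ⟨b (m i), h2 i, hb _⟩
  have hm'ℬ : ∀ i, m' i ∈ ℬ := fun i => (hℬ _).mpr ⟨b (m' i), h4 i, hb _⟩
  have hexp : ∀ z ∈ ℬ, ∃ c : Fin d → K, (∀ i, c i ∈ 𝒜) ∧ z = ∑ i, σ (c i) * m i := by
    intro z hz
    obtain ⟨c, hc, rfl⟩ := (hℬ z).mp hz
    refine ⟨fun j => ∑ i, c i * a (g i) j,
      fun j => 𝒜.sum_mem fun i _ => 𝒜.mul_mem (hc i) (h1 i j), ?_⟩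
    simp only [map_sum, Finset.sum_mul]
    rw [Finset.sum_comm]
    refine Finset.sum_congr rfl fun i _ => ?_
    conv_lhs => rw [ha (g i)]
    rw [Finset.mul_sum]
    refine Finset.sum_congr rfl fun j _ => ?_
    rw [map_mul, mul_assoc]
  rw [one_mul]
  constructor
  · intro hz
    rw [hm' z]
    exact ℬ.sum_mem fun i _ => ℬ.mul_mem (hℬ.map_mem (hz _ (hmℬ i))) (hm'ℬ i)
  · intro hz b hb
    obtain ⟨c, hc, rfl⟩ := hexp z hz
    obtain ⟨c', hc', rfl⟩ := hexp b hb
    rw [Finset.sum_mul_sum, map_sum]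
    refine 𝒜.sum_mem fun i _ => ?_
    rw [map_sum]
    refine 𝒜.sum_mem fun j _ => ?_
    rw [show σ (c i) * m i * (σ (c' j) * m j) = σ (c i) * (σ (c' j) * (m i * m j)) by ring, hT, hT]
    exact 𝒜.mul_mem (hc i) (𝒜.mul_mem (hc' j) (h3 i j))

/-- A nonzero functional has an order if `ℬ` is a principal ideal domain. -/
lemma IsSemilinear.exists_hasOrder (hσ : σ.Finite) (hT : IsSemilinear σ T) (hT0 : T ≠ 0)
    {𝒜 : Subring K} {ℬ : Subring M} {n : ℕ} {g : Fin n → M} (hg : IsSpanning σ 𝒜 ℬ g)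
    (h𝒜 : ∀ a : K, ∃ s ∈ 𝒜, s ≠ 0 ∧ s * a ∈ 𝒜) (hℬ : ∀ b : M, ∃ s ∈ 𝒜, s ≠ 0 ∧ σ s * b ∈ ℬ)
    [IsPrincipalIdealRing ℬ] : ∃ f, f ≠ 0 ∧ HasOrder T 𝒜 ℬ f := by
  obtain ⟨d, m, m', -, hm'⟩ := hT.exists_dual_basis hσ hT0
  have hden : ∀ (k : ℕ) (b : Fin k → M), ∃ s ∈ 𝒜, s ≠ 0 ∧ ∀ i, σ s * b i ∈ ℬ := by
    intro k b
    choose s hs hs0 hsb using fun i => hℬ (b i)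
    refine ⟨∏ i, s i, 𝒜.prod_mem fun i _ => hs i, Finset.prod_ne_zero_iff.mpr fun i _ => hs0 i,
      fun i => ?_⟩
    rw [← Finset.prod_erase_mul _ _ (Finset.mem_univ i), map_mul, mul_assoc]
    exact ℬ.mul_mem (hg.map_mem (𝒜.prod_mem fun j _ => hs j)) (hsb i)
  obtain ⟨s, hs, hs0, hsm⟩ := hden _ m
  obtain ⟨s', hs', hs'0, hsm'⟩ := hden _ m'
  obtain ⟨t, ht, ht0, htg⟩ : ∃ t ∈ 𝒜, t ≠ 0 ∧ ∀ i, t * T (g i) ∈ 𝒜 := by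
    choose s hs hs0 hsb using fun i => h𝒜 (T (g i))
    refine ⟨∏ i, s i, 𝒜.prod_mem fun i _ => hs i, Finset.prod_ne_zero_iff.mpr fun i _ => hs0 i,
      fun i => ?_⟩
    rw [← Finset.prod_erase_mul _ _ (Finset.mem_univ i), mul_assoc]
    exact 𝒜.mul_mem (𝒜.prod_mem fun j _ => hs j) (hsb i)
  -- The fractional ideal {z | T(zℬ) ⊆ 𝒜}, multiplied by σ(s s') to make it an ideal of ℬ.
  let I : Ideal ℬ :=
    { carrier := {b | ∀ c ∈ ℬ, T ((σ (s * s'))⁻¹ * b * c) ∈ 𝒜}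
      add_mem' := fun {a b} ha hb c hc => by
        rw [Subring.coe_add, mul_add, add_mul, map_add]
        exact 𝒜.add_mem (ha c hc) (hb c hc)
      zero_mem' := fun c _ => by simp
      smul_mem' := fun a b hb c hc => by
        have := hb (a * c) (ℬ.mul_mem a.2 hc)
        rwa [show (σ (s * s'))⁻¹ * (b : M) * (a * c) = (σ (s * s'))⁻¹ * ((a • b : ℬ) : M) * c by
          rw [smul_eq_mul, Subring.coe_mul]; ring] at this }
  have hss : σ (s * s') ≠ 0 := (map_ne_zero σ).mpr (mul_ne_zero hs0 hs'0)
  have hI : ∀ z, (∀ b ∈ ℬ, T (z * b) ∈ 𝒜) ↔ ∃ b ∈ I, (b : M) = σ (s * s') * z := by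
    intro z
    constructor
    · intro hz
      -- In the dual expansion of z, the factor s makes m_i integral inside `T` and s' does the same
      -- for m'_i.
      have hmem : σ (s * s') * z ∈ ℬ := by
        rw [hm' z, Finset.mul_sum]
        refine ℬ.sum_mem fun i _ => ?_
        have h1 : T (z * (σ s * m i)) ∈ 𝒜 := hz _ (hsm i)
        rw [mul_left_comm, hT] at h1
        rw [show σ (s * s') * (σ (T (z * m i)) * m' i) = σ (s * T (z * m i)) * (σ s' * m' i) by
          rw [σ.map_mul, σ.map_mul]; ring]
        exact ℬ.mul_mem (hg.map_mem h1) (hsm' i)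
      refine ⟨⟨_, hmem⟩, fun c hc => ?_, rfl⟩
      change T ((σ (s * s'))⁻¹ * (σ (s * s') * z) * c) ∈ 𝒜
      rw [inv_mul_cancel_left₀ hss]
      exact hz c hc
    · rintro ⟨b, hb, hbz⟩ c hc
      have := hb c hc
      rwa [hbz, inv_mul_cancel_left₀ hss] at this
  obtain ⟨w, hw⟩ := IsPrincipalIdealRing.principal I
  -- The ideal is not zero: it contains σ(s s') σ(t), because t clears the denominators of the
  -- values T(g_i).
  have hw0 : (w : M) ≠ 0 := by
    intro h0
    have hw' : w = 0 := Subtype.ext h0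
    obtain ⟨b, hb, hbz⟩ := (hI (σ t)).mp ((hg.forall_mem_iff hT _).mpr fun i => by
      rw [hT]; exact htg i)
    rw [hw, hw', Submodule.span_zero_singleton, Submodule.mem_bot] at hb
    rw [hb, Subring.coe_zero] at hbz
    exact mul_ne_zero hss ((map_ne_zero σ).mpr ht0) hbz.symm
  refine ⟨σ (s * s') / w, div_ne_zero hss hw0, fun z => ?_⟩
  rw [hI]
  constructor
  · rintro ⟨b, hb, hbz⟩
    rw [hw] at hb
    obtain ⟨c, rfl⟩ := Submodule.mem_span_singleton.mp hb
    rw [div_mul_eq_mul_div, ← hbz, smul_eq_mul, Subring.coe_mul, mul_div_cancel_right₀ _ hw0]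
    exact c.2
  · intro h
    refine ⟨⟨_, h⟩ * w, by rw [hw]; exact Ideal.mul_mem_left _ _ (Submodule.mem_span_singleton_self w), ?_⟩
    rw [Subring.coe_mul]
    field_simp

/-- Transposes of `p^{-e}`-linear maps of fields. -/
lemma IsSemilinear.exists_transpose {p : ℕ} [hp : Fact p.Prime] [CharP M p]
    (hσ : σ.Finite) (hT : IsSemilinear σ T) (hT0 : T ≠ 0) (e : ℕ) {φ : K →+ K}
    (hφ : ∀ r z, φ (r ^ p ^ e * z) = r * φ z) :
    ∃ ψ : M →+ M, (∀ r z, ψ (r ^ p ^ e * z) = r * ψ z) ∧ ∀ z, T (ψ z) = φ (T z) := by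
  -- The functional w ↦ φ(T(w^q z)) is additive by Frobenius and linear over `K`, hence of the form
  -- T(g · ); this g is ψ(z), and w = 1 gives the transpose identity.
  have h1 : ∀ z : M, ∃ g, ∀ w, φ (T (w ^ p ^ e * z)) = T (g * w) := by
    intro z
    obtain ⟨g, hg⟩ := hT.exists_eq hσ hT0
      (Ψ := ⟨⟨fun w => φ (T (w ^ p ^ e * z)), by simp [hp.1.ne_zero]⟩, fun a b => by
        simp only [add_pow_char_pow, add_mul, map_add]⟩) (fun c w => by
        simp only [AddMonoidHom.coe_mk, ZeroHom.coe_mk]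
        rw [mul_pow, ← map_pow, mul_assoc, hT, hφ])
    exact ⟨g, hg⟩
  choose ψ hψ using h1
  refine ⟨⟨⟨ψ, ?_⟩, fun a b => ?_⟩, fun r z => ?_, fun z => ?_⟩
  · refine eq_zero_of_forall hT0 fun w => ?_
    rw [← hψ, mul_zero, map_zero, map_zero]
  · refine eq_of_forall hT0 fun w => ?_
    change T (ψ (a + b) * w) = T ((ψ a + ψ b) * w)
    rw [add_mul, map_add, ← hψ, ← hψ, ← hψ, mul_add, map_add, map_add]
  · refine eq_of_forall hT0 fun w => ?_
    change T (ψ (r ^ p ^ e * z) * w) = T (r * ψ z * w)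
    rw [← hψ, ← mul_assoc, ← mul_pow, hψ]
    congr 1
    ring
  · have := hψ z 1
    rw [one_pow, one_mul, mul_one] at this
    exact this.symm

/-- The order of a transpose. -/
lemma HasOrder.transpose {q : ℕ} {FM : M →+* M}
    (hFM : ∀ r, FM r = r ^ q) {𝒜 : Subring K} {ℬ : Subring M} (hσℬ : ∀ a ∈ 𝒜, σ a ∈ ℬ)
    {φ : K →+ K} {ψ : M →+ M} {f : K} {s : M} (hφ : HasOrder φ 𝒜 𝒜 f)
    (hTs : HasOrder T 𝒜 ℬ s) (hs : s ≠ 0) (hT : IsSemilinear σ T)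
    (hψ : ∀ r z, ψ (r ^ q * z) = r * ψ z) (h : ∀ z, T (ψ z) = φ (T z)) :
    HasOrder ψ ℬ ℬ (s * σ f / s ^ q) := by
  -- The order of φ ∘ T = T ∘ ψ is computed through both factorizations, and s^q, the Frobenius
  -- image of the order of T, is cancelled.
  have h1 : HasOrder (φ.comp T) 𝒜 ℬ (s * σ f) := hφ.comp hT hσℬ hTs
  have h2 : φ.comp T = T.comp ψ := by ext z; exact (h z).symm
  rw [h2] at h1
  have := hTs.of_comp (τ := FM) hs (fun c z => by rw [hFM, hψ]) (fun b hb => by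
    rw [hFM]; exact ℬ.pow_mem hb q) h1
  rwa [hFM] at this

end Duality

/-! ### Intersections of localizations at primes of height one -/

/-- A Noetherian integrally closed domain is the intersection of its localizations at the prime
ideals of height one. -/
theorem exists_algebraMap_eq_of_forall_height_one {R K : Type*} [CommRing R] [IsDomain R]
    [IsNoetherianRing R] [IsIntegrallyClosed R] [Field K] [Algebra R K] [IsFractionRing R K] (z : K)
    (h : ∀ P : Ideal R, P.IsPrime → P.height = 1 →
      ∃ s ∉ P, ∃ a, algebraMap R K s * z = algebraMap R K a) : ∃ a, algebraMap R K a = z := by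
  by_contra hz
  let N := (LinearMap.range (Algebra.linearMap R K))
  have hN : ∀ w : K, (Submodule.Quotient.mk w : K ⧸ N) = 0 ↔ ∃ a, algebraMap R K a = w := by
    intro w
    rw [Submodule.Quotient.mk_eq_zero]
    rfl
  -- If z is not in R, its class in K / R has its annihilator inside an associated prime `P`, which
  -- is the exact annihilator of the class of some w. It remains to see that `P` has height one.
  obtain ⟨P, hP, hzP⟩ := exists_le_isAssociatedPrime_of_isNoetherianRing R
    (Submodule.Quotient.mk z : K ⧸ N) (by rwa [Ne, hN])
  rw [isAssociatedPrime_iff] at hP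
  obtain ⟨hprime, y, hy⟩ := hP
  obtain ⟨w, rfl⟩ := Submodule.Quotient.mk_surjective N y
  have hPw : ∀ a, a ∈ P ↔ ∃ b, algebraMap R K b = algebraMap R K a * w := by
    intro a
    rw [hy, Submodule.mem_colon_singleton, Submodule.mem_bot, ← Submodule.Quotient.mk_smul, hN,
      Algebra.smul_def]
  have hzP' : ∀ a b, algebraMap R K b = algebraMap R K a * z → a ∈ P := by
    intro a b hab
    apply hzP
    rw [Submodule.mem_colon_singleton, Submodule.mem_bot, ← Submodule.Quotient.mk_smul, hN]
    exact ⟨b, by rw [hab, Algebra.smul_def]⟩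
  have hw : ¬ ∃ a, algebraMap R K a = w := by
    intro ⟨a, ha⟩
    exact hprime.ne_top ((Ideal.eq_top_iff_one P).mpr ((hPw 1).mpr ⟨a, by simpa using ha⟩))
  have hP0 : P ≠ ⊥ := by
    obtain ⟨c, b, hb, hcb⟩ := IsFractionRing.div_surjective (A := R) w
    have hb0 : algebraMap R K b ≠ 0 := by simpa using nonZeroDivisors.ne_zero hb
    intro h0
    have : b ∈ P := (hPw b).mpr ⟨c, by rw [← hcb]; field_simp⟩
    rw [h0, Ideal.mem_bot] at this
    exact nonZeroDivisors.ne_zero hb this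
  -- Otherwise w P ⊆ P, and w would be integral over R since P is a nonzero finitely generated
  -- module.
  obtain ⟨a, haP, u, hu, huP⟩ : ∃ a ∈ P, ∃ u, algebraMap R K u = algebraMap R K a * w ∧ u ∉ P := by
    by_contra! hcon
    refine hw (IsIntegrallyClosed.isIntegral_iff.mp
      (isIntegral_of_smul_mem_submodule (A := K) (N := Submodule.map (Algebra.linearMap R K) P)
        ?_ ((IsNoetherian.noetherian P).map _) w ?_))
    · intro h0
      refine hP0 (Submodule.eq_bot_iff _ |>.mpr fun b hb => ?_)
      have : algebraMap R K b ∈ Submodule.map (Algebra.linearMap R K) P := ⟨b, hb, rfl⟩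
      rw [h0, Submodule.mem_bot] at this
      exact (IsFractionRing.to_map_eq_zero_iff (K := K)).mp this
    · rintro _ ⟨b, hb, rfl⟩
      obtain ⟨c, hc⟩ := (hPw b).mp hb
      exact ⟨c, hcon b hb c hc, by rw [Algebra.linearMap_apply, hc, smul_eq_mul, mul_comm]; rfl⟩
  -- From a w = u outside P: each b in P satisfies u b = (b w) a, so a prime below P containing a
  -- also contains b. Krull's theorem now bounds the height.
  have hmin : P ∈ (Ideal.span {a}).minimalPrimes := by
    refine ⟨⟨hprime, (Ideal.span_singleton_le_iff_mem P).mpr haP⟩, ?_⟩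
    rintro Q ⟨hQ, haQ⟩ hQP b hb
    obtain ⟨c, hc⟩ := (hPw b).mp hb
    have h1 : u * b = c * a := by
      apply IsFractionRing.injective R K
      rw [map_mul, map_mul, hu, hc]
      ring
    have h2 : u * b ∈ Q := by
      rw [h1]
      exact Q.mul_mem_left c (haQ (Ideal.mem_span_singleton_self a))
    exact (hQ.mem_or_mem h2).resolve_left fun hu => huP (hQP hu)
  have hle := Ideal.height_le_one_of_isPrincipal_of_mem_minimalPrimes _ P hmin
  have hne : P.height ≠ 0 := by
    rwa [Ne, Ideal.height_eq_zero_iff_eq_bot]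
  obtain ⟨s, hs, b, hb⟩ := h P hprime
    (le_antisymm hle (Order.one_le_iff_ne_zero.mpr hne))
  exact hs (hzP' s b hb.symm)

end FrobeniusTranspose

/-! ### Normal schemes: local rings in the function field and finite morphisms -/

namespace FrobeniusTranspose

/-! ### Local rings as subrings of the function field -/

section FunctionField

set_option linter.unusedSectionVars false

variable {X : Scheme.{u}} [IsIntegral X]

lemma genericPoint_mem {U : X.Opens} {x : X} (hx : x ∈ U) : genericPoint X ∈ U :=
  (genericPoint_specializes x).mem_open U.isOpen hx

/-- The rational function defined by a section over an open set. -/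
def sectionToField (U : X.Opens) (h : genericPoint X ∈ U) : Γ(X, U) →+* X.functionField :=
  (X.presheaf.germ U (genericPoint X) h).hom

lemma sectionToField_injective {U : X.Opens} (h : genericPoint X ∈ U) :
    Function.Injective (sectionToField U h) :=
  germ_injective_of_isIntegral X _ _

lemma sectionToField_map {U V : X.Opens} (i : V ⟶ U) (h : genericPoint X ∈ V) (s : Γ(X, U)) :
    sectionToField V h (X.presheaf.map i.op s) = sectionToField U (i.le h) s :=
  X.presheaf.germ_res_apply i _ h s

/-- The local ring at a point, as a subring of the function field. -/
def stalkSubring (x : X) : Subring X.functionField :=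
  (algebraMap (X.presheaf.stalk x) X.functionField).range

lemma algebraMap_germ {U : X.Opens} {x : X} (hx : x ∈ U) (s : Γ(X, U)) :
    algebraMap (X.presheaf.stalk x) X.functionField (X.presheaf.germ U x hx s) =
      sectionToField U (genericPoint_mem hx) s := by
  change X.presheaf.stalkSpecializes _ (X.presheaf.germ U x hx s) = _
  rw [TopCat.Presheaf.germ_stalkSpecializes_apply]
  rfl

lemma sectionToField_mem {U : X.Opens} (h : genericPoint X ∈ U) (s : Γ(X, U)) {x : X}
    (hx : x ∈ U) : sectionToField U h s ∈ stalkSubring x :=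
  ⟨_, algebraMap_germ hx s⟩

lemma mem_stalkSubring_iff {x : X} {z : X.functionField} :
    z ∈ stalkSubring x ↔ ∃ (U : X.Opens) (hx : x ∈ U) (s : Γ(X, U)),
      sectionToField U (genericPoint_mem hx) s = z := by
  constructor
  · rintro ⟨a, rfl⟩
    obtain ⟨U, hx, s, rfl⟩ := X.presheaf.exists_germ_eq a
    exact ⟨U, hx, s, (algebraMap_germ hx s).symm⟩
  · rintro ⟨U, hx, s, rfl⟩
    exact sectionToField_mem _ s hx

lemma exists_sectionToField_eq (z : X.functionField) :
    ∃ (U : X.Opens) (h : genericPoint X ∈ U) (s : Γ(X, U)), sectionToField U h s = z :=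
  X.presheaf.exists_germ_eq z

lemma stalkSubring_genericPoint : stalkSubring (genericPoint X) = ⊤ := by
  rw [eq_top_iff]
  intro z _
  obtain ⟨U, h, s, rfl⟩ := exists_sectionToField_eq z
  exact sectionToField_mem h s h

/-- A rational function that is regular at all points of `U` is a section over `U`. -/
lemma exists_section_of_forall_mem {U : X.Opens} (h : genericPoint X ∈ U) {z : X.functionField}
    (hz : ∀ x ∈ U, z ∈ stalkSubring x) : ∃ s, sectionToField U h s = z := by
  choose V hxV s hs using fun x : U => mem_stalkSubring_iff.mp (hz x.1 x.2)
  have hgen : ∀ x, genericPoint X ∈ V x ⊓ U := fun x => ⟨genericPoint_mem (hxV x), h⟩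
  obtain ⟨t, ht, -⟩ := X.sheaf.existsUnique_gluing' (fun x : U => V x ⊓ U) U
    (fun x => homOfLE inf_le_right) (fun x hx => Opens.mem_iSup.mpr ⟨⟨x, hx⟩, hxV _, hx⟩)
    (fun x => X.presheaf.map (homOfLE (inf_le_left : V x ⊓ U ≤ V x)).op (s x)) (by
      intro x y
      apply sectionToField_injective (U := (V x ⊓ U) ⊓ (V y ⊓ U)) ⟨hgen x, hgen y⟩
      exact ((sectionToField_map _ _ _).trans ((sectionToField_map _ _ _).trans ((hs x).trans
        (hs y).symm))).trans ((sectionToField_map _ _ _).trans (sectionToField_map _ _ _)).symm)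
  have ht' := ht ⟨_, h⟩
  refine ⟨t, ?_⟩
  rw [← sectionToField_map (homOfLE (inf_le_right : V ⟨_, h⟩ ⊓ U ≤ U)) (hgen _) t,
    ← hs ⟨_, h⟩, ← sectionToField_map (homOfLE (inf_le_left : V ⟨_, h⟩ ⊓ U ≤ V ⟨_, h⟩)) (hgen _)]
  exact congrArg _ ht'

lemma exists_open_forall_mem (F : Set X.functionField) (hF : F.Finite) :
    ∃ U : X.Opens, genericPoint X ∈ U ∧ ∀ x ∈ U, F ⊆ stalkSubring x := by
  induction F, hF using Set.Finite.induction_on with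
  | empty => exact ⟨⊤, trivial, by simp⟩
  | @insert a F _ _ ih =>
    obtain ⟨U, hU, hUF⟩ := ih
    obtain ⟨V, hV, s, rfl⟩ := exists_sectionToField_eq a
    refine ⟨U ⊓ V, ⟨hU, hV⟩, fun x hx => Set.insert_subset ?_ (hUF x hx.1)⟩
    exact sectionToField_mem hV s hx.2

lemma isUnit_iff_inv_mem {x : X} {a : X.presheaf.stalk x} (ha : a ≠ 0) :
    IsUnit a ↔ (algebraMap _ X.functionField a)⁻¹ ∈ stalkSubring x := by
  have h0 : algebraMap _ X.functionField a ≠ 0 := by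
    simpa using ha
  constructor
  · rintro ⟨u, rfl⟩
    exact ⟨(u⁻¹ : (X.presheaf.stalk x)ˣ), by
      apply eq_inv_of_mul_eq_one_left
      rw [← map_mul, Units.inv_mul, map_one]⟩
  · rintro ⟨b, hb⟩
    refine IsUnit.of_mul_eq_one b (IsFractionRing.injective _ X.functionField ?_)
    rw [map_mul, hb, mul_inv_cancel₀ h0, map_one]

/-! ### Affine open sets -/

lemma notMem_primeIdealOf_iff {U : X.Opens} (hU : IsAffineOpen U) {x : X} (hx : x ∈ U)
    (s : Γ(X, U)) : s ∉ (hU.primeIdealOf ⟨x, hx⟩).asIdeal ↔ IsUnit (X.presheaf.germ U x hx s) := by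
  rw [hU.primeIdealOf_eq_map_closedPoint]
  change ¬ (X.presheaf.germ U x hx s ∈ IsLocalRing.maximalIdeal (X.presheaf.stalk x)) ↔ _
  rw [IsLocalRing.mem_maximalIdeal, mem_nonunits_iff, not_not]

lemma exists_mul_eq_of_isAffineOpen {U : X.Opens} (hU : IsAffineOpen U) {x : X} (hx : x ∈ U)
    {z : X.functionField} (hz : z ∈ stalkSubring x) : ∃ s a : Γ(X, U),
      IsUnit (X.presheaf.germ U x hx s) ∧
      sectionToField U (genericPoint_mem hx) s * z = sectionToField U (genericPoint_mem hx) a := by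
  obtain ⟨b, rfl⟩ := hz
  let := TopCat.Presheaf.algebra_section_stalk X.presheaf (⟨x, hx⟩ : U)
  have := hU.isLocalization_stalk ⟨x, hx⟩
  obtain ⟨⟨a, s⟩, h⟩ := IsLocalization.surj (hU.primeIdealOf ⟨x, hx⟩).asIdeal.primeCompl b
  refine ⟨s, a, (notMem_primeIdealOf_iff hU hx s).mp s.2, ?_⟩
  rw [← algebraMap_germ hx, ← algebraMap_germ hx, mul_comm, ← map_mul]
  exact congrArg _ h

lemma inv_mem_of_isUnit_germ {U : X.Opens} {x : X} (hx : x ∈ U) {s : Γ(X, U)}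
    (hs : IsUnit (X.presheaf.germ U x hx s)) :
    (sectionToField U (genericPoint_mem hx) s)⁻¹ ∈ stalkSubring x := by
  rw [← algebraMap_germ hx]
  exact (isUnit_iff_inv_mem hs.ne_zero).mp hs

lemma isFractionRing_of_isAffineOpen {U : X.Opens} (hU : IsAffineOpen U)
    (h : genericPoint X ∈ U) :
    letI := (sectionToField U h).toAlgebra
    IsFractionRing Γ(X, U) X.functionField := by
  have : Nonempty U := ⟨⟨_, h⟩⟩
  exact functionField_isFractionRing_of_isAffineOpen X U hU

lemma isDomain_of_mem {U : X.Opens} (h : genericPoint X ∈ U) : IsDomain Γ(X, U) :=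
  (sectionToField_injective h).isDomain _

/-- An element integral over the sections is integral over every stalk, hence lies in all of them
and is a section. -/
lemma isIntegrallyClosed_of_isAffineOpen (hX : IsNormal X) {U : X.Opens} (hU : IsAffineOpen U)
    (h : genericPoint X ∈ U) : IsIntegrallyClosed Γ(X, U) := by
  let := (sectionToField U h).toAlgebra
  have := isFractionRing_of_isAffineOpen hU h
  have := isDomain_of_mem h
  rw [isIntegrallyClosed_iff X.functionField]
  intro z hz
  refine exists_section_of_forall_mem h fun x hx => ?_
  have := (hX x).2
  let := (X.presheaf.germ U x hx).hom.toAlgebra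
  have : IsScalarTower Γ(X, U) (X.presheaf.stalk x) X.functionField :=
    IsScalarTower.of_algebraMap_eq fun s => (algebraMap_germ hx s).symm
  exact IsIntegrallyClosed.isIntegral_iff.mp (hz.tower_top (A := X.presheaf.stalk x))

lemma exists_point_of_prime {U : X.Opens} (hU : IsAffineOpen U) (P : Ideal Γ(X, U))
    [hP : P.IsPrime] : ∃ (x : X) (hx : x ∈ U), hU.primeIdealOf ⟨x, hx⟩ = ⟨P, hP⟩ ∧
      Order.coheight x = P.height := by
  let y : Spec Γ(X, U) := ⟨P, hP⟩
  have hy : hU.fromSpec y ∈ U := by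
    have : hU.fromSpec y ∈ Set.range hU.fromSpec := ⟨y, rfl⟩
    rwa [hU.range_fromSpec] at this
  refine ⟨hU.fromSpec y, hy, ?_, ?_⟩
  · have h1 := hU.fromSpec_primeIdealOf ⟨_, hy⟩
    exact hU.fromSpec.isOpenEmbedding.injective h1
  · rw [coheight_eq_of_isOpenImmersion, ← idealHeight_eq_coheight]

lemma height_primeIdealOf {U : X.Opens} (hU : IsAffineOpen U) {x : X} (hx : x ∈ U) :
    (hU.primeIdealOf ⟨x, hx⟩).asIdeal.height = Order.coheight x := by
  have h1 := hU.fromSpec_primeIdealOf ⟨x, hx⟩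
  have h2 := idealHeight_eq_coheight Γ(X, U) (hU.primeIdealOf ⟨x, hx⟩)
  have h3 := coheight_eq_of_isOpenImmersion (x := (hU.primeIdealOf ⟨x, hx⟩ : Spec Γ(X, U)))
    hU.fromSpec
  exact h2.trans (h3.symm.trans (congrArg _ h1))

/-- On a normal scheme, a rational function that is regular in codimension one on `U` is a section
over `U`. -/
theorem exists_section_of_forall_coheight_one [IsLocallyNoetherian X] (hX : IsNormal X)
    {U : X.Opens} (h : genericPoint X ∈ U) {z : X.functionField}
    (hz : ∀ x ∈ U, Order.coheight x = 1 → z ∈ stalkSubring x) :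
    ∃ s, sectionToField U h s = z := by
  refine exists_section_of_forall_mem h fun x hx => ?_
  obtain ⟨_, ⟨V, hV, rfl⟩, hxV, hVU⟩ := X.isBasis_affineOpens.exists_subset_of_mem_open hx U.isOpen
  have hgV : genericPoint X ∈ V := genericPoint_mem hxV
  have := isIntegrallyClosed_of_isAffineOpen hX hV hgV
  let := (sectionToField V hgV).toAlgebra
  have := isFractionRing_of_isAffineOpen hV hgV
  have := isDomain_of_mem hgV
  have : IsNoetherianRing Γ(X, V) := IsLocallyNoetherian.component_noetherian ⟨V, hV⟩
  obtain ⟨a, rfl⟩ := exists_algebraMap_eq_of_forall_height_one (R := Γ(X, V)) z fun P hP hht => by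
    obtain ⟨y, hy, hPy, hcoh⟩ := exists_point_of_prime hV P
    obtain ⟨s, a, hs, hsa⟩ := exists_mul_eq_of_isAffineOpen hV hy
      (hz y (hVU hy) (hcoh.trans hht))
    rw [← notMem_primeIdealOf_iff hV hy, hPy] at hs
    exact ⟨s, hs, a, hsa⟩
  exact sectionToField_mem hgV a hxV

/-! ### Points of codimension one -/

/-- A point strictly between x and the generic point would give a chain of length two. -/
lemma eq_of_specializes {x g : X} (hx : Order.coheight x = 1) (h : g ⤳ x)
    (hg : g ≠ genericPoint X) : g = x := by
  by_contra hne
  have h1 : x ≤ g := h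
  have h2 : x < g := lt_of_le_not_ge h1 fun h' => hne (Specializes.antisymm h h').eq
  have h3 : g ≤ genericPoint X := genericPoint_specializes g
  have h4 : g < genericPoint X := lt_of_le_not_ge h3 fun h' =>
    hg (Specializes.antisymm (show g ⤳ genericPoint X from h') h3).eq
  have h5 := Order.coheight_add_one_le h4
  have h6 := Order.coheight_add_one_le h2
  rw [hx] at h6
  have h7 : Order.coheight g ≠ 0 := by
    intro h0
    rw [h0] at h5
    simp at h5
  have h8 : (1 : ℕ∞) + 1 ≤ 1 := (add_le_add_left (Order.one_le_iff_ne_zero.mpr h7) 1).trans h6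
  exact absurd h8 (by decide)

lemma ne_genericPoint {x : X} (hx : Order.coheight x = 1) : x ≠ genericPoint X := by
  rintro rfl
  have : IsMax (genericPoint X) := fun y _ => genericPoint_specializes y
  rw [Order.coheight_eq_zero.mpr this] at hx
  exact zero_ne_one hx

/-- Such a point is the generic point of one of the finitely many irreducible closed sets making up
the complement. This is the source of finite support for all the divisors. -/
lemma finite_coheight_one_notMem [NoetherianSpace X] {U : X.Opens} (h : genericPoint X ∈ U) :
    {x : X | Order.coheight x = 1 ∧ x ∉ U}.Finite := by
  obtain ⟨S, hS, hcl, hirr, hU⟩ :=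
    NoetherianSpace.exists_finite_set_isClosed_irreducible U.isOpen.isClosed_compl
  refine Set.Finite.subset (s := ⋃ t ∈ S, {x | IsGenericPoint x t}) ?_ ?_
  · refine hS.biUnion fun t _ => Set.Subsingleton.finite ?_
    intro a ha b hb
    exact ha.eq hb
  · rintro x ⟨hx, hxU⟩
    have hx' : x ∈ (U : Set X)ᶜ := hxU
    rw [hU] at hx'
    obtain ⟨t, ht, hxt⟩ := hx'
    simp only [Set.mem_iUnion]
    refine ⟨t, ht, ?_⟩
    obtain ⟨g, hg⟩ := QuasiSober.sober (hirr t ht) (hcl t ht)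
    have h1 : g = x := eq_of_specializes hx (hg.specializes hxt) (by
      rintro rfl
      have : genericPoint X ∈ (U : Set X)ᶜ := by
        rw [hU]
        exact ⟨t, ht, hg.mem⟩
      exact this h)
    rw [← h1]
    exact hg

lemma isDiscreteValuationRing_stalk [IsLocallyNoetherian X] (hX : IsNormal X) {x : X}
    (hx : Order.coheight x = 1) : IsDiscreteValuationRing (X.presheaf.stalk x) := by
  have := (hX x).2
  have hdim := ringKrullDim_stalk_eq_coheight x
  rw [hx] at hdim
  have hnf : ¬ IsField (X.presheaf.stalk x) := by
    intro h
    rw [ringKrullDim_eq_zero_of_isField h] at hdim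
    exact absurd hdim (by decide)
  have : Ring.KrullDimLE 1 (X.presheaf.stalk x) := krullDimLE_of_coheight_le hx.le
  have h4 : IsDedekindDomain (X.presheaf.stalk x) :=
    { toIsDomain := inferInstance
      toIsDedekindRing :=
        { toIsNoetherian := inferInstance
          toDimensionLEOne := ⟨fun {P} h0 hP =>
            Ring.krullDimLE_one_iff_of_isPrime_bot.mp this P h0 hP⟩
          toIsIntegralClosure := inferInstance } }
  exact ((IsDiscreteValuationRing.TFAE (X.presheaf.stalk x) hnf).out 0 2).mpr h4

/-! ### Orders of vanishing -/

lemma ord_one {X : Scheme.{u}} [IsIntegral X] [IsLocallyNoetherian X] (x : X) :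
    Scheme.ord (1 : X.functionField) x = 0 := by
  have := Scheme.ord_mul (x := x) (one_ne_zero (α := X.functionField)) one_ne_zero
  rw [mul_one] at this
  linarith

lemma ord_pow [IsLocallyNoetherian X] (x : X) {f : X.functionField} (hf : f ≠ 0) (n : ℕ) :
    Scheme.ord (f ^ n) x = n * Scheme.ord f x := by
  induction n with
  | zero => simp [ord_one]
  | succ n ih =>
    rw [pow_succ, Scheme.ord_mul (pow_ne_zero n hf) hf, ih]
    push_cast
    ring

lemma ord_inv [IsLocallyNoetherian X] (x : X) {f : X.functionField} (hf : f ≠ 0) :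
    Scheme.ord f⁻¹ x = - Scheme.ord f x := by
  have := Scheme.ord_mul (x := x) hf (inv_ne_zero hf)
  rw [mul_inv_cancel₀ hf, ord_one] at this
  linarith

lemma ord_div [IsLocallyNoetherian X] (x : X) {f g : X.functionField} (hf : f ≠ 0) (hg : g ≠ 0) :
    Scheme.ord (f / g) x = Scheme.ord f x - Scheme.ord g x := by
  rw [div_eq_mul_inv, Scheme.ord_mul hf (inv_ne_zero hg), ord_inv x hg, sub_eq_add_neg]

lemma ord_zpow [IsLocallyNoetherian X] (x : X) {f : X.functionField} (hf : f ≠ 0) (n : ℤ) :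
    Scheme.ord (f ^ n) x = n * Scheme.ord f x := by
  obtain ⟨n, rfl | rfl⟩ := n.eq_nat_or_neg
  · rw [zpow_natCast, ord_pow x hf]
  · rw [zpow_neg, zpow_natCast, ord_inv x (pow_ne_zero n hf), ord_pow x hf]
    ring

lemma ord_algebraMap [IsLocallyNoetherian X] {x : X} (hx : Order.coheight x = 1)
    {a : X.presheaf.stalk x} (ha : a ≠ 0) {n : ℕ} (h : Ring.ord (X.presheaf.stalk x) a = n) :
    Scheme.ord (algebraMap _ X.functionField a) x = n := by
  have ha' : algebraMap _ X.functionField a ≠ 0 := by simpa using ha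
  rw [Scheme.ord_eq_iff hx ha']
  have : Ring.KrullDimLE 1 (X.presheaf.stalk x) := krullDimLE_of_coheight_le hx.le
  change Ring.ordFrac (X.presheaf.stalk x) (algebraMap _ X.functionField a) = _
  rw [Ring.ordFrac_eq_ord _ ha]
  exact Ring.ordMonoidWithZeroHom_eq_coe _ (mem_nonZeroDivisors_of_ne_zero ha) h

lemma ord_algebraMap_irreducible [IsLocallyNoetherian X] {x : X} (hx : Order.coheight x = 1)
    [IsDiscreteValuationRing (X.presheaf.stalk x)]
    {t : X.presheaf.stalk x} (ht : Irreducible t) :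
    Scheme.ord (algebraMap _ X.functionField t) x = 1 :=
  ord_algebraMap hx ht.ne_zero (n := 1) (by rw [Ring.ord_of_irreducible ht]; rfl)

lemma ord_algebraMap_isUnit [IsLocallyNoetherian X] {x : X} (hx : Order.coheight x = 1)
    {a : X.presheaf.stalk x} (ha : IsUnit a) :
    Scheme.ord (algebraMap _ X.functionField a) x = 0 :=
  ord_algebraMap hx ha.ne_zero (n := 0) (by rw [Ring.ord_of_isUnit ha]; rfl)

/-- Rational functions are products of units and powers of the uniformizer. -/
lemma exists_eq_unit_mul_zpow [IsLocallyNoetherian X] (hX : IsNormal X) {x : X}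
    (hx : Order.coheight x = 1) {t : X.presheaf.stalk x} (ht : Irreducible t)
    {f : X.functionField} (hf : f ≠ 0) : ∃ u : (X.presheaf.stalk x)ˣ,
      f = algebraMap _ X.functionField (u : X.presheaf.stalk x) *
        algebraMap _ X.functionField t ^ Scheme.ord f x := by
  have := isDiscreteValuationRing_stalk hX hx
  have ht0 : algebraMap _ X.functionField t ≠ 0 := by simpa using ht.ne_zero
  suffices ∃ (u : (X.presheaf.stalk x)ˣ) (n : ℤ),
      f = algebraMap _ X.functionField (u : X.presheaf.stalk x) *
        algebraMap _ X.functionField t ^ n by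
    obtain ⟨u, n, rfl⟩ := this
    refine ⟨u, ?_⟩
    have hu0 : algebraMap _ X.functionField (u : X.presheaf.stalk x) ≠ 0 := by simp
    rw [Scheme.ord_mul hu0 (zpow_ne_zero n ht0), ord_zpow x ht0, ord_algebraMap_irreducible hx ht,
      ord_algebraMap_isUnit hx u.isUnit, zero_add, mul_one]
  obtain ⟨a, b, hb, rfl⟩ := IsFractionRing.div_surjective (A := X.presheaf.stalk x) f
  have ha0 : a ≠ 0 := by
    rintro rfl
    simp at hf
  obtain ⟨n, u, rfl⟩ := IsDiscreteValuationRing.eq_unit_mul_pow_irreducible ha0 ht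
  obtain ⟨m, v, rfl⟩ := IsDiscreteValuationRing.eq_unit_mul_pow_irreducible
    (nonZeroDivisors.ne_zero hb) ht
  refine ⟨u * v⁻¹, n - m, ?_⟩
  have hv0 : algebraMap _ X.functionField (v : X.presheaf.stalk x) ≠ 0 := by simp
  have hv : algebraMap _ X.functionField ((v⁻¹ : (X.presheaf.stalk x)ˣ) : X.presheaf.stalk x) =
      (algebraMap _ X.functionField (v : X.presheaf.stalk x))⁻¹ := by
    apply eq_inv_of_mul_eq_one_left
    rw [← map_mul, Units.inv_mul, map_one]
  rw [map_mul, map_mul, map_pow, map_pow, zpow_sub₀ ht0, zpow_natCast, zpow_natCast, Units.val_mul,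
    map_mul, hv]
  field_simp

lemma mem_stalkSubring_iff_ord [IsLocallyNoetherian X] (hX : IsNormal X) {x : X}
    (hx : Order.coheight x = 1) {f : X.functionField} (hf : f ≠ 0) :
    f ∈ stalkSubring x ↔ 0 ≤ Scheme.ord f x := by
  have := isDiscreteValuationRing_stalk hX hx
  constructor
  · rintro ⟨a, rfl⟩
    have ha : a ≠ 0 := by
      rintro rfl
      simp at hf
    obtain ⟨n, hn⟩ := ENat.ne_top_iff_exists.mp
      (Ring.ord_ne_top (mem_nonZeroDivisors_of_ne_zero ha))
    rw [ord_algebraMap hx ha hn.symm]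
    positivity
  · intro h
    obtain ⟨t, ht⟩ := IsDiscreteValuationRing.exists_irreducible (X.presheaf.stalk x)
    obtain ⟨u, hu⟩ := exists_eq_unit_mul_zpow hX hx ht hf
    obtain ⟨n, hn⟩ := Int.eq_ofNat_of_zero_le h
    rw [hn, zpow_natCast, ← map_pow, ← map_mul] at hu
    exact ⟨_, hu.symm⟩

lemma ord_eq_of_div_mem [IsLocallyNoetherian X] (hX : IsNormal X) {x : X}
    (hx : Order.coheight x = 1) {f g : X.functionField} (hf : f ≠ 0) (hg : g ≠ 0)
    (hfg : f / g ∈ stalkSubring x) (hgf : g / f ∈ stalkSubring x) :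
    Scheme.ord f x = Scheme.ord g x := by
  rw [mem_stalkSubring_iff_ord hX hx (div_ne_zero hf hg), ord_div x hf hg] at hfg
  rw [mem_stalkSubring_iff_ord hX hx (div_ne_zero hg hf), ord_div x hg hf] at hgf
  linarith

lemma HasOrder.ord_eq [IsLocallyNoetherian X] (hX : IsNormal X) {x : X}
    (hx : Order.coheight x = 1) {K : Type*} [Field K] {T : X.functionField →+ K} {𝒜 : Subring K}
    {ℬ : Subring X.functionField} (hℬ : ℬ ≤ stalkSubring x) {f g : X.functionField}
    (h : HasOrder T 𝒜 ℬ f) (h' : HasOrder T 𝒜 ℬ g) (hf : f ≠ 0) (hg : g ≠ 0) :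
    Scheme.ord f x = Scheme.ord g x :=
  ord_eq_of_div_mem hX hx hf hg (hℬ (h.div_mem h' hg)) (hℬ (h'.div_mem h hf))

lemma finite_ord_ne_zero [IsNoetherian X] (hX : IsNormal X) {f : X.functionField} (hf : f ≠ 0) :
    {x : X | Order.coheight x = 1 ∧ Scheme.ord f x ≠ 0}.Finite := by
  obtain ⟨U, hU, h⟩ := exists_open_forall_mem {f, f⁻¹} (by simp)
  refine (finite_coheight_one_notMem hU).subset ?_
  rintro x ⟨hx, hne⟩
  refine ⟨hx, fun hxU => hne ?_⟩
  have h1 := (mem_stalkSubring_iff_ord hX hx hf).mp (h x hxU (by simp))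
  have h2 := (mem_stalkSubring_iff_ord hX hx (inv_ne_zero hf)).mp (h x hxU (by simp))
  rw [ord_inv x hf] at h2
  linarith

/-! ### `F`-finiteness -/

lemma exists_pow_ringHom {A : Type*} [CommRing A] {p : ℕ} {F : A →+* A} (hF : ∀ a, F a = a ^ p)
    (hfin : F.Finite) (e : ℕ) : ∃ G : A →+* A, (∀ a, G a = a ^ p ^ e) ∧ G.Finite := by
  induction e with
  | zero => exact ⟨RingHom.id A, by simp, RingHom.Finite.id A⟩
  | succ e ih =>
    obtain ⟨G, hG, hGf⟩ := ih
    exact ⟨F.comp G, fun a => by rw [RingHom.comp_apply, hF, hG, ← pow_mul, pow_succ], hfin.comp hGf⟩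

lemma IsFFinite.isPowFinite {p : ℕ} (hF : IsFFinite p X) {U : X.Opens} (hU : IsAffineOpen U)
    (e : ℕ) : IsPowFinite (p ^ e) Γ(X, U) := by
  obtain ⟨F, hF, hfin⟩ := hF.finite U hU
  obtain ⟨G, hG, hGf⟩ := exists_pow_ringHom hF hfin e
  exact IsPowFinite.of_finite hG hGf

/-- The generators over U serve at all of its points: for z = a / s the denominator becomes a q-th
power, z = s^{-q} (s^{q-1} a), and s^{q-1} a is expanded. -/
lemma exists_isSpanning_pow {q : ℕ} (hq : q ≠ 0) {Fr : X.functionField →+* X.functionField}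
    (hFr : ∀ a, Fr a = a ^ q) {U : X.Opens} (hU : IsAffineOpen U) (hpow : IsPowFinite q Γ(X, U)) :
    ∃ (n : ℕ) (g : Fin n → X.functionField), ∀ x ∈ U,
      IsSpanning Fr (stalkSubring x) (stalkSubring x) g := by
  by_cases hgen : genericPoint X ∈ U
  · obtain ⟨n, g, hg⟩ := hpow
    refine ⟨n, fun i => sectionToField U hgen (g i), fun x hx z => ⟨fun hz => ?_, ?_⟩⟩
    · obtain ⟨s, a, hs, hsa⟩ := exists_mul_eq_of_isAffineOpen hU hx hz
      have hinv := inv_mem_of_isUnit_germ hx hs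
      have hs0 : sectionToField U hgen s ≠ 0 := by
        rw [← algebraMap_germ hx]
        simpa using hs.ne_zero
      obtain ⟨c, hc⟩ := hg (s ^ (q - 1) * a)
      refine ⟨fun i => (sectionToField U hgen s)⁻¹ * sectionToField U hgen (c i), fun i =>
        Subring.mul_mem _ hinv (sectionToField_mem hgen _ hx), ?_⟩
      have h1 := congrArg (sectionToField U hgen) hc
      rw [map_mul, map_pow, ← hsa, ← mul_assoc, ← pow_succ, Nat.sub_add_cancel
        (Nat.one_le_iff_ne_zero.mpr hq), map_sum] at h1
      rw [← inv_mul_cancel_left₀ (pow_ne_zero q hs0) z, h1, Finset.mul_sum]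
      refine Finset.sum_congr rfl fun i _ => ?_
      rw [hFr, mul_pow, map_mul, map_pow, inv_pow, mul_assoc]
    · rintro ⟨c, hc, rfl⟩
      refine Subring.sum_mem _ fun i _ => Subring.mul_mem _ ?_ (sectionToField_mem hgen _ hx)
      rw [hFr]
      exact Subring.pow_mem _ (hc i) q
  · exact ⟨0, Fin.elim0, fun x hx => absurd (genericPoint_mem hx) hgen⟩

lemma isPowFinite_stalk {q : ℕ} (hq : q ≠ 0) {Fr : X.functionField →+* X.functionField}
    (hFr : ∀ a, Fr a = a ^ q) {U : X.Opens} (hU : IsAffineOpen U) (hpow : IsPowFinite q Γ(X, U))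
    {x : X} (hx : x ∈ U) : IsPowFinite q (X.presheaf.stalk x) := by
  obtain ⟨n, g, hg⟩ := exists_isSpanning_pow hq hFr hU hpow
  choose g' hg' using fun i => (hg x hx).mem i
  refine ⟨n, g', fun z => ?_⟩
  obtain ⟨c, hc, hz⟩ := ((hg x hx) (algebraMap _ _ z)).mp ⟨z, rfl⟩
  choose c' hc' using hc
  refine ⟨c', IsFractionRing.injective _ X.functionField ?_⟩
  rw [hz, map_sum]
  simp only [map_mul, map_pow, hc', hg', hFr]

lemma exists_isAffineOpen_mem (x : X) : ∃ U : X.Opens, IsAffineOpen U ∧ x ∈ U := by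
  obtain ⟨_, ⟨V, hV, rfl⟩, hxV, -⟩ := X.isBasis_affineOpens.exists_subset_of_mem_open
    (Set.mem_univ x) isOpen_univ
  exact ⟨V, hV, hxV⟩

lemma finite_of_isSpanning {K M : Type*} [Field K] [Field M] {σ : K →+* M} {n : ℕ} {g : Fin n → M}
    (h : ∀ z, ∃ c : Fin n → K, z = ∑ i, σ (c i) * g i) : σ.Finite := by
  classical
  let := σ.toAlgebra
  change Module.Finite K M
  refine ⟨⟨Finset.univ.image g, eq_top_iff.mpr fun z _ => ?_⟩⟩
  obtain ⟨c, rfl⟩ := h z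
  refine Submodule.sum_mem _ fun i _ => ?_
  exact Submodule.smul_mem _ (c i) (Submodule.subset_span (by simp))

end FunctionField

end FrobeniusTranspose

namespace FrobeniusTranspose

/-! ### Finite extensions of discrete valuation rings -/

/-- The ring is a Dedekind domain whose maximal ideals all lie over that of A, so there are finitely
many; a semilocal Dedekind domain is principal. -/
lemma isPrincipalIdealRing_of_finite {A B : Type*} [CommRing A] [IsDomain A]
    [IsDiscreteValuationRing A] [CommRing B] [IsDomain B] [Algebra A B] [FaithfulSMul A B]
    [Module.Finite A B] [IsIntegrallyClosed B] : IsPrincipalIdealRing B := by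
  have : IsNoetherianRing B := IsNoetherianRing.of_finite A B
  have hdim : Ring.DimensionLEOne B := ⟨fun {P} h0 hP => by
    have h1 := Ideal.IsIntegral.comap_ne_bot A h0
    exact Ideal.isMaximal_of_isIntegral_of_isMaximal_comap (R := A) P
      (Ideal.IsPrime.isMaximal inferInstance h1)⟩
  have hD : IsDedekindDomain B :=
    { toIsDomain := inferInstance
      toIsDedekindRing :=
        { toIsNoetherian := inferInstance
          toDimensionLEOne := hdim
          toIsIntegralClosure := inferInstance } }
  refine IsPrincipalIdealRing.of_finite_maximals
    ((IsDedekindDomain.primesOver_finite (IsLocalRing.maximalIdeal A) B).subset ?_)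
  intro P hP
  have hP' : P.IsMaximal := hP
  have h1 : (P.comap (algebraMap A B)).IsMaximal :=
    Ideal.isMaximal_comap_of_isIntegral_of_isMaximal P
  exact ⟨hP'.isPrime, ⟨(IsLocalRing.eq_maximalIdeal h1).symm⟩⟩

section Affine

set_option linter.unusedSectionVars false

variable {X : Scheme.{u}} [IsIntegral X]

lemma exists_pow_mul_eq {W : X.Opens} (hW : IsAffineOpen W) (f : Γ(X, W)) (hW' : genericPoint X ∈ W)
    (hf : genericPoint X ∈ X.basicOpen f) {z : X.functionField}
    (hz : ∀ y ∈ X.basicOpen f, z ∈ stalkSubring y) :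
    ∃ (n : ℕ) (a : Γ(X, W)), sectionToField W hW' f ^ n * z = sectionToField W hW' a := by
  obtain ⟨s, rfl⟩ := exists_section_of_forall_mem hf hz
  have := hW.isLocalization_basicOpen f
  obtain ⟨n, a, h⟩ := IsLocalization.Away.surj f s
  refine ⟨n, a, ?_⟩
  have h1 : ∀ b : Γ(X, W), sectionToField (X.basicOpen f) hf (algebraMap _ _ b) =
      sectionToField W hW' b := fun b => sectionToField_map (homOfLE (X.basicOpen_le f)) hf b
  have h2 := congrArg (sectionToField (X.basicOpen f) hf) h
  rw [map_mul, map_pow, h1, h1] at h2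
  rw [mul_comm]
  exact h2

lemma isUnit_germ_of_mem_basicOpen {W : X.Opens} {f : Γ(X, W)} {x : X} (hx : x ∈ W)
    (h : x ∈ X.basicOpen f) : IsUnit (X.presheaf.germ W x hx f) :=
  (X.mem_basicOpen f x hx).mp h

end Affine

/-! ### Finite surjective morphisms -/

section Morphism

set_option linter.unusedSectionVars false

variable {X Y : Scheme.{u}} [IsIntegral X] [IsIntegral Y] (π : Y ⟶ X) [Surjective π]

lemma functionFieldMap_section {U : X.Opens} (h : genericPoint X ∈ U) (s : Γ(X, U)) :
    functionFieldMap π (sectionToField U h s) =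
      sectionToField (π ⁻¹ᵁ U) (genericPoint_mem_preimage π h) (π.app U s) := by
  have h1 := X.presheaf.germ_stalkSpecializes_apply (U := U)
    h (specializes_of_eq (map_genericPoint π)) s
  have h2 := π.germ_stalkMap_apply U (genericPoint Y) (genericPoint_mem_preimage π h) s
  exact (congrArg (π.stalkMap (genericPoint Y)) h1).trans h2

lemma functionFieldMap_algebraMap (y : Y) (a : X.presheaf.stalk (π y)) :
    functionFieldMap π (algebraMap _ _ a) =
      algebraMap (Y.presheaf.stalk y) _ ((π.stalkMap y).hom a) := by
  obtain ⟨U, hx, s, rfl⟩ := X.presheaf.exists_germ_eq a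
  rw [algebraMap_germ, functionFieldMap_section]
  have h2 := π.germ_stalkMap_apply U y hx s
  refine Eq.trans ?_ (congrArg (algebraMap _ _) h2).symm
  rw [algebraMap_germ (show y ∈ π ⁻¹ᵁ U from hx)]

lemma mem_pushforwardStalk_iff {x : X} {z : Y.functionField} :
    z ∈ pushforwardStalk π x ↔ ∃ U : X.Opens, x ∈ U ∧ ∀ y ∈ π ⁻¹ᵁ U, z ∈ stalkSubring y := by
  constructor
  · rintro ⟨U, hx, h, s, rfl⟩
    exact ⟨U, hx, fun y hy => sectionToField_mem h s hy⟩
  · rintro ⟨U, hx, h⟩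
    have hgen := genericPoint_mem_preimage π (genericPoint_mem hx)
    obtain ⟨s, hs⟩ := exists_section_of_forall_mem hgen h
    exact ⟨U, hx, hgen, s, hs⟩

/-- The stalk of `π_* 𝒪_Y`, as a subring of the function field. -/
def pushforwardSubring (x : X) : Subring Y.functionField where
  carrier := pushforwardStalk π x
  mul_mem' := by
    intro a b ha hb
    obtain ⟨U, hx, h⟩ := (mem_pushforwardStalk_iff π).mp ha
    obtain ⟨V, hx', h'⟩ := (mem_pushforwardStalk_iff π).mp hb
    exact (mem_pushforwardStalk_iff π).mpr ⟨U ⊓ V, ⟨hx, hx'⟩, fun y hy =>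
      Subring.mul_mem _ (h y hy.1) (h' y hy.2)⟩
  add_mem' := by
    intro a b ha hb
    obtain ⟨U, hx, h⟩ := (mem_pushforwardStalk_iff π).mp ha
    obtain ⟨V, hx', h'⟩ := (mem_pushforwardStalk_iff π).mp hb
    exact (mem_pushforwardStalk_iff π).mpr ⟨U ⊓ V, ⟨hx, hx'⟩, fun y hy =>
      Subring.add_mem _ (h y hy.1) (h' y hy.2)⟩
  one_mem' := (mem_pushforwardStalk_iff π).mpr ⟨⊤, trivial, fun _ _ => Subring.one_mem _⟩
  zero_mem' := (mem_pushforwardStalk_iff π).mpr ⟨⊤, trivial, fun _ _ => Subring.zero_mem _⟩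
  neg_mem' := by
    intro a ha
    obtain ⟨U, hx, h⟩ := (mem_pushforwardStalk_iff π).mp ha
    exact (mem_pushforwardStalk_iff π).mpr ⟨U, hx, fun y hy => Subring.neg_mem _ (h y hy)⟩

lemma mem_pushforwardSubring_iff {x : X} {z : Y.functionField} :
    z ∈ pushforwardSubring π x ↔ ∃ U : X.Opens, x ∈ U ∧ ∀ y ∈ π ⁻¹ᵁ U, z ∈ stalkSubring y :=
  mem_pushforwardStalk_iff π

lemma pushforwardSubring_le (y : Y) : pushforwardSubring π (π y) ≤ stalkSubring y := by
  intro z hz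
  obtain ⟨U, hx, h⟩ := (mem_pushforwardSubring_iff π).mp hz
  exact h y hx

lemma section_mem_pushforwardSubring {U : X.Opens} {x : X} (hx : x ∈ U)
    (h : genericPoint Y ∈ π ⁻¹ᵁ U) (s : Γ(Y, π ⁻¹ᵁ U)) :
    sectionToField (π ⁻¹ᵁ U) h s ∈ pushforwardSubring π x :=
  ⟨U, hx, h, s, rfl⟩

lemma functionFieldMap_mem_pushforwardSubring {x : X} {a : X.functionField}
    (ha : a ∈ stalkSubring x) : functionFieldMap π a ∈ pushforwardSubring π x := by
  obtain ⟨U, hx, s, rfl⟩ := mem_stalkSubring_iff.mp ha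
  rw [functionFieldMap_section]
  exact section_mem_pushforwardSubring π hx _ _

/-- The finitely many coefficients of an integral equation are regular over the preimage of one
neighbourhood of x, where normality of the stalks of Y applies. -/
lemma isIntegrallyClosed_pushforwardSubring (hY : IsNormal Y) {x : X} {z : Y.functionField}
    (hz : IsIntegral (pushforwardSubring π x) z) : z ∈ pushforwardSubring π x := by
  obtain ⟨f, hf, hfz⟩ := hz
  have hU : ∃ U : X.Opens, x ∈ U ∧ ∀ y ∈ π ⁻¹ᵁ U, ∀ i ∈ f.support,
      (f.coeff i : Y.functionField) ∈ stalkSubring y := by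
    induction f.support using Finset.induction_on with
    | empty => exact ⟨⊤, trivial, by simp⟩
    | insert i s _ ih =>
      obtain ⟨U, hx, h⟩ := ih
      obtain ⟨V, hx', h'⟩ := (mem_pushforwardSubring_iff π).mp (f.coeff i).2
      refine ⟨U ⊓ V, ⟨hx, hx'⟩, fun y hy j hj => ?_⟩
      rcases Finset.mem_insert.mp hj with rfl | hj
      · exact h' y hy.2
      · exact h y hy.1 j hj
  obtain ⟨U, hx, hU⟩ := hU
  refine (mem_pushforwardSubring_iff π).mpr ⟨U, hx, fun y hy => ?_⟩
  have := (hY y).2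
  refine (IsIntegrallyClosed.isIntegral_iff (R := Y.presheaf.stalk y) (K := Y.functionField)).mp ?_
  have hlift : f.map (algebraMap (pushforwardSubring π x) Y.functionField) ∈
      Polynomial.lifts (algebraMap (Y.presheaf.stalk y) Y.functionField) := by
    rw [Polynomial.lifts_iff_coeff_lifts]
    intro i
    rw [Polynomial.coeff_map]
    by_cases hi : i ∈ f.support
    · exact hU y hy i hi
    · rw [Polynomial.notMem_support_iff.mp hi, map_zero]
      exact ⟨0, map_zero _⟩
  obtain ⟨g, hg, -, hgm⟩ := Polynomial.lifts_and_natDegree_eq_and_monic hlift (hf.map _)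
  refine ⟨g, hgm, ?_⟩
  rw [Polynomial.eval₂_eq_eval_map, hg, ← Polynomial.eval₂_eq_eval_map]
  exact hfz

variable [IsFinite π]

/-- Over an affine open set, the stalks of `π_* 𝒪_Y` are generated by common sections. -/
lemma exists_isSpanning {U : X.Opens} (hU : IsAffineOpen U) (hgen : genericPoint X ∈ U) :
    ∃ (n : ℕ) (g : Fin n → Γ(Y, π ⁻¹ᵁ U)), ∀ x ∈ U,
      IsSpanning (functionFieldMap π) (stalkSubring x) (pushforwardSubring π x)
        fun i => sectionToField (π ⁻¹ᵁ U) (genericPoint_mem_preimage π hgen) (g i) := by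
  obtain ⟨n, g, hg⟩ := exists_finset_of_finite (π.finite_app U hU)
  refine ⟨n, g, fun x hx z => ⟨fun hz => ?_, ?_⟩⟩
  · obtain ⟨V, hxV, hV⟩ := (mem_pushforwardSubring_iff π).mp hz
    -- On a basic open set inside V the function z becomes a section over the preimage of U after
    -- multiplication by a power of f, which is invertible at x.
    obtain ⟨f, hfV, hxf⟩ := hU.exists_basicOpen_le ⟨x, hxV⟩ hx
    have hpre : π ⁻¹ᵁ X.basicOpen f = Y.basicOpen (π.app U f) := Scheme.preimage_basicOpen π f
    obtain ⟨m, a, ha⟩ := exists_pow_mul_eq (hU.preimage π) (π.app U f)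
      (genericPoint_mem_preimage π hgen) (by
        rw [← hpre]; exact genericPoint_mem_preimage π (genericPoint_mem hxf)) (z := z) (by
        intro y hy
        rw [← hpre] at hy
        exact hV y (hfV hy))
    rw [← functionFieldMap_section π hgen, ← map_pow] at ha
    have hunit := isUnit_germ_of_mem_basicOpen hx hxf
    have hinv := inv_mem_of_isUnit_germ hx hunit
    have hf0 : sectionToField U hgen f ^ m ≠ 0 := by
      refine pow_ne_zero m ?_
      rw [← algebraMap_germ hx]
      simpa using hunit.ne_zero
    obtain ⟨c, hc⟩ := hg a
    refine ⟨fun i => (sectionToField U hgen f)⁻¹ ^ m * sectionToField U hgen (c i), fun i =>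
      Subring.mul_mem _ (Subring.pow_mem _ hinv m) (sectionToField_mem hgen _ hx), ?_⟩
    have hf0' : functionFieldMap π (sectionToField U hgen f ^ m) ≠ 0 := (map_ne_zero _).mpr hf0
    rw [← inv_mul_cancel_left₀ hf0' z, ha, hc, map_sum, Finset.mul_sum]
    refine Finset.sum_congr rfl fun i _ => ?_
    rw [map_mul, map_mul, functionFieldMap_section, ← map_inv₀, inv_pow, mul_assoc]
  · rintro ⟨c, hc, rfl⟩
    exact Subring.sum_mem _ fun i _ => Subring.mul_mem _
      (functionFieldMap_mem_pushforwardSubring π (hc i)) (section_mem_pushforwardSubring π hx _ _)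

/-- Denominators can be taken from X: by integrality each nonzero section over the preimage divides
a nonzero section over U. -/
lemma exists_functionFieldMap_mul_eq {U : X.Opens} (hU : IsAffineOpen U)
    (hgen : genericPoint X ∈ U) (z : Y.functionField) : ∃ (c : Γ(X, U)) (a : Γ(Y, π ⁻¹ᵁ U)),
      sectionToField U hgen c ≠ 0 ∧ functionFieldMap π (sectionToField U hgen c) * z =
        sectionToField (π ⁻¹ᵁ U) (genericPoint_mem_preimage π hgen) a := by
  have hgenY := genericPoint_mem_preimage π hgen
  let := (sectionToField (π ⁻¹ᵁ U) hgenY).toAlgebra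
  have := isFractionRing_of_isAffineOpen (hU.preimage π) hgenY
  have := isDomain_of_mem hgenY
  have := isDomain_of_mem hgen
  obtain ⟨a, b, hb, rfl⟩ := IsFractionRing.div_surjective (A := Γ(Y, π ⁻¹ᵁ U)) z
  have hb0 : sectionToField (π ⁻¹ᵁ U) hgenY b ≠ 0 := by
    rw [Ne, map_eq_zero_iff _ (sectionToField_injective hgenY)]
    exact nonZeroDivisors.ne_zero hb
  let := (π.app U).hom.toAlgebra
  have : Algebra.IsIntegral Γ(X, U) Γ(Y, π ⁻¹ᵁ U) := ⟨(π.finite_app U hU).to_isIntegral⟩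
  obtain ⟨c, hc0, d, hcd⟩ := (Algebra.IsIntegral.isIntegral (R := Γ(X, U)) b).isAlgebraic.exists_nonzero_dvd hb
  refine ⟨c, d * a, ?_, ?_⟩
  · rwa [Ne, map_eq_zero_iff _ (sectionToField_injective hgen)]
  · have hcd' : (π.app U).hom c = b * d := hcd
    rw [functionFieldMap_section]
    change sectionToField (π ⁻¹ᵁ U) hgenY ((π.app U).hom c) *
      (sectionToField (π ⁻¹ᵁ U) hgenY a / sectionToField (π ⁻¹ᵁ U) hgenY b) = _
    rw [hcd', map_mul, map_mul]
    field_simp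

lemma pushforwardSubring_genericPoint : pushforwardSubring π (genericPoint X) = ⊤ := by
  rw [eq_top_iff]
  intro z _
  obtain ⟨U, hU, hgen⟩ := exists_isAffineOpen_mem (genericPoint X)
  obtain ⟨c, a, hc0, hca⟩ := exists_functionFieldMap_mul_eq π hU hgen z
  have h1 : (sectionToField U hgen c)⁻¹ ∈ stalkSubring (genericPoint X) := by
    rw [stalkSubring_genericPoint]; trivial
  have h0 : functionFieldMap π (sectionToField U hgen c) ≠ 0 := (map_ne_zero _).mpr hc0
  rw [← inv_mul_cancel_left₀ h0 z, hca, ← map_inv₀]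
  exact Subring.mul_mem _ (functionFieldMap_mem_pushforwardSubring π h1)
    (section_mem_pushforwardSubring π hgen _ _)

lemma exists_functionField_spanning {U : X.Opens}
    (hgen : genericPoint X ∈ U) {n : ℕ} {g : Fin n → Y.functionField} (hg : ∀ x ∈ U,
      IsSpanning (functionFieldMap π) (stalkSubring x) (pushforwardSubring π x) g)
    (z : Y.functionField) :
    ∃ c : Fin n → X.functionField, z = ∑ i, functionFieldMap π (c i) * g i := by
  obtain ⟨c, -, hc⟩ := (hg _ hgen z).mp (by rw [pushforwardSubring_genericPoint]; trivial)
  exact ⟨c, hc⟩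

lemma functionFieldMap_finite : (functionFieldMap π).Finite := by
  obtain ⟨U, hU, hgen⟩ := exists_isAffineOpen_mem (genericPoint X)
  obtain ⟨n, g, hg⟩ := exists_isSpanning π hU hgen
  exact finite_of_isSpanning (exists_functionField_spanning π hgen hg)

lemma exists_mul_mem_stalkSubring (x : X) (a : X.functionField) :
    ∃ s ∈ stalkSubring x, s ≠ 0 ∧ s * a ∈ stalkSubring x := by
  obtain ⟨b, c, hc, rfl⟩ := IsFractionRing.div_surjective (A := X.presheaf.stalk x) a
  have hc0 : algebraMap _ X.functionField c ≠ 0 := by simpa using nonZeroDivisors.ne_zero hc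
  exact ⟨_, ⟨c, rfl⟩, hc0, b, by field_simp⟩

lemma exists_mul_mem_pushforwardSubring (x : X) (z : Y.functionField) :
    ∃ s ∈ stalkSubring x, s ≠ 0 ∧ functionFieldMap π s * z ∈ pushforwardSubring π x := by
  obtain ⟨U, hU, hx⟩ := exists_isAffineOpen_mem x
  obtain ⟨c, a, hc0, hca⟩ := exists_functionFieldMap_mul_eq π hU (genericPoint_mem hx) z
  refine ⟨_, sectionToField_mem _ c hx, hc0, ?_⟩
  rw [hca]
  exact section_mem_pushforwardSubring π hx _ _

/-- A finite integrally closed extension of a discrete valuation ring. Principality yields a single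
order s of T that serves at all points over x. -/
lemma isPrincipalIdealRing_pushforwardSubring [IsLocallyNoetherian X] (hX : IsNormal X)
    (hY : IsNormal Y) {x : X} (hx : Order.coheight x = 1) :
    IsPrincipalIdealRing (pushforwardSubring π x) := by
  have := isDiscreteValuationRing_stalk hX hx
  let f : X.presheaf.stalk x →+* pushforwardSubring π x :=
    ((functionFieldMap π).comp (algebraMap (X.presheaf.stalk x) X.functionField)).codRestrict _
      fun a => functionFieldMap_mem_pushforwardSubring π ⟨a, rfl⟩
  let := f.toAlgebra
  have : FaithfulSMul (X.presheaf.stalk x) (pushforwardSubring π x) := by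
    rw [faithfulSMul_iff_algebraMap_injective]
    intro a b hab
    exact IsFractionRing.injective _ X.functionField
      ((functionFieldMap π).injective (congrArg Subtype.val hab))
  have : Module.Finite (X.presheaf.stalk x) (pushforwardSubring π x) := by
    classical
    obtain ⟨U, hU, hxU⟩ := exists_isAffineOpen_mem x
    obtain ⟨n, g, hg⟩ := exists_isSpanning π hU (genericPoint_mem hxU)
    refine ⟨⟨Finset.univ.image fun i => ⟨_, (hg x hxU).mem i⟩, eq_top_iff.mpr fun z _ => ?_⟩⟩
    obtain ⟨c, hc, hz⟩ := (hg x hxU z.1).mp z.2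
    choose c' hc' using hc
    have : z = ∑ i, c' i • (⟨_, (hg x hxU).mem i⟩ : pushforwardSubring π x) := by
      ext
      rw [hz]
      simp only [AddSubmonoidClass.coe_finsetSum]
      refine Finset.sum_congr rfl fun i _ => ?_
      rw [← hc']
      rfl
    rw [this]
    exact Submodule.sum_mem _ fun i _ => Submodule.smul_mem _ _ (Submodule.subset_span (by simp))
  have : IsFractionRing (pushforwardSubring π x) Y.functionField := by
    refine IsFractionRing.of_field _ _ fun z => ?_
    obtain ⟨s, hs, hs0, hsz⟩ := exists_mul_mem_pushforwardSubring π x z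
    refine ⟨⟨_, hsz⟩, ⟨_, functionFieldMap_mem_pushforwardSubring π hs⟩, ?_⟩
    have : functionFieldMap π s ≠ 0 := (map_ne_zero _).mpr hs0
    change z = functionFieldMap π s * z / functionFieldMap π s
    field_simp
  have : IsIntegrallyClosed (pushforwardSubring π x) := by
    rw [isIntegrallyClosed_iff Y.functionField]
    intro z hz
    exact ⟨⟨z, isIntegrallyClosed_pushforwardSubring π hY hz⟩, rfl⟩
  exact isPrincipalIdealRing_of_finite (A := X.presheaf.stalk x)

/-- The image of a point of codimension one has codimension one. -/
lemma coheight_apply_eq_one [IsLocallyNoetherian X] [IsLocallyNoetherian Y] (hX : IsNormal X) {y : Y}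
    (hy : Order.coheight y = 1) : Order.coheight (π y) = 1 := by
  obtain ⟨U, hU, hx⟩ := exists_isAffineOpen_mem (π y)
  have hgen := genericPoint_mem hx
  have hgenY := genericPoint_mem_preimage π hgen
  have hV := hU.preimage π
  have := isDomain_of_mem hgenY
  have := isDomain_of_mem hgen
  let := (π.app U).hom.toAlgebra
  have : Algebra.IsIntegral Γ(X, U) Γ(Y, π ⁻¹ᵁ U) := ⟨(π.finite_app U hU).to_isIntegral⟩
  have : IsIntegrallyClosed Γ(X, U) := isIntegrallyClosed_of_isAffineOpen hX hU hgen
  have : IsNoetherianRing Γ(Y, π ⁻¹ᵁ U) := IsLocallyNoetherian.component_noetherian ⟨_, hV⟩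
  have : IsNoetherianRing Γ(X, U) := IsLocallyNoetherian.component_noetherian ⟨_, hU⟩
  have : FaithfulSMul Γ(X, U) Γ(Y, π ⁻¹ᵁ U) := by
    rw [faithfulSMul_iff_algebraMap_injective]
    intro a b hab
    have h1 : π.app U a = π.app U b := hab
    apply sectionToField_injective hgen
    apply (functionFieldMap π).injective
    rw [functionFieldMap_section, functionFieldMap_section, h1]
  have hcomap := IsAffineOpen.comap_primeIdealOf_appLE (f := π) U hU (π ⁻¹ᵁ U) hV le_rfl
    (x := y) hx
  let P := (hV.primeIdealOf ⟨y, hx⟩).asIdeal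
  let p := (hU.primeIdealOf ⟨π y, hx⟩).asIdeal
  have hpP : p = P.comap (algebraMap Γ(X, U) Γ(Y, π ⁻¹ᵁ U)) := by
    have := congrArg PrimeSpectrum.asIdeal hcomap
    rw [← Scheme.Hom.app_eq_appLE] at this
    exact this.symm
  have : P.LiesOver p := ⟨hpP⟩
  have hP : P.height = 1 := (height_primeIdealOf hV hx).trans hy
  have hle : p.height ≤ 1 := by
    -- Going down for an integral extension of an integrally closed domain bounds the height of the
    -- contraction by that of P.
    rw [← hP, Ideal.height_eq_height_add_of_liesOver_of_hasGoingDown p P]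
    exact le_self_add
  have hne : p.height ≠ 0 := by
    rw [Ne, Ideal.height_eq_zero_iff_eq_bot, hpP]
    exact Ideal.IsIntegral.comap_ne_bot _ (Ideal.ne_bot_of_height_eq_one hP)
  rw [← height_primeIdealOf hU hx]
  exact le_antisymm hle (Order.one_le_iff_ne_zero.mpr hne)

lemma ramificationIndex_eq [IsLocallyNoetherian X] [IsLocallyNoetherian Y] (hX : IsNormal X)
    (y : PrimeDivisor Y) {f : X.functionField} (hf : f ≠ 0) :
    Scheme.ord (functionFieldMap π f) y.1 = Scheme.ord f (π y.1) * ramificationIndex π y := by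
  have hx := coheight_apply_eq_one π hX y.2
  have := isDiscreteValuationRing_stalk hX hx
  have hex := IsDiscreteValuationRing.exists_irreducible (X.presheaf.stalk (π y.1))
  rw [ramificationIndex, dif_pos hex, ← functionFieldMap_algebraMap]
  set t := hex.choose
  have ht : Irreducible t := hex.choose_spec
  obtain ⟨u, hu⟩ := exists_eq_unit_mul_zpow hX hx ht hf
  have ht0 : functionFieldMap π (algebraMap _ X.functionField t) ≠ 0 :=
    (map_ne_zero _).mpr (by simpa using ht.ne_zero)
  have hu0 : functionFieldMap π
      (algebraMap _ X.functionField (u : X.presheaf.stalk (π y.1))) ≠ 0 :=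
    (map_ne_zero _).mpr (by simp)
  conv_lhs => rw [hu, map_mul, map_zpow₀, Scheme.ord_mul hu0 (zpow_ne_zero _ ht0), ord_zpow _ ht0]
  rw [functionFieldMap_algebraMap, ord_algebraMap_isUnit y.2 (u.isUnit.map (π.stalkMap y.1).hom),
    zero_add]

/-- The elements of `(π_* 𝒪_Y)_x` that are invertible at `y`. -/
def localizationSubmonoid (y : Y) : Submonoid Y.functionField where
  carrier := {s | s ≠ 0 ∧ s ∈ pushforwardSubring π (π y) ∧ s⁻¹ ∈ stalkSubring y}
  one_mem' := ⟨one_ne_zero, Subring.one_mem _, by rw [inv_one]; exact Subring.one_mem _⟩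
  mul_mem' := by
    rintro a b ⟨ha0, ha, ha'⟩ ⟨hb0, hb, hb'⟩
    exact ⟨mul_ne_zero ha0 hb0, Subring.mul_mem _ ha hb, by
      rw [mul_inv]; exact Subring.mul_mem _ ha' hb'⟩

lemma isSubringLocalization (y : Y) : IsSubringLocalization (localizationSubmonoid π y)
    (pushforwardSubring π (π y)) (stalkSubring y) where
  le := pushforwardSubring_le π y
  mem := fun _ hs => hs.2.1
  ne_zero := fun _ hs => hs.1
  inv_mem := fun _ hs => hs.2.2
  exists_mul_mem := by
    intro a ha
    obtain ⟨U, hU, hx⟩ := exists_isAffineOpen_mem (π y)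
    have hy : y ∈ π ⁻¹ᵁ U := hx
    obtain ⟨s, b, hs, hsb⟩ := exists_mul_eq_of_isAffineOpen (hU.preimage π) hy ha
    refine ⟨_, ⟨?_, section_mem_pushforwardSubring π hx _ s, inv_mem_of_isUnit_germ hy hs⟩, ?_⟩
    · rw [← algebraMap_germ hy]
      simpa using hs.ne_zero
    · rw [hsb]
      exact section_mem_pushforwardSubring π hx _ _

/-- Inverting q-th powers gives the same localization, because s^q a = s^(q-1) (s a). -/
lemma isSubringLocalization_pow (y : Y) {q : ℕ} (hq : q ≠ 0)
    {Fr : Y.functionField →+* Y.functionField} (hFr : ∀ a, Fr a = a ^ q) :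
    IsSubringLocalization ((localizationSubmonoid π y).map Fr)
      (pushforwardSubring π (π y)) (stalkSubring y) where
  le := pushforwardSubring_le π y
  mem := by
    rintro _ ⟨s, hs, rfl⟩
    rw [hFr]
    exact Subring.pow_mem _ hs.2.1 q
  ne_zero := by
    rintro _ ⟨s, hs, rfl⟩
    exact (map_ne_zero Fr).mpr hs.1
  inv_mem := by
    rintro _ ⟨s, hs, rfl⟩
    rw [hFr, ← inv_pow]
    exact Subring.pow_mem _ hs.2.2 q
  exists_mul_mem := by
    intro a ha
    obtain ⟨s, hs, hsa⟩ := (isSubringLocalization π y).exists_mul_mem a ha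
    refine ⟨_, ⟨s, hs, rfl⟩, ?_⟩
    rw [hFr, ← Nat.sub_add_cancel (Nat.one_le_iff_ne_zero.mpr hq), pow_succ, mul_assoc]
    exact Subring.mul_mem _ (Subring.pow_mem _ hs.2.1 _) hsa

/-- As for a single scheme, except that the denominator, made a q-th power, is a product of sections
of X that are units at x. -/
lemma exists_isSpanning_pow_pushforward {q : ℕ} (hq : q ≠ 0)
    {Fr : Y.functionField →+* Y.functionField} (hFr : ∀ a, Fr a = a ^ q) {U : X.Opens}
    (hU : IsAffineOpen U) (hpow : IsPowFinite q Γ(Y, π ⁻¹ᵁ U)) {x : X} (hx : x ∈ U) :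
    ∃ (n : ℕ) (g : Fin n → Y.functionField),
      IsSpanning Fr (pushforwardSubring π x) (pushforwardSubring π x) g := by
  have hgen := genericPoint_mem hx
  have hgenY := genericPoint_mem_preimage π hgen
  obtain ⟨n, g, hg⟩ := hpow
  refine ⟨n, fun i => sectionToField _ hgenY (g i), fun z => ⟨fun hz => ?_, ?_⟩⟩
  · obtain ⟨m, h, hspan⟩ := exists_isSpanning π hU hgen
    obtain ⟨c, hc, rfl⟩ := (hspan x hx z).mp hz
    choose s a hs hsa using fun i => exists_mul_eq_of_isAffineOpen hU hx (hc i)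
    have hs0 : ∀ i, sectionToField U hgen (s i) ≠ 0 := fun i => by
      rw [← algebraMap_germ hx]
      simpa using (hs i).ne_zero
    let S := ∏ i, s i
    have hS0 : functionFieldMap π (sectionToField U hgen S) ≠ 0 := by
      rw [map_ne_zero, map_prod]
      exact Finset.prod_ne_zero_iff.mpr fun i _ => hs0 i
    have hSinv : (sectionToField U hgen S)⁻¹ ∈ stalkSubring x := by
      rw [map_prod, ← Finset.prod_inv_distrib]
      exact Subring.prod_mem _ fun i _ => inv_mem_of_isUnit_germ hx (hs i)
    have hmem : ∀ i, ∃ b : Γ(X, U), sectionToField U hgen S * c i = sectionToField U hgen b := by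
      intro i
      refine ⟨(∏ j ∈ Finset.univ.erase i, s j) * a i, ?_⟩
      rw [map_mul, ← hsa i, ← mul_assoc, ← map_mul, Finset.prod_erase_mul _ _ (Finset.mem_univ i)]
    choose b hb using hmem
    let w : Γ(Y, π ⁻¹ᵁ U) := ∑ i, π.app U (b i) * h i
    obtain ⟨d, hd⟩ := hg (π.app U S ^ (q - 1) * w)
    refine ⟨fun i => functionFieldMap π (sectionToField U hgen S)⁻¹ * sectionToField _ hgenY (d i),
      fun i => Subring.mul_mem _ (functionFieldMap_mem_pushforwardSubring π hSinv)
        (section_mem_pushforwardSubring π hx _ _), ?_⟩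
    have hw : sectionToField _ hgenY w = functionFieldMap π (sectionToField U hgen S) *
        ∑ i, functionFieldMap π (c i) * sectionToField _ hgenY (h i) := by
      rw [map_sum, Finset.mul_sum]
      refine Finset.sum_congr rfl fun i _ => ?_
      rw [map_mul, ← functionFieldMap_section π hgen, ← hb, (functionFieldMap π).map_mul, mul_assoc]
    have h1 := congrArg (sectionToField _ hgenY) hd
    rw [map_mul, map_pow, hw, ← functionFieldMap_section π hgen, ← mul_assoc, ← pow_succ,
      Nat.sub_add_cancel (Nat.one_le_iff_ne_zero.mpr hq), map_sum] at h1
    rw [← inv_mul_cancel_left₀ (pow_ne_zero q hS0)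
      (∑ i, functionFieldMap π (c i) * sectionToField _ hgenY (h i)), h1, Finset.mul_sum]
    refine Finset.sum_congr rfl fun i _ => ?_
    rw [hFr, mul_pow, map_mul, map_pow, map_inv₀, inv_pow, mul_assoc]
  · rintro ⟨c, hc, rfl⟩
    refine Subring.sum_mem _ fun i _ => Subring.mul_mem _ ?_ (section_mem_pushforwardSubring π hx _ _)
    rw [hFr]
    exact Subring.pow_mem _ (hc i) q

end Morphism

end FrobeniusTranspose

namespace FrobeniusTranspose

/-! ### Extension of `p^{-e}`-linear maps to the fraction field -/

section Extension

variable {R K : Type*} [CommRing R] [IsDomain R] [Field K] [Algebra R K] [IsFractionRing R K]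
  {q : ℕ}

lemma exists_mul_pow_eq (hq : q ≠ 0) (z : K) :
    ∃ a b : R, b ≠ 0 ∧ algebraMap R K b ^ q * z = algebraMap R K a := by
  obtain ⟨a, b, hb, rfl⟩ := IsFractionRing.div_surjective (A := R) z
  have hb0 : algebraMap R K b ≠ 0 := by simpa using nonZeroDivisors.ne_zero hb
  refine ⟨b ^ (q - 1) * a, b, nonZeroDivisors.ne_zero hb, ?_⟩
  obtain ⟨q, rfl⟩ := Nat.exists_eq_succ_of_ne_zero hq
  simp only [Nat.succ_eq_add_one, add_tsub_cancel_right, map_mul, map_pow, pow_succ]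
  field_simp

/-- The value at z is ψ(a) / b whenever b^q z = a; `key` is the independence of this choice. -/
lemma exists_rootLinear_extension (hq : q ≠ 0) {ψ : R →+ R} (hψ : IsRootLinear q ψ) :
    ∃ Ψ : K →+ K, (∀ r z, Ψ (r ^ q * z) = r * Ψ z) ∧
      ∀ a, Ψ (algebraMap R K a) = algebraMap R K (ψ a) := by
  choose a b hb hab using exists_mul_pow_eq (R := R) (K := K) hq
  have hinj := IsFractionRing.injective R K
  have key : ∀ (z : K) (c d : R), d ≠ 0 → algebraMap R K d ^ q * z = algebraMap R K c →
      algebraMap R K (ψ (a z)) / algebraMap R K (b z) =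
        algebraMap R K (ψ c) / algebraMap R K d := by
    intro z c d hd hcd
    have hd0 : algebraMap R K d ≠ 0 := by simpa using hd
    have hb0 : algebraMap R K (b z) ≠ 0 := by simpa using hb z
    rw [div_eq_div_iff hb0 hd0, ← map_mul, ← map_mul]
    have h1 : d ^ q • a z = b z ^ q • c := by
      apply hinj
      rw [smul_eq_mul, smul_eq_mul, map_mul, map_mul, map_pow, map_pow, ← hcd, ← hab z]
      ring
    have h2 := congrArg ψ h1
    rw [hψ, hψ] at h2
    rw [mul_comm, h2, mul_comm]
  refine ⟨⟨⟨fun z => algebraMap R K (ψ (a z)) / algebraMap R K (b z), ?_⟩, ?_⟩, ?_, ?_⟩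
  · rw [key 0 0 1 one_ne_zero (by simp)]
    simp
  · intro z w
    have hz0 : algebraMap R K (b z) ≠ 0 := by simpa using hb z
    have hw0 : algebraMap R K (b w) ≠ 0 := by simpa using hb w
    dsimp only
    rw [key (z + w) (b w ^ q • a z + b z ^ q • a w) (b z * b w) (mul_ne_zero (hb z) (hb w)) (by
      rw [smul_eq_mul, smul_eq_mul, map_add, map_mul, map_mul, map_mul, map_pow, map_pow, ← hab z,
        ← hab w]
      ring), map_add, hψ, hψ, map_add, map_mul, map_mul, map_mul]
    field_simp
  · intro r z
    obtain ⟨c, d, hd, rfl⟩ := IsFractionRing.div_surjective (A := R) r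
    have hd' := nonZeroDivisors.ne_zero hd
    have hd0 : algebraMap R K d ≠ 0 := by simpa using hd'
    have hz0 : algebraMap R K (b z) ≠ 0 := by simpa using hb z
    change algebraMap R K (ψ (a _)) / algebraMap R K (b _) =
      _ * (algebraMap R K (ψ (a z)) / algebraMap R K (b z))
    rw [key _ (c ^ q • a z) (d * b z) (mul_ne_zero hd' (hb z)) (by
      rw [smul_eq_mul, map_mul, map_mul, map_pow, ← hab z, div_pow, mul_pow]
      field_simp), hψ, map_mul, map_mul]
    field_simp
  · intro c
    change algebraMap R K (ψ (a _)) / algebraMap R K (b _) = _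
    rw [key _ c 1 one_ne_zero (by simp)]
    simp

lemma rootLinear_ext (hq : q ≠ 0) {Ψ Ψ' : K →+ K} (h : ∀ r z, Ψ (r ^ q * z) = r * Ψ z)
    (h' : ∀ r z, Ψ' (r ^ q * z) = r * Ψ' z)
    (heq : ∀ a : R, Ψ (algebraMap R K a) = Ψ' (algebraMap R K a)) : Ψ = Ψ' := by
  ext z
  obtain ⟨a, b, hb, hab⟩ := exists_mul_pow_eq (R := R) hq z
  have hb0 : algebraMap R K b ≠ 0 := by simpa using hb
  have := heq a
  rw [← hab, h, h'] at this
  exact mul_left_cancel₀ hb0 this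

end Extension

/-! ### `p^{-e}`-linear maps at the generic point -/

section Generic

variable {X : Scheme.{u}} [IsIntegral X] {q : ℕ} {L : X.Modules}

/-- The map `z ↦ φ (z m)` on the function field, where `m` is a rational section. -/
def RootLinearMap.along (φ : RootLinearMap q L) (m : L.presheaf.stalk (genericPoint X)) :
    X.functionField →+ X.functionField :=
  (φ.stalkMap (genericPoint X)).comp
    ((AddMonoidHom.flip (smulAddHom (X.presheaf.stalk (genericPoint X)) _)) m)

lemma RootLinearMap.along_apply (φ : RootLinearMap q L) (m : L.presheaf.stalk (genericPoint X))
    (z : X.presheaf.stalk (genericPoint X)) :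
    φ.along m z = φ.stalkMap (genericPoint X) (z • m) := rfl

lemma RootLinearMap.along_smul (φ : RootLinearMap q L) (m : L.presheaf.stalk (genericPoint X))
    (c : X.presheaf.stalk (genericPoint X)) (z : X.functionField) :
    φ.along (c • m) z = φ.along m (c * z) := by
  rw [along_apply, along_apply, smul_smul, mul_comm]

lemma RootLinearMap.stalkMap_pow_smul {X : Scheme.{u}} {L : X.Modules} (φ : RootLinearMap q L)
    (x : X) (r : X.presheaf.stalk x) (m : L.presheaf.stalk x) :
    φ.stalkMap x (r ^ q • m) = r * φ.stalkMap x m := by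
  obtain ⟨U, hU, r, rfl⟩ := X.presheaf.exists_germ_eq r
  obtain ⟨V, hV, m, rfl⟩ := L.presheaf.exists_germ_eq m
  have hx : x ∈ U ⊓ V := ⟨hU, hV⟩
  rw [← X.presheaf.germ_res_apply (homOfLE inf_le_left : U ⊓ V ⟶ U) x hx,
    ← L.presheaf.germ_res_apply (homOfLE inf_le_right : U ⊓ V ⟶ V) x hx, ← map_pow,
    ← germ_smul_stalkModule, φ.stalkMap_germ, φ.isRootLinear, map_mul, φ.stalkMap_germ]

lemma RootLinearMap.along_pow_mul (φ : RootLinearMap q L)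
    (m : L.presheaf.stalk (genericPoint X)) (r z : X.functionField) :
    φ.along m (r ^ q * z) = r * φ.along m z := by
  rw [along_apply, along_apply, mul_smul, φ.stalkMap_pow_smul]

lemma RootLinearMap.sectionToField_app_smul (φ : RootLinearMap q L) {U : X.Opens}
    (h : genericPoint X ∈ U) (a : Γ(X, U)) (l : Γ(L, U)) :
    sectionToField U h (φ.app U (a • l)) =
      φ.along (L.presheaf.germ U _ h l) (sectionToField U h a) := by
  rw [along_apply]
  have h1 := germ_smul_stalkModule L _ U h a l
  have h2 := φ.stalkMap_germ _ U h (a • l)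
  rw [h1] at h2
  exact h2.symm

lemma RootLinearMap.algebraMap_stalkMap_smul (φ : RootLinearMap q L) {U : X.Opens} {x : X}
    (hx : x ∈ U) (a : X.presheaf.stalk x) (l : Γ(L, U)) :
    algebraMap _ X.functionField (φ.stalkMap x (a • L.presheaf.germ U x hx l)) =
      φ.along (L.presheaf.germ U _ (genericPoint_mem hx) l) (algebraMap _ _ a) := by
  obtain ⟨V, hV, a, rfl⟩ := X.presheaf.exists_germ_eq a
  have hx' : x ∈ U ⊓ V := ⟨hx, hV⟩
  rw [← X.presheaf.germ_res_apply (homOfLE inf_le_right : U ⊓ V ⟶ V) x hx',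
    ← L.presheaf.germ_res_apply (homOfLE inf_le_left : U ⊓ V ⟶ U) x hx',
    ← L.presheaf.germ_res_apply (homOfLE inf_le_left : U ⊓ V ⟶ U) _ (genericPoint_mem hx'),
    ← germ_smul_stalkModule, φ.stalkMap_germ, algebraMap_germ, algebraMap_germ,
    φ.sectionToField_app_smul]

lemma subsingleton_of_genericPoint_notMem {U : X.Opens} (h : genericPoint X ∉ U) :
    Subsingleton Γ(X, U) := by
  have : U = ⊥ := by
    by_contra hne
    obtain ⟨x, hx⟩ := (Opens.ne_bot_iff_nonempty U).mp hne
    exact h (genericPoint_mem hx)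
  subst this
  infer_instance

lemma RootLinearMap.along_ne_zero {φ : RootLinearMap q L} (hφ : φ ≠ 0)
    {m : L.presheaf.stalk (genericPoint X)}
    (hm : Function.Surjective fun a : X.presheaf.stalk (genericPoint X) => a • m) :
    φ.along m ≠ 0 := by
  intro h0
  apply hφ
  ext U l : 3
  by_cases h : genericPoint X ∈ U
  · apply sectionToField_injective h
    obtain ⟨a, ha⟩ := hm (L.presheaf.germ U _ h l)
    have h1 := φ.stalkMap_germ _ U h l
    rw [← ha] at h1
    refine h1.symm.trans ?_
    change φ.along m a = sectionToField U h 0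
    rw [h0, map_zero]
    rfl
  · have := subsingleton_of_genericPoint_notMem h
    exact Subsingleton.elim _ _

/-- The germ at the generic point of a local generator. -/
lemma IsGeneratingSection.germ_eq_smul {U V : X.Opens} {l : Γ(L, U)} (h : IsGeneratingSection L U l)
    {x : X} (hx : x ∈ U) (hx' : x ∈ V) (m : Γ(L, V)) :
    ∃ c : X.presheaf.stalk x, L.presheaf.germ V x hx' m = c • L.presheaf.germ U x hx l ∧
      L.presheaf.germ V _ (genericPoint_mem hx') m =
        (algebraMap _ X.functionField c : X.presheaf.stalk (genericPoint X)) •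
          L.presheaf.germ U _ (genericPoint_mem hx) l := by
  have hxW : x ∈ U ⊓ V := ⟨hx, hx'⟩
  obtain ⟨c, hc⟩ := (h (U ⊓ V) (homOfLE inf_le_left)).2
    (L.presheaf.map (homOfLE inf_le_right : U ⊓ V ⟶ V).op m)
  have key : ∀ (y : X) (hy : y ∈ U ⊓ V), L.presheaf.germ V y hy.2 m =
      X.presheaf.germ (U ⊓ V) y hy c • L.presheaf.germ U y hy.1 l := by
    intro y hy
    rw [← L.presheaf.germ_res_apply (homOfLE inf_le_right : U ⊓ V ⟶ V) y hy,
      ← L.presheaf.germ_res_apply (homOfLE inf_le_left : U ⊓ V ⟶ U) y hy,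
      ← germ_smul_stalkModule]
    exact congrArg _ hc.symm
  refine ⟨X.presheaf.germ (U ⊓ V) x hxW c, key x hxW, ?_⟩
  rw [algebraMap_germ]
  exact key _ (genericPoint_mem hxW)

lemma IsGeneratingSection.germ_eq_unit_smul {U V : X.Opens} {l : Γ(L, U)}
    (h : IsGeneratingSection L U l) {m : Γ(L, V)} (h' : IsGeneratingSection L V m)
    {x : X} (hx : x ∈ U) (hx' : x ∈ V) :
    ∃ c : X.presheaf.stalk x, IsUnit c ∧
      L.presheaf.germ V _ (genericPoint_mem hx') m =
        (algebraMap _ X.functionField c : X.presheaf.stalk (genericPoint X)) •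
          L.presheaf.germ U _ (genericPoint_mem hx) l := by
  obtain ⟨c, hc, hc'⟩ := h.germ_eq_smul hx hx' m
  obtain ⟨d, hd, -⟩ := h'.germ_eq_smul hx' hx l
  refine ⟨c, IsUnit.of_mul_eq_one d ?_, hc'⟩
  apply (h.stalk x hx).1
  dsimp only
  rw [one_smul, mul_comm, mul_smul, ← hc, ← hd]

/-- A `p^{-e}`-linear map on the generic stalk that is integral in codimension one comes from a
map of sheaves. -/
theorem exists_rootLinearMap [IsLocallyNoetherian X] (hX : IsNormal X)
    (ξ : L.presheaf.stalk (genericPoint X) →+ X.functionField)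
    (hξ : ∀ (r : X.presheaf.stalk (genericPoint X)) m, ξ (r ^ q • m) = r * ξ m)
    (h : ∀ (V : X.Opens) (m : Γ(L, V)) (x : X) (hx : x ∈ V), Order.coheight x = 1 →
      ξ (L.presheaf.germ V _ (genericPoint_mem hx) m) ∈ stalkSubring x) :
    ∃ φ : RootLinearMap q L, φ.stalkMap (genericPoint X) = ξ := by
  classical
  choose s hs using fun (V : X.Opens) (hV : genericPoint X ∈ V) (m : Γ(L, V)) =>
    exists_section_of_forall_coheight_one hX hV (z := ξ (L.presheaf.germ V _ hV m))
      fun x hx h1 => h V m x hx h1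
  let t : ∀ V : X.Opens, Γ(L, V) → Γ(X, V) := fun V m =>
    if hV : genericPoint X ∈ V then s V hV m else 0
  have ht : ∀ V (hV : genericPoint X ∈ V) m,
      sectionToField V hV (t V m) = ξ (L.presheaf.germ V _ hV m) := by
    intro V hV m
    simp only [t, dif_pos hV, hs]
  have hext : ∀ (V : X.Opens) (a b : Γ(X, V)),
      (∀ hV : genericPoint X ∈ V, sectionToField V hV a = sectionToField V hV b) → a = b := by
    intro V a b hab
    by_cases hV : genericPoint X ∈ V
    · exact sectionToField_injective hV (hab hV)
    · have := subsingleton_of_genericPoint_notMem hV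
      exact Subsingleton.elim _ _
  let φ : RootLinearMap q L :=
    { app := fun V => AddMonoidHom.mk' (t V) fun m m' => hext V _ _ fun hV => by
        rw [map_add, ht, ht, ht, map_add, map_add]
      naturality := fun {U V} i m => hext U _ _ fun hU => by
        change sectionToField U hU (t U _) = sectionToField U hU (X.presheaf.map i.op (t V m))
        rw [ht, sectionToField_map, ht, L.presheaf.germ_res_apply]
      isRootLinear := fun V r m => hext V _ _ fun hV => by
        change sectionToField V hV (t V _) = sectionToField V hV (r * t V m)
        rw [ht, germ_smul_stalkModule, map_pow, hξ, map_mul, ht]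
        rfl }
  refine ⟨φ, ?_⟩
  ext m
  obtain ⟨V, hV, m, rfl⟩ := L.presheaf.exists_germ_eq m
  rw [φ.stalkMap_germ]
  exact ht V hV m

end Generic

end FrobeniusTranspose

namespace FrobeniusTranspose

/-! ### Generators of the module of `p^{-e}`-linear maps -/

section Generator

set_option linter.unusedSectionVars false

variable {R K : Type*} [CommRing R] [IsDomain R] [Field K] [Algebra R K] [IsFractionRing R K]
  {q : ℕ}

lemma exists_restrict {Ψ : K →+ K} (h : ∀ a : R, Ψ (algebraMap R K a) ∈ (algebraMap R K).range) :
    ∃ ψ : R →+ R, ∀ a, algebraMap R K (ψ a) = Ψ (algebraMap R K a) := by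
  choose ψ hψ using h
  refine ⟨AddMonoidHom.mk' ψ fun a b => IsFractionRing.injective R K ?_, hψ⟩
  rw [map_add, hψ, hψ, hψ, map_add, map_add]

lemma isRootLinear_of_algebraMap {Ψ : K →+ K} (hΨ : ∀ r z, Ψ (r ^ q * z) = r * Ψ z) {ψ : R →+ R}
    (hψ : ∀ a, algebraMap R K (ψ a) = Ψ (algebraMap R K a)) : IsRootLinear q ψ := by
  intro r a
  apply IsFractionRing.injective R K
  rw [hψ, smul_eq_mul, map_mul, map_pow, hΨ, map_mul, hψ]

/-- Every ψ extends to the fraction field, where it is Φ(g · ) by duality, and integrality of ψ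
forces g into R. -/
lemma isRootGenerator_of_hasOrder (hq : q ≠ 0) {Fr : K →+* K} (hFr : ∀ a, Fr a = a ^ q)
    (hfin : Fr.Finite) {Φ : K →+ K} (hΦ : ∀ r z, Φ (r ^ q * z) = r * Φ z) (hΦ0 : Φ ≠ 0)
    (h : HasOrder Φ (algebraMap R K).range (algebraMap R K).range 1) {φ : R →+ R}
    (hφ : ∀ a, algebraMap R K (φ a) = Φ (algebraMap R K a)) : IsRootGenerator q φ := by
  refine ⟨isRootLinear_of_algebraMap hΦ hφ, fun ψ hψ => ?_⟩
  obtain ⟨Ψ, hΨ, hΨψ⟩ := exists_rootLinear_extension (K := K) hq hψ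
  obtain ⟨g, hg⟩ := IsSemilinear.exists_eq hfin (σ := Fr) (T := Φ) (Ψ := Ψ)
    (fun c z => by rw [hFr, hΦ]) hΦ0 (fun c z => by rw [hFr, hΨ])
  have hmem : (1 : K) * g ∈ (algebraMap R K).range := (h g).mp <| by
    rintro _ ⟨b, rfl⟩
    rw [← hg, hΨψ]
    exact ⟨_, rfl⟩
  rw [one_mul] at hmem
  obtain ⟨g, rfl⟩ := hmem
  refine ⟨g, fun a => IsFractionRing.injective R K ?_⟩
  rw [← hΨψ, hg, hφ, (algebraMap R K).map_mul]

/-- Conversely a generator has a unit as its order: Φ(f⁻¹ · ) is integral, hence equal to Φ(g · )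
with g in R, and g = f⁻¹ by nondegeneracy. -/
lemma IsRootGenerator.mem_and_inv_mem (hq : q ≠ 0) {Φ : K →+ K}
    (hΦ : ∀ r z, Φ (r ^ q * z) = r * Φ z) (hΦ0 : Φ ≠ 0) {φ : R →+ R} (h : IsRootGenerator q φ)
    (hφ : ∀ a, algebraMap R K (φ a) = Φ (algebraMap R K a)) {f : K} (hf : f ≠ 0)
    (hord : HasOrder Φ (algebraMap R K).range (algebraMap R K).range f) :
    f ∈ (algebraMap R K).range ∧ f⁻¹ ∈ (algebraMap R K).range := by
  constructor
  · rw [← mul_one f]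
    refine (hord 1).mp ?_
    rintro _ ⟨b, rfl⟩
    rw [one_mul, ← hφ]
    exact ⟨_, rfl⟩
  · have h1 := (hord f⁻¹).mpr (by rw [mul_inv_cancel₀ hf]; exact Subring.one_mem _)
    let Ψ := Φ.comp (AddMonoidHom.mulLeft f⁻¹)
    have hΨ : ∀ r z, Ψ (r ^ q * z) = r * Ψ z := fun r z => by
      change Φ (f⁻¹ * (r ^ q * z)) = r * Φ (f⁻¹ * z)
      rw [mul_left_comm, hΦ]
    obtain ⟨ψ, hψ⟩ := exists_restrict (R := R) (Ψ := Ψ) fun a => h1 _ ⟨a, rfl⟩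
    obtain ⟨g, hg⟩ := h.2 ψ (isRootLinear_of_algebraMap hΨ hψ)
    have h2 : Ψ = Φ.comp (AddMonoidHom.mulLeft (algebraMap R K g)) := by
      refine rootLinear_ext (R := R) hq hΨ (fun r z => ?_) fun a => ?_
      · change Φ (_ * (r ^ q * z)) = r * Φ (_ * z)
        rw [mul_left_comm, hΦ]
      · rw [← hψ, hg, hφ, map_mul]
        rfl
    refine ⟨g, (eq_of_forall hΦ0 fun z => ?_)⟩
    exact (DFunLike.congr_fun h2 z).symm

end Generator

/-! ### The divisor of a `p^{-e}`-linear map -/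

section RootDivisor

variable {X : Scheme.{u}} [IsIntegral X]

lemma IsFFinite.exists_pow {p : ℕ} (hp : p.Prime) (hF : IsFFinite p X) (e : ℕ) :
    ∃ Fr : X.functionField →+* X.functionField, (∀ a, Fr a = a ^ p ^ e) ∧ Fr.Finite ∧
      ∀ U : X.Opens, IsAffineOpen U → ∃ (n : ℕ) (g : Fin n → X.functionField), ∀ x ∈ U,
        IsSpanning Fr (stalkSubring x) (stalkSubring x) g := by
  have := hF.charP
  have : ExpChar X.functionField p := ExpChar.prime hp
  have hFr : ∀ a, iterateFrobenius X.functionField p e a = a ^ p ^ e := fun a =>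
    iterateFrobenius_def p e a
  have key : ∀ U : X.Opens, IsAffineOpen U → ∃ (n : ℕ) (g : Fin n → X.functionField), ∀ x ∈ U,
      IsSpanning (iterateFrobenius X.functionField p e) (stalkSubring x) (stalkSubring x) g :=
    fun U hU => exists_isSpanning_pow (pow_ne_zero e hp.ne_zero) hFr hU (hF.isPowFinite hU e)
  refine ⟨iterateFrobenius X.functionField p e, hFr, ?_, key⟩
  obtain ⟨U, hU, hgen⟩ := exists_isAffineOpen_mem (genericPoint X)
  obtain ⟨n, g, hg⟩ := key U hU
  refine finite_of_isSpanning (g := g) fun z => ?_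
  obtain ⟨c, -, hc⟩ := (hg _ hgen z).mp (by rw [stalkSubring_genericPoint]; trivial)
  exact ⟨c, hc⟩

/-- The sheaf is locally generated by one free section. -/
def HasLocalGenerators {X : Scheme.{u}} (L : X.Modules) : Prop :=
  ∀ x : X, ∃ (U : X.Opens) (l : Γ(L, U)), x ∈ U ∧ IsGeneratingSection L U l

lemma IsInvertibleSheaf.hasLocalGenerators {X : Scheme.{u}} {L : X.Modules}
    (hL : IsInvertibleSheaf L) : HasLocalGenerators L := by
  intro x
  obtain ⟨U, hx, ⟨i⟩⟩ := hL x
  obtain ⟨l, hl⟩ := exists_isGeneratingSection (M := L) (U := U) i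
  exact ⟨U, l, hx, hl⟩

variable {q : ℕ} {L : X.Modules}

/-- The order `n` of `φ` at `x`, measured against a local generator of `L`. -/
def RootLinearMap.HasOrderAt [IsLocallyNoetherian X] (φ : RootLinearMap q L) (x : X) (n : ℤ) :
    Prop :=
  ∃ (U : X.Opens) (l : Γ(L, U)) (hx : x ∈ U) (f : X.functionField), IsGeneratingSection L U l ∧
    f ≠ 0 ∧ HasOrder (φ.along (L.presheaf.germ U _ (genericPoint_mem hx) l)) (stalkSubring x)
      (stalkSubring x) f ∧ Scheme.ord f x = n

lemma RootLinearMap.along_germ_ne_zero {φ : RootLinearMap q L} (hφ : φ ≠ 0) {U : X.Opens}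
    {l : Γ(L, U)} (hl : IsGeneratingSection L U l) (h : genericPoint X ∈ U) :
    φ.along (L.presheaf.germ U _ h l) ≠ 0 :=
  RootLinearMap.along_ne_zero hφ (hl.stalk _ h).2

variable [IsLocallyNoetherian X]

/-- Two local generators of L differ by a unit of the local ring, which multiplies the order by that
unit. -/
lemma RootLinearMap.HasOrderAt.ord_eq (hX : IsNormal X) {φ : RootLinearMap q L} {x : X}
    (hx : Order.coheight x = 1) {n : ℤ} (h : φ.HasOrderAt x n) {U : X.Opens} {l : Γ(L, U)}
    (hxU : x ∈ U) (hl : IsGeneratingSection L U l) {f : X.functionField} (hf : f ≠ 0)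
    (hord : HasOrder (φ.along (L.presheaf.germ U _ (genericPoint_mem hxU) l)) (stalkSubring x)
      (stalkSubring x) f) : Scheme.ord f x = n := by
  obtain ⟨V, m, hxV, g, hm, hg, hord', rfl⟩ := h
  obtain ⟨c, hc, hcm⟩ := hm.germ_eq_unit_smul hl hxV hxU
  rw [hcm] at hord
  have h1 : φ.along ((algebraMap _ X.functionField c : X.presheaf.stalk (genericPoint X)) •
      L.presheaf.germ V _ (genericPoint_mem hxV) m) =
      (φ.along (L.presheaf.germ V _ (genericPoint_mem hxV) m)).comp
        (AddMonoidHom.mulLeft (algebraMap _ X.functionField c)) := by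
    ext z
    exact φ.along_smul _ _ z
  rw [h1] at hord
  have hc0 : algebraMap _ X.functionField c ≠ 0 := by simpa using hc.ne_zero
  rw [HasOrder.ord_eq hX hx le_rfl hord (hord'.mulLeft _) hf (mul_ne_zero hg hc0),
    Scheme.ord_mul hg hc0, ord_algebraMap_isUnit hx hc, add_zero]

lemma RootLinearMap.HasOrderAt.unique (hX : IsNormal X) {φ : RootLinearMap q L} {x : X}
    (hx : Order.coheight x = 1) {n n' : ℤ} (h : φ.HasOrderAt x n) (h' : φ.HasOrderAt x n') :
    n = n' := by
  obtain ⟨U, l, hxU, f, hl, hf, hord, rfl⟩ := h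
  exact h'.ord_eq hX hx hxU hl hf hord

lemma isPrincipalIdealRing_stalkSubring (hX : IsNormal X) {x : X} (hx : Order.coheight x = 1) :
    IsPrincipalIdealRing (stalkSubring x) := by
  have := isDiscreteValuationRing_stalk hX hx
  exact IsPrincipalIdealRing.of_surjective
    (algebraMap (X.presheaf.stalk x) X.functionField).rangeRestrict
    (RingHom.rangeRestrict_surjective _)

lemma exists_hasOrder_stalkSubring (hX : IsNormal X) {p : ℕ} (hp : p.Prime) (hF : IsFFinite p X)
    {e : ℕ} {Φ : X.functionField →+ X.functionField} (hΦ : ∀ r z, Φ (r ^ p ^ e * z) = r * Φ z)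
    (hΦ0 : Φ ≠ 0) {x : X} (hx : Order.coheight x = 1) :
    ∃ f, f ≠ 0 ∧ HasOrder Φ (stalkSubring x) (stalkSubring x) f := by
  obtain ⟨Fr, hFr, hfin, hspan⟩ := hF.exists_pow hp e
  obtain ⟨U, hU, hxU⟩ := exists_isAffineOpen_mem x
  obtain ⟨n, g, hg⟩ := hspan U hU
  have := isPrincipalIdealRing_stalkSubring hX hx
  refine IsSemilinear.exists_hasOrder hfin (fun c z => by rw [hFr, hΦ]) hΦ0 (hg x hxU)
    (exists_mul_mem_stalkSubring x) fun b => ?_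
  obtain ⟨s, hs, hs0, hsb⟩ := exists_mul_mem_stalkSubring x b
  refine ⟨s, hs, hs0, ?_⟩
  rw [hFr, ← Nat.sub_add_cancel (Nat.one_le_iff_ne_zero.mpr (pow_ne_zero e hp.ne_zero)), pow_succ,
    mul_assoc]
  exact Subring.mul_mem _ (Subring.pow_mem _ hs _) hsb

variable {p : ℕ} {e : ℕ}

lemma RootLinearMap.exists_hasOrderAt (hX : IsNormal X) (hp : p.Prime) (hF : IsFFinite p X)
    (hL : HasLocalGenerators L) {φ : RootLinearMap (p ^ e) L} (hφ : φ ≠ 0) {x : X}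
    (hx : Order.coheight x = 1) : ∃ n, φ.HasOrderAt x n := by
  obtain ⟨U, l, hxU, hl⟩ := hL x
  obtain ⟨f, hf, hord⟩ := exists_hasOrder_stalkSubring hX hp hF (φ.along_pow_mul _)
    (RootLinearMap.along_germ_ne_zero hφ hl (genericPoint_mem hxU)) hx
  exact ⟨_, U, l, hxU, f, hl, hf, hord, rfl⟩

lemma RootLinearMap.finite_not_hasOrderAt_zero [NoetherianSpace X] (hp : p.Prime)
    (hF : IsFFinite p X) (hL : HasLocalGenerators L) {φ : RootLinearMap (p ^ e) L} (hφ : φ ≠ 0) :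
    {x : X | Order.coheight x = 1 ∧ ¬ φ.HasOrderAt x 0}.Finite := by
  obtain ⟨Fr, hFr, hfin, hspan⟩ := hF.exists_pow hp e
  obtain ⟨U, l, hgenU, hl⟩ := hL (genericPoint X)
  obtain ⟨V, hV, hgenV⟩ := exists_isAffineOpen_mem (genericPoint X)
  obtain ⟨n, g, hg⟩ := hspan V hV
  obtain ⟨F, hFfin, hFord⟩ := IsSemilinear.exists_finite_hasOrder_one (σ := Fr)
    (T := φ.along (L.presheaf.germ U _ hgenU l)) (g := g) hfin
    (fun c z => by rw [hFr, φ.along_pow_mul]) (RootLinearMap.along_germ_ne_zero hφ hl hgenU)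
    (fun z => by
      obtain ⟨c, -, hc⟩ := (hg _ hgenV z).mp (by rw [stalkSubring_genericPoint]; trivial)
      exact ⟨c, hc⟩)
  obtain ⟨W, hgenW, hW⟩ := exists_open_forall_mem F hFfin
  have hgen : genericPoint X ∈ U ⊓ V ⊓ W := ⟨⟨hgenU, hgenV⟩, hgenW⟩
  refine (finite_coheight_one_notMem hgen).subset ?_
  rintro x ⟨hx, hord⟩
  refine ⟨hx, fun hxU => hord ⟨U, l, hxU.1.1, 1, hl, one_ne_zero, ?_, ord_one x⟩⟩
  exact hFord _ _ (hW x hxU.2) (hg x hxU.1.2)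

/-- Translation of the definition by stalkwise generators into orders on the function field; from
here on only orders are used. -/
lemma RootLinearMap.hasDivisor_iff (hX : IsNormal X) (hp : p.Prime) (hF : IsFFinite p X)
    (hL : HasLocalGenerators L) {φ : RootLinearMap (p ^ e) L} (hφ : φ ≠ 0) {Δ : QDivisor X} :
    φ.HasDivisor Δ ↔ ∀ (x : PrimeDivisor X) (n : ℤ), φ.HasOrderAt x.1 n →
      Δ x = (n : ℚ) / (((p ^ e : ℕ) : ℚ) - 1) := by
  have hq : p ^ e ≠ 0 := pow_ne_zero e hp.ne_zero
  obtain ⟨Fr, hFr, hfin, hspan⟩ := hF.exists_pow hp e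
  refine forall_congr' fun x => ?_
  obtain ⟨U, l, hxU, hl⟩ := hL x.1
  set Λ := φ.along (L.presheaf.germ U _ (genericPoint_mem hxU) l) with hΛ
  have hΛp : ∀ r z, Λ (r ^ p ^ e * z) = r * Λ z := φ.along_pow_mul _
  have hΛ0 : Λ ≠ 0 := RootLinearMap.along_germ_ne_zero hφ hl _
  obtain ⟨f, hf, hord⟩ := exists_hasOrder_stalkSubring hX hp hF hΛp hΛ0 x.2
  constructor
  · rintro ⟨m, hm, Φ, hΦ, g, hg, hφg, hΔ⟩ n hn
    obtain ⟨Ψ, hΨ, hΨΦ⟩ := exists_rootLinear_extension (K := X.functionField) hq hΦ.1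
    obtain ⟨c, hc⟩ := hm.2 (L.presheaf.germ U x.1 hxU l)
    dsimp only at hc
    have hcu : IsUnit c := by
      obtain ⟨d, hd⟩ := (hl.stalk x.1 hxU).2 m
      refine IsUnit.of_mul_eq_one d (hm.1 ?_)
      dsimp only at hd ⊢
      rw [mul_comm, mul_smul, hc, hd, one_smul]
    have hg0 : algebraMap _ X.functionField g ≠ 0 := by simpa using hg
    have hc0 : algebraMap _ X.functionField c ≠ 0 := by simpa using hcu.ne_zero
    -- As l = c m with c a unit, φ along l is Ψ(g c · ). The order f / (g c) of the generator Ψ is a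
    -- unit, so f and g have the same valuation.
    have h1 : Λ = Ψ.comp (AddMonoidHom.mulLeft
        (algebraMap _ X.functionField g * algebraMap _ X.functionField c)) := by
      refine rootLinear_ext (R := X.presheaf.stalk x.1) hq hΛp (fun r z => ?_) fun a => ?_
      · change Ψ (_ * (r ^ p ^ e * z)) = r * Ψ (_ * z)
        rw [mul_left_comm, hΨ]
      · change _ = Ψ (algebraMap _ _ g * algebraMap _ _ c * algebraMap _ _ a)
        rw [hΛ, ← φ.algebraMap_stalkMap_smul hxU, ← hc, smul_smul, hφg, ← map_mul, ← map_mul,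
          hΨΦ]
        congr 2
        ring
    have hΨ0 : Ψ ≠ 0 := by
      rintro rfl
      exact hΛ0 h1
    rw [h1] at hord
    have hord' := hord.of_mulLeft (mul_ne_zero hg0 hc0)
    have h2 := hΦ.mem_and_inv_mem hq hΨ hΨ0 (fun a => (hΨΦ a).symm)
      (div_ne_zero hf (mul_ne_zero hg0 hc0)) hord'
    rw [inv_div] at h2
    have h3 := ord_eq_of_div_mem hX x.2 hf (mul_ne_zero hg0 hc0) h2.1 h2.2
    rw [Scheme.ord_mul hg0 hc0, ord_algebraMap_isUnit x.2 hcu, add_zero] at h3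
    rw [← h1] at hord
    rw [hΔ, ← h3, hn.ord_eq hX x.2 hxU hl hf hord]
  · intro h
    have hn : φ.HasOrderAt x.1 (Scheme.ord f x.1) := ⟨U, l, hxU, f, hl, hf, hord, rfl⟩
    -- Dividing by the order f produces a map of order 1, that is, a generator.
    let Ψ := Λ.comp (AddMonoidHom.mulLeft f⁻¹)
    have hΨ : ∀ r z, Ψ (r ^ p ^ e * z) = r * Ψ z := fun r z => by
      change Λ (_ * (r ^ p ^ e * z)) = r * Λ (_ * z)
      rw [mul_left_comm, hΛp]
    have hΨ1 : HasOrder Ψ (stalkSubring x.1) (stalkSubring x.1) 1 := by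
      have := hord.mulLeft f⁻¹
      rwa [mul_inv_cancel₀ hf] at this
    have hΛΨ : ∀ z, Λ z = Ψ (f * z) := fun z => by
      change _ = Λ (f⁻¹ * (f * z))
      rw [inv_mul_cancel_left₀ hf]
    have hΨ0 : Ψ ≠ 0 := by
      intro h0
      apply hΛ0
      ext z
      rw [hΛΨ, h0]
      rfl
    obtain ⟨ψ, hψ⟩ := exists_restrict (R := X.presheaf.stalk x.1) (Ψ := Ψ) fun a => by
      have := (hΨ1 1).mpr (by rw [one_mul]; exact Subring.one_mem _) (algebraMap _ _ a) ⟨a, rfl⟩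
      rwa [one_mul] at this
    have hfmem : f ∈ stalkSubring x.1 := by
      rw [← mul_one f]
      refine (hord 1).mp ?_
      rintro _ ⟨b, rfl⟩
      rw [one_mul, hΛ, ← φ.algebraMap_stalkMap_smul hxU]
      exact ⟨_, rfl⟩
    obtain ⟨f', rfl⟩ := hfmem
    refine ⟨_, hl.stalk x.1 hxU, ψ, isRootGenerator_of_hasOrder hq hFr hfin hΨ hΨ0 hΨ1 hψ, f', ?_,
      fun a => ?_, h _ hn⟩
    · rintro rfl
      exact hf (map_zero _)
    · apply IsFractionRing.injective (X.presheaf.stalk x.1) X.functionField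
      rw [φ.algebraMap_stalkMap_smul hxU, ← hΛ, hΛΨ, hψ,
        (algebraMap _ X.functionField).map_mul]

lemma RootLinearMap.hasDivisor_iff_eq (hX : IsNormal X) (hp : p.Prime) (hF : IsFFinite p X)
    (hL : HasLocalGenerators L) {φ : RootLinearMap (p ^ e) L} (hφ : φ ≠ 0) {Δ : QDivisor X}
    (hΔ : ∀ (x : PrimeDivisor X) (n : ℤ), φ.HasOrderAt x.1 n →
      Δ x = (n : ℚ) / (((p ^ e : ℕ) : ℚ) - 1)) (Δ' : QDivisor X) :
    φ.HasDivisor Δ' ↔ Δ' = Δ := by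
  rw [RootLinearMap.hasDivisor_iff hX hp hF hL hφ]
  constructor
  · intro h
    ext x
    obtain ⟨n, hn⟩ := RootLinearMap.exists_hasOrderAt hX hp hF hL hφ x.2
    rw [h x n hn, hΔ x n hn]
  · rintro rfl
    exact hΔ

lemma RootLinearMap.exists_divisor [NoetherianSpace X] (hX : IsNormal X) (hp : p.Prime)
    (hF : IsFFinite p X) (hL : HasLocalGenerators L) {φ : RootLinearMap (p ^ e) L} (hφ : φ ≠ 0) :
    ∃ Δ : QDivisor X, ∀ (x : PrimeDivisor X) (n : ℤ), φ.HasOrderAt x.1 n →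
      Δ x = (n : ℚ) / (((p ^ e : ℕ) : ℚ) - 1) := by
  choose n hn using fun x : PrimeDivisor X =>
    RootLinearMap.exists_hasOrderAt hX hp hF hL hφ x.2
  refine ⟨Finsupp.ofSupportFinite (fun x => (n x : ℚ) / (((p ^ e : ℕ) : ℚ) - 1)) ?_, ?_⟩
  · refine ((RootLinearMap.finite_not_hasOrderAt_zero hp hF hL hφ).preimage
      (f := (Subtype.val : PrimeDivisor X → X)) Subtype.val_injective.injOn).subset ?_
    intro x hx
    refine ⟨x.2, fun h0 => hx ?_⟩
    have := (hn x).unique hX x.2 h0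
    simp [this]
  · intro x k hk
    rw [hk.unique hX x.2 (hn x)]
    rfl

end RootDivisor

end FrobeniusTranspose

namespace FrobeniusTranspose

/-! ### The divisor of a rational map -/

section RationalDivisor

variable {X Y : Scheme.{u}} [IsIntegral X] [IsIntegral Y] {π : Y ⟶ X} [Surjective π]

/-- The underlying additive map. -/
def RationalHom.toAddHom (T : RationalHom π) : Y.functionField →+ X.functionField :=
  letI := functionFieldAlgebra π
  T.toAddMonoidHom

lemma RationalHom.toAddHom_apply (T : RationalHom π) (z : Y.functionField) :
    T.toAddHom z = T z := rfl

lemma RationalHom.map_mul (T : RationalHom π) (c : X.functionField) (z : Y.functionField) :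
    T (functionFieldMap π c * z) = c * T z := by
  let := functionFieldAlgebra π
  exact LinearMap.map_smul T c z

lemma RationalHom.isSemilinear (T : RationalHom π) :
    IsSemilinear (functionFieldMap π) T.toAddHom := T.map_mul

/-- A semilinear additive map, as a linear map. -/
def RationalHom.ofSemilinear {T : Y.functionField →+ X.functionField}
    (hT : IsSemilinear (functionFieldMap π) T) : RationalHom π :=
  letI := functionFieldAlgebra π
  { toFun := T
    map_add' := T.map_add
    map_smul' := hT }

lemma RationalHom.toAddHom_ne_zero {T : RationalHom π} (hT : T ≠ 0) : T.toAddHom ≠ 0 := by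
  let := functionFieldAlgebra π
  intro h
  exact hT (LinearMap.ext fun z => DFunLike.congr_fun h z)

lemma isSemilinear_comp_mulLeft {K M : Type*} [CommRing K] [CommRing M] {σ : K →+* M}
    {T : M →+ K} (hT : IsSemilinear σ T) (g : M) :
    IsSemilinear σ (T.comp (AddMonoidHom.mulLeft g)) := by
  intro c z
  change T (g * (σ c * z)) = c * T (g * z)
  rw [mul_left_comm, hT]

/-- The order `n` of `T` at `y`. -/
def RationalHom.HasOrderAt [IsLocallyNoetherian Y] (T : RationalHom π) (y : Y) (n : ℤ) : Prop :=
  ∃ s : Y.functionField, s ≠ 0 ∧ HasOrder T.toAddHom (stalkSubring (π y))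
    (pushforwardSubring π (π y)) s ∧ Scheme.ord s y = n

lemma RationalHom.HasOrderAt.unique [IsLocallyNoetherian Y] (hY : IsNormal Y) {T : RationalHom π}
    {y : Y} (hy : Order.coheight y = 1) {n n' : ℤ} (h : T.HasOrderAt y n)
    (h' : T.HasOrderAt y n') : n = n' := by
  obtain ⟨s, hs, h, rfl⟩ := h
  obtain ⟨s', hs', h', rfl⟩ := h'
  exact HasOrder.ord_eq hY hy (pushforwardSubring_le π y) h h' hs hs'

variable [IsFinite π]

lemma RationalHom.exists_hasOrder [IsLocallyNoetherian X] (hX : IsNormal X) (hY : IsNormal Y)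
    {T : RationalHom π} (hT : T ≠ 0) {x : X} (hx : Order.coheight x = 1) :
    ∃ s, s ≠ 0 ∧ HasOrder T.toAddHom (stalkSubring x) (pushforwardSubring π x) s := by
  obtain ⟨U, hU, hxU⟩ := exists_isAffineOpen_mem x
  obtain ⟨n, g, hg⟩ := exists_isSpanning π hU (genericPoint_mem hxU)
  have := isPrincipalIdealRing_pushforwardSubring π hX hY hx
  exact IsSemilinear.exists_hasOrder (functionFieldMap_finite π) T.isSemilinear
    (RationalHom.toAddHom_ne_zero hT) (hg x hxU) (exists_mul_mem_stalkSubring x)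
    (exists_mul_mem_pushforwardSubring π x)

lemma RationalHom.exists_hasOrderAt [IsLocallyNoetherian X] [IsLocallyNoetherian Y] (hX : IsNormal X) (hY : IsNormal Y)
    {T : RationalHom π} (hT : T ≠ 0) {y : Y} (hy : Order.coheight y = 1) :
    ∃ n, T.HasOrderAt y n := by
  obtain ⟨s, hs, h⟩ := RationalHom.exists_hasOrder hX hY hT (coheight_apply_eq_one π hX hy)
  exact ⟨_, s, hs, h, rfl⟩

lemma RationalHom.finite_not_hasOrderAt_zero [IsLocallyNoetherian Y] [NoetherianSpace Y] {T : RationalHom π} (hT : T ≠ 0) :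
    {y : Y | Order.coheight y = 1 ∧ ¬ T.HasOrderAt y 0}.Finite := by
  obtain ⟨V, hV, hgenV⟩ := exists_isAffineOpen_mem (genericPoint X)
  obtain ⟨n, g, hg⟩ := exists_isSpanning π hV hgenV
  obtain ⟨F, hFfin, hFord⟩ := IsSemilinear.exists_finite_hasOrder_one (functionFieldMap_finite π)
    T.isSemilinear (RationalHom.toAddHom_ne_zero hT) (exists_functionField_spanning π hgenV hg)
  obtain ⟨W, hgenW, hW⟩ := exists_open_forall_mem F hFfin
  have hgen : genericPoint X ∈ V ⊓ W := ⟨hgenV, hgenW⟩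
  refine (finite_coheight_one_notMem (genericPoint_mem_preimage π hgen)).subset ?_
  rintro y ⟨hy, hord⟩
  refine ⟨hy, fun hyU => hord ⟨1, one_ne_zero, ?_, ord_one y⟩⟩
  have hyU' : π y ∈ V ⊓ W := hyU
  exact hFord _ _ (hW _ hyU'.2) (hg _ hyU'.1)

variable [IsLocallyNoetherian X] [IsLocallyNoetherian Y]

lemma RationalHom.hasDivisor_iff (hX : IsNormal X) (hY : IsNormal Y) {T : RationalHom π}
    (hT : T ≠ 0) {R : WeilDivisor Y} :
    T.HasDivisor R ↔ ∀ (y : PrimeDivisor Y) (n : ℤ), T.HasOrderAt y.1 n → R y = n := by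
  refine forall_congr' fun y => ?_
  obtain ⟨s, hs, hord⟩ := RationalHom.exists_hasOrder hX hY hT (coheight_apply_eq_one π hX y.2)
  have hn : T.HasOrderAt y.1 (Scheme.ord s y.1) := ⟨s, hs, hord, rfl⟩
  have hT0 := RationalHom.toAddHom_ne_zero hT
  constructor
  · rintro ⟨Φ, hΦ, g, hg, hTΦ, hR⟩ n hn'
    have h1 : T.toAddHom = Φ.toAddHom.comp (AddMonoidHom.mulLeft g) := by
      ext z
      exact hTΦ z
    have hΦ0 : Φ.toAddHom ≠ 0 := by
      intro h0
      rw [h0] at h1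
      exact hT0 h1
    rw [h1] at hord
    have h2 := hord.of_mulLeft hg
    have h3 : s / g ∈ pushforwardSubring π (π y.1) := by
      rw [← mul_one (s / g)]
      refine (h2 1).mp fun b hb => ?_
      rw [one_mul]
      exact hΦ.1 b hb
    -- The map Φ((g / s) · ) is integral because Φ has order s / g, so the generating property of Φ
    -- applies to it.
    have h4 : g / s ∈ pushforwardSubring π (π y.1) := by
      have h5 : ∀ b ∈ pushforwardSubring π (π y.1),
          Φ.toAddHom (g / s * b) ∈ stalkSubring (π y.1) := (h2 (g / s)).mpr (by
        rw [div_mul_div_cancel₀ hg, div_self hs]; exact Subring.one_mem _)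
      obtain ⟨k, hk, hk'⟩ := hΦ.2 (.ofSemilinear (isSemilinear_comp_mulLeft Φ.isSemilinear (g / s)))
        h5
      have : g / s = k := eq_of_forall hΦ0 fun z => hk' z
      rw [this]
      exact hk
    rw [hR, hn'.unique hY y.2 hn]
    exact ord_eq_of_div_mem hY y.2 hg hs (pushforwardSubring_le π y.1 h4)
      (pushforwardSubring_le π y.1 h3)
  · intro h
    let Φ : RationalHom π := .ofSemilinear (isSemilinear_comp_mulLeft T.isSemilinear s⁻¹)
    have hΦ1 : HasOrder Φ.toAddHom (stalkSubring (π y.1)) (pushforwardSubring π (π y.1)) 1 := by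
      have := hord.mulLeft s⁻¹
      rwa [mul_inv_cancel₀ hs] at this
    have hTΦ : ∀ z, T z = Φ (s * z) := fun z => by
      change T z = T (s⁻¹ * (s * z))
      rw [inv_mul_cancel_left₀ hs]
    have hΦ0 : Φ.toAddHom ≠ 0 := by
      intro h0
      apply hT0
      ext z
      exact (hTΦ z).trans (DFunLike.congr_fun h0 (s * z))
    refine ⟨Φ, ⟨?_, fun Ψ hΨ => ?_⟩, s, hs, hTΦ, h _ hn⟩
    · intro z hz
      have := (hΦ1 1).mpr (by rw [one_mul]; exact Subring.one_mem _) z hz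
      rwa [one_mul] at this
    · obtain ⟨g, hg⟩ := IsSemilinear.exists_eq (functionFieldMap_finite π) Φ.isSemilinear hΦ0
        Ψ.isSemilinear
      refine ⟨g, ?_, hg⟩
      have : (1 : Y.functionField) * g ∈ pushforwardSubring π (π y.1) := (hΦ1 g).mp fun b hb => by
        rw [← hg]
        exact hΨ b hb
      rwa [one_mul] at this

lemma RationalHom.hasDivisor_iff_eq (hX : IsNormal X) (hY : IsNormal Y) {T : RationalHom π}
    (hT : T ≠ 0) {R : WeilDivisor Y}
    (hR : ∀ (y : PrimeDivisor Y) (n : ℤ), T.HasOrderAt y.1 n → R y = n) (R' : WeilDivisor Y) :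
    T.HasDivisor R' ↔ R' = R := by
  rw [RationalHom.hasDivisor_iff hX hY hT]
  constructor
  · intro h
    ext y
    obtain ⟨n, hn⟩ := RationalHom.exists_hasOrderAt hX hY hT y.2
    rw [h y n hn, hR y n hn]
  · rintro rfl
    exact hR

lemma RationalHom.exists_divisor [NoetherianSpace Y] (hX : IsNormal X) (hY : IsNormal Y)
    {T : RationalHom π} (hT : T ≠ 0) : ∃ R : WeilDivisor Y, ∀ (y : PrimeDivisor Y) (n : ℤ),
      T.HasOrderAt y.1 n → R y = n := by
  choose n hn using fun y : PrimeDivisor Y => RationalHom.exists_hasOrderAt hX hY hT y.2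
  refine ⟨Finsupp.ofSupportFinite n ?_, fun y k hk => (hn y).unique hY y.2 hk⟩
  refine ((RationalHom.finite_not_hasOrderAt_zero hT).preimage
    (f := (Subtype.val : PrimeDivisor Y → Y)) Subtype.val_injective.injOn).subset ?_
  exact fun y hy => ⟨y.2, fun h0 => hy ((hn y).unique hY y.2 h0)⟩

end RationalDivisor

/-! ### Pull-back of sections -/

section PullbackSection

open Scheme.Modules

variable {X Y : Scheme.{u}} (π : Y ⟶ X) {L : X.Modules}

lemma pullbackSection_smul {U : X.Opens} (a : Γ(X, U)) (l : Γ(L, U)) :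
    pullbackSection π L (a • l) = π.app U a • pullbackSection π L l :=
  Hom.app_smul ((pullbackPushforwardAdjunction π).unit.app L) a l

lemma pullbackSection_map {U V : X.Opens} (i : V ⟶ U) (l : Γ(L, U)) :
    pullbackSection π L (L.presheaf.map i.op l) =
      ((pullback π).obj L).presheaf.map ((Opens.map π.base).map i).op (pullbackSection π L l) :=
  ConcreteCategory.congr_hom ((Hom.mapPresheaf
    ((pullbackPushforwardAdjunction π).unit.app L)).naturality i.op) l

/-- The local generators of `L`, together with their pull-backs. -/
lemma exists_isGeneratingSection_pullbackSection (hL : IsInvertibleSheaf L) (x : X) :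
    ∃ (U : X.Opens) (l : Γ(L, U)), x ∈ U ∧ IsGeneratingSection L U l ∧
      IsGeneratingSection ((pullback π).obj L) (π ⁻¹ᵁ U) (pullbackSection π L l) := by
  obtain ⟨U, hx, ⟨i⟩⟩ := hL x
  obtain ⟨l, hl⟩ := exists_isGeneratingSection (M := L) (U := U) i
  exact ⟨U, l, hx, hl, hl.pullbackSection π i⟩

lemma hasLocalGenerators_pullback (hL : IsInvertibleSheaf L) :
    HasLocalGenerators ((pullback π).obj L) := by
  intro y
  obtain ⟨U, l, hx, -, hl⟩ := exists_isGeneratingSection_pullbackSection π hL (π y)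
  exact ⟨π ⁻¹ᵁ U, _, hx, hl⟩

variable [IsIntegral X] [IsIntegral Y] [Surjective π]

lemma exists_germ_pullbackSection_eq {U V : X.Opens} {l : Γ(L, U)}
    (h : IsGeneratingSection L U l) (hU : genericPoint X ∈ U) (hV : genericPoint X ∈ V)
    (m : Γ(L, V)) : ∃ c : X.presheaf.stalk (genericPoint X),
      L.presheaf.germ V _ hV m = c • L.presheaf.germ U _ hU l ∧
      ((pullback π).obj L).presheaf.germ (π ⁻¹ᵁ V) _ (genericPoint_mem_preimage π hV)
          (pullbackSection π L m) =
        (functionFieldMap π c : Y.presheaf.stalk (genericPoint Y)) •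
          ((pullback π).obj L).presheaf.germ (π ⁻¹ᵁ U) _ (genericPoint_mem_preimage π hU)
            (pullbackSection π L l) := by
  have hW : genericPoint X ∈ U ⊓ V := ⟨hU, hV⟩
  obtain ⟨c, hc⟩ := (h (U ⊓ V) (homOfLE inf_le_left)).2
    (L.presheaf.map (homOfLE inf_le_right : U ⊓ V ⟶ V).op m)
  dsimp only at hc
  refine ⟨sectionToField (U ⊓ V) hW c, ?_, ?_⟩
  · rw [← L.presheaf.germ_res_apply (homOfLE inf_le_right : U ⊓ V ⟶ V) _ hW,
      ← L.presheaf.germ_res_apply (homOfLE inf_le_left : U ⊓ V ⟶ U) _ hW, ← hc,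
      germ_smul_stalkModule]
    rfl
  · have hc' := congrArg (pullbackSection π L) hc
    rw [pullbackSection_smul, pullbackSection_map, pullbackSection_map] at hc'
    have hW' := genericPoint_mem_preimage π hW
    rw [functionFieldMap_section,
      ← ((pullback π).obj L).presheaf.germ_res_apply
        ((Opens.map π.base).map (homOfLE inf_le_right : U ⊓ V ⟶ V)) _ hW',
      ← ((pullback π).obj L).presheaf.germ_res_apply
        ((Opens.map π.base).map (homOfLE inf_le_left : U ⊓ V ⟶ U)) _ hW']
    refine (congrArg _ hc'.symm).trans ?_
    exact germ_smul_stalkModule ((pullback π).obj L) _ (π ⁻¹ᵁ (U ⊓ V)) hW' _ _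

end PullbackSection

end FrobeniusTranspose

namespace FrobeniusTranspose

/-! ### Transposes and extensions at the generic point -/

section Transpose

open Scheme.Modules

variable {X Y : Scheme.{u}} [IsIntegral X] [IsIntegral Y] {π : Y ⟶ X} [Surjective π]
  {L : X.Modules} {q : ℕ}

/-- The transpose condition lives at the generic point, and one generator suffices: another section
is a multiple c of it, its pull-back is the same multiple by the image of c, and T is linear. -/
lemma isTranspose_iff [IsFinite π] {T : RationalHom π} {φ : RootLinearMap q L}
    {ψ : RootLinearMap q ((pullback π).obj L)} {U : X.Opens} {l : Γ(L, U)}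
    (hl : IsGeneratingSection L U l) (hU : genericPoint X ∈ U) :
    IsTranspose T φ ψ ↔ ∀ z, T (ψ.along (((pullback π).obj L).presheaf.germ (π ⁻¹ᵁ U) _
      (genericPoint_mem_preimage π hU) (pullbackSection π L l)) z) =
        φ.along (L.presheaf.germ U _ hU l) (T z) := by
  constructor
  · intro h z
    obtain ⟨V, hV, hV', s, rfl⟩ : z ∈ pushforwardSubring π (genericPoint X) := by
      rw [pushforwardSubring_genericPoint]; trivial
    have hW : genericPoint X ∈ U ⊓ V := ⟨hU, hV⟩
    have hW' := genericPoint_mem_preimage π hW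
    have h1 := h (U ⊓ V) hW (Y.presheaf.map ((Opens.map π.base).map
      (homOfLE inf_le_right : U ⊓ V ⟶ V)).op s) (L.presheaf.map (homOfLE inf_le_left).op l)
    have h2 := ψ.sectionToField_app_smul hW' (Y.presheaf.map ((Opens.map π.base).map
      (homOfLE inf_le_right : U ⊓ V ⟶ V)).op s)
      (pullbackSection π L (L.presheaf.map (homOfLE inf_le_left).op l))
    have h3 := (congrArg T h2).symm.trans h1
    rw [pullbackSection_map, L.presheaf.germ_res_apply] at h3
    have h4 := ((pullback π).obj L).presheaf.germ_res_apply
        ((Opens.map π.base).map (homOfLE inf_le_left : U ⊓ V ⟶ U)) _ hW' (pullbackSection π L l)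
    have h5 := Y.presheaf.germ_res_apply
        ((Opens.map π.base).map (homOfLE inf_le_right : U ⊓ V ⟶ V)) _ hW' s
    erw [h4, h5] at h3
    exact h3
  · intro h V hV s m
    obtain ⟨c, hc, hc'⟩ := exists_germ_pullbackSection_eq π hl hU hV m
    have h2 := ψ.sectionToField_app_smul (genericPoint_mem_preimage π hV) s (pullbackSection π L m)
    refine (congrArg T h2).trans ?_
    rw [hc', ψ.along_smul, h, T.map_mul, hc, ← φ.along_smul]
    rfl

lemma isExtension_iff {φ : RootLinearMap q L}
    {ψ : RootLinearMap q ((pullback π).obj L)} {U : X.Opens} {l : Γ(L, U)}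
    (hl : IsGeneratingSection L U l) (hU : genericPoint X ∈ U) :
    IsExtension φ ψ ↔ ∀ c, ψ.along (((pullback π).obj L).presheaf.germ (π ⁻¹ᵁ U) _
      (genericPoint_mem_preimage π hU) (pullbackSection π L l)) (functionFieldMap π c) =
        functionFieldMap π (φ.along (L.presheaf.germ U _ hU l) c) := by
  constructor
  · intro h c
    obtain ⟨V, hV, a, rfl⟩ := exists_sectionToField_eq c
    have hW : genericPoint X ∈ U ⊓ V := ⟨hU, hV⟩
    have hW' := genericPoint_mem_preimage π hW
    rw [← sectionToField_map (homOfLE inf_le_right : U ⊓ V ⟶ V) hW,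
      ← L.presheaf.germ_res_apply (homOfLE inf_le_left : U ⊓ V ⟶ U) _ hW,
      ← φ.sectionToField_app_smul hW, functionFieldMap_section, functionFieldMap_section,
      ← h (U ⊓ V), pullbackSection_smul, ψ.sectionToField_app_smul, pullbackSection_map,
      ← ((pullback π).obj L).presheaf.germ_res_apply
        ((Opens.map π.base).map (homOfLE inf_le_left : U ⊓ V ⟶ U)) _ hW' (pullbackSection π L l)]
  · intro h V m
    by_cases hV' : genericPoint Y ∈ π ⁻¹ᵁ V
    · have hV : genericPoint X ∈ V := by
        rw [← map_genericPoint π]; exact hV'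
      obtain ⟨c, hc, hc'⟩ := exists_germ_pullbackSection_eq π hl hU hV m
      apply sectionToField_injective hV'
      rw [← functionFieldMap_section π hV, ← one_smul Γ(X, V) m,
        ← one_smul Γ(Y, π ⁻¹ᵁ V) (pullbackSection π L _), ψ.sectionToField_app_smul,
        φ.sectionToField_app_smul, one_smul, hc', hc, ψ.along_smul, φ.along_smul, map_one,
        map_one, mul_one, mul_one, h]
    · have := subsingleton_of_genericPoint_notMem hV'
      exact Subsingleton.elim _ _

end Transpose

/-! ### The order of a transpose -/

section TransposeOrder

set_option linter.unusedSectionVars false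

open Scheme.Modules

variable {X Y : Scheme.{u}} [IsIntegral X] [IsIntegral Y] {π : Y ⟶ X} [Surjective π] [IsFinite π]
  {p e : ℕ}

/-- The composition formula needs the semilocal ring (π_* 𝒪_Y)_x, on which T is defined over
𝒪_{X,x}. Being p^{-e}-linear over M, Ψ can afterwards be localized at the single point y. -/
lemma hasOrder_transpose_stalkSubring (hp : p.Prime) (hYF : IsFFinite p Y) {T : RationalHom π}
    {Φ : X.functionField →+ X.functionField} {Ψ : Y.functionField →+ Y.functionField}
    (hΨ : ∀ r z, Ψ (r ^ p ^ e * z) = r * Ψ z) (h : ∀ z, T (Ψ z) = Φ (T z)) (y : Y)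
    {f : X.functionField} (hf : HasOrder Φ (stalkSubring (π y)) (stalkSubring (π y)) f)
    {s : Y.functionField} (hs0 : s ≠ 0)
    (hs : HasOrder T.toAddHom (stalkSubring (π y)) (pushforwardSubring π (π y)) s) :
    HasOrder Ψ (stalkSubring y) (stalkSubring y) (s * functionFieldMap π f / s ^ p ^ e) := by
  have hq : p ^ e ≠ 0 := pow_ne_zero e hp.ne_zero
  obtain ⟨Fr, hFr, -, -⟩ := hYF.exists_pow hp e
  obtain ⟨U, hU, hxU⟩ := exists_isAffineOpen_mem (π y)
  obtain ⟨n, g, hg⟩ := exists_isSpanning_pow_pushforward π hq hFr hU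
    (hYF.isPowFinite (hU.preimage π) e) hxU
  exact (HasOrder.transpose hFr (fun a ha => functionFieldMap_mem_pushforwardSubring π ha) hf hs
    hs0 T.isSemilinear hΨ h).localization (fun c z => by rw [hFr, hΨ]) hg
    (isSubringLocalization π y) (isSubringLocalization_pow π y hq hFr)

variable [IsLocallyNoetherian X] [IsLocallyNoetherian Y]

lemma ord_transpose (hX : IsNormal X) (q : ℕ) (y : PrimeDivisor Y) {f : X.functionField}
    (hf : f ≠ 0) {s : Y.functionField} (hs : s ≠ 0) :
    Scheme.ord (s * functionFieldMap π f / s ^ q) y.1 = Scheme.ord s y.1 +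
      Scheme.ord f (π y.1) * ramificationIndex π y - q * Scheme.ord s y.1 := by
  have hf' : functionFieldMap π f ≠ 0 := (map_ne_zero _).mpr hf
  rw [ord_div _ (mul_ne_zero hs hf') (pow_ne_zero _ hs), Scheme.ord_mul hs hf', ord_pow _ hs,
    ramificationIndex_eq π hX y hf]

variable {L : X.Modules}

lemma RootLinearMap.HasOrderAt.nonneg {X : Scheme.{u}} [IsIntegral X] [IsLocallyNoetherian X]
    {L : X.Modules} {q : ℕ} (hX : IsNormal X) {φ : RootLinearMap q L} {x : X}
    (hx : Order.coheight x = 1) {n : ℤ} (h : φ.HasOrderAt x n) : 0 ≤ n := by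
  obtain ⟨U, l, hxU, f, hl, hf, hord, rfl⟩ := h
  rw [← mem_stalkSubring_iff_ord hX hx hf, ← mul_one f]
  refine (hord 1).mp ?_
  rintro _ ⟨b, rfl⟩
  rw [one_mul, ← φ.algebraMap_stalkMap_smul hxU]
  exact ⟨_, rfl⟩

lemma IsTranspose.hasOrderAt (hX : IsNormal X) (hp : p.Prime) (hXF : IsFFinite p X)
    (hYF : IsFFinite p Y) (hL : IsInvertibleSheaf L) {T : RationalHom π}
    {φ : RootLinearMap (p ^ e) L} (hφ : φ ≠ 0) {ψ : RootLinearMap (p ^ e) ((pullback π).obj L)}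
    (h : IsTranspose T φ ψ) (y : PrimeDivisor Y) {n k : ℤ} (hn : φ.HasOrderAt (π y.1) n)
    (hk : T.HasOrderAt y.1 k) :
    ψ.HasOrderAt y.1 (k + n * ramificationIndex π y - (p ^ e : ℕ) * k) := by
  have hx := coheight_apply_eq_one π hX y.2
  obtain ⟨U, l, hxU, hl, hl'⟩ := exists_isGeneratingSection_pullbackSection π hL (π y.1)
  have hgen := genericPoint_mem hxU
  obtain ⟨s, hs, hord, rfl⟩ := hk
  obtain ⟨f, hf, hordf⟩ := exists_hasOrder_stalkSubring hX hp hXF (φ.along_pow_mul _)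
    (RootLinearMap.along_germ_ne_zero hφ hl hgen) hx
  have hn' := hn.ord_eq hX hx hxU hl hf hordf
  rw [isTranspose_iff hl hgen] at h
  have hf' : functionFieldMap π f ≠ 0 := (map_ne_zero _).mpr hf
  refine ⟨π ⁻¹ᵁ U, _, hxU, _, hl', div_ne_zero (mul_ne_zero hs hf') (pow_ne_zero (p ^ e) hs),
    hasOrder_transpose_stalkSubring hp hYF (ψ.along_pow_mul _) h y.1 hordf hs hord, ?_⟩
  rw [ord_transpose hX _ y hf hs, hn']

lemma RationalHom.surjective {X Y : Scheme.{u}} [IsIntegral X] [IsIntegral Y] {π : Y ⟶ X}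
    [Surjective π] {T : RationalHom π} (hT : T ≠ 0) (w : X.functionField) : ∃ z, T z = w := by
  let := functionFieldAlgebra π
  obtain ⟨z, hz⟩ : ∃ z, T z ≠ 0 := by
    by_contra! h0
    exact hT (LinearMap.ext h0)
  refine ⟨functionFieldMap π (w / T z) * z, ?_⟩
  rw [T.map_mul, div_mul_cancel₀ _ hz]

lemma IsTranspose.ne_zero {q : ℕ} (hL : IsInvertibleSheaf L) {T : RationalHom π} (hT : T ≠ 0)
    {φ : RootLinearMap q L} (hφ : φ ≠ 0) {ψ : RootLinearMap q ((pullback π).obj L)}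
    (h : IsTranspose T φ ψ) : ψ ≠ 0 := by
  rintro rfl
  obtain ⟨U, l, hgen, hl, -⟩ :=
    exists_isGeneratingSection_pullbackSection π hL (genericPoint X)
  rw [isTranspose_iff hl hgen] at h
  apply RootLinearMap.along_germ_ne_zero hφ hl hgen
  ext w
  obtain ⟨z, rfl⟩ := T.surjective hT w
  rw [← h]
  have h0 : ∀ m, (0 : RootLinearMap q ((pullback π).obj L)).stalkMap (genericPoint Y) m = 0 := by
    intro m
    obtain ⟨V, hV, m, rfl⟩ := ((pullback π).obj L).presheaf.exists_germ_eq m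
    rw [RootLinearMap.stalkMap_germ]
    exact map_zero _
  rw [RootLinearMap.along_apply, h0]
  exact T.toAddHom.map_zero

lemma pullbackDivisor_apply (hX : IsNormal X) (D : QDivisor X) (y : PrimeDivisor Y) :
    pullbackDivisor π D y =
      D ⟨π y.1, coheight_apply_eq_one π hX y.2⟩ * (ramificationIndex π y : ℚ) := by
  change pullbackCoeff π D y = _
  rw [pullbackCoeff, dif_pos (coheight_apply_eq_one π hX y.2)]

/-- The transpose over the function fields descends to sheaves: nonnegativity says that its order at
each prime divisor is regular, so it maps local sections of the pull-back to 𝒪_{Y,y}. -/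
lemma exists_isTranspose (hX : IsNormal X) (hY : IsNormal Y) (hp : p.Prime) (hXF : IsFFinite p X)
    (hYF : IsFFinite p Y) (hL : IsInvertibleSheaf L) {T : RationalHom π} (hT : T ≠ 0)
    {φ : RootLinearMap (p ^ e) L} (hφ : φ ≠ 0)
    (h : ∀ (y : PrimeDivisor Y) (n k : ℤ), φ.HasOrderAt (π y.1) n → T.HasOrderAt y.1 k →
      0 ≤ k + n * ramificationIndex π y - (p ^ e : ℕ) * k) :
    ∃ ψ : RootLinearMap (p ^ e) ((pullback π).obj L), IsTranspose T φ ψ := by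
  have : Fact p.Prime := ⟨hp⟩
  have := hYF.charP
  obtain ⟨U₀, l₀, hgen₀, hl₀, hl₀'⟩ :=
    exists_isGeneratingSection_pullbackSection π hL (genericPoint X)
  obtain ⟨Ψ, hΨ, hTΨ⟩ := IsSemilinear.exists_transpose (p := p) (functionFieldMap_finite π)
    T.isSemilinear (RationalHom.toAddHom_ne_zero hT) e
    (φ.along_pow_mul (L.presheaf.germ U₀ _ hgen₀ l₀))
  have hgen₀' := genericPoint_mem_preimage π hgen₀
  have hbij := hl₀'.stalk _ hgen₀'
  set m₀ := ((pullback π).obj L).presheaf.germ (π ⁻¹ᵁ U₀) _ hgen₀' (pullbackSection π L l₀)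
  -- The generic stalk of the pull-back is identified with K(Y) by means of the generator m₀.
  let E := AddEquiv.ofBijective ((AddMonoidHom.flip
    (smulAddHom (Y.presheaf.stalk (genericPoint Y)) _)) m₀) hbij
  have hE : ∀ a : Y.presheaf.stalk (genericPoint Y), E.symm (a • m₀) = a :=
    fun a => E.symm_apply_apply a
  obtain ⟨ψ, hψ⟩ := exists_rootLinearMap (q := p ^ e) (L := (pullback π).obj L) hY
    (Ψ.comp E.symm.toAddMonoidHom) (fun r m => by
      obtain ⟨a, rfl⟩ := hbij.2 m
      change Ψ (E.symm (r ^ p ^ e • a • m₀)) = r * Ψ (E.symm (a • m₀))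
      rw [smul_smul, hE, hE]
      exact hΨ _ _) (fun V m y hyV hy => by
      obtain ⟨U, l, hxU, hl, hl'⟩ := exists_isGeneratingSection_pullbackSection π hL (π y)
      have hgen := genericPoint_mem hxU
      have hx := coheight_apply_eq_one π hX hy
      -- Near y the section is a times the pull-back of a generator l, and l is c times l₀
      -- generically. So its value is Ψ(σ(c) a), and Ψ(σ(c) · ) is the transpose of φ along l.
      obtain ⟨a, -, ha⟩ := hl'.germ_eq_smul (x := y) hxU hyV m
      obtain ⟨c, hc, hc'⟩ := exists_germ_pullbackSection_eq π hl₀ hgen₀ hgen l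
      have h1 : (Ψ.comp E.symm.toAddMonoidHom)
          (((pullback π).obj L).presheaf.germ V _ (genericPoint_mem hyV) m) =
          (Ψ.comp (AddMonoidHom.mulLeft (functionFieldMap π c))) (algebraMap _ _ a) := by
        rw [ha]
        refine (congrArg (fun w => (Ψ.comp E.symm.toAddMonoidHom)
          ((algebraMap _ Y.functionField a : Y.presheaf.stalk (genericPoint Y)) • w)) hc').trans ?_
        change Ψ (E.symm _) = Ψ _
        rw [smul_smul]
        refine (congrArg Ψ (hE _)).trans ?_
        rw [mul_comm]
        rfl
      rw [h1]
      obtain ⟨k, hk⟩ := RationalHom.exists_hasOrderAt hX hY hT hy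
      obtain ⟨s, hs, hord, rfl⟩ := hk
      obtain ⟨f, hf, hordf⟩ := exists_hasOrder_stalkSubring hX hp hXF (φ.along_pow_mul _)
        (RootLinearMap.along_germ_ne_zero hφ hl hgen) hx
      have h2 := hasOrder_transpose_stalkSubring (e := e) hp hYF (T := T)
        (Ψ := Ψ.comp (AddMonoidHom.mulLeft (functionFieldMap π c))) (fun r z => by
          change Ψ (_ * (r ^ p ^ e * z)) = r * Ψ (_ * z)
          rw [mul_left_comm, hΨ]) (fun z => by
          refine (hTΨ _).trans ?_
          rw [hc, φ.along_smul]
          exact congrArg _ (T.map_mul c z)) y hordf hs hord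
      have hf' : functionFieldMap π f ≠ 0 := (map_ne_zero _).mpr hf
      have h3 : s * functionFieldMap π f / s ^ p ^ e ∈ stalkSubring y := by
        rw [mem_stalkSubring_iff_ord hY hy
          (div_ne_zero (mul_ne_zero hs hf') (pow_ne_zero (p ^ e) hs)),
          ord_transpose hX _ ⟨y, hy⟩ hf hs]
        exact h ⟨y, hy⟩ _ _ ⟨U, l, hxU, f, hl, hf, hordf, rfl⟩ ⟨s, hs, hord, rfl⟩
      have h4 := (h2 1).mpr (by rwa [mul_one]) (algebraMap _ _ a) ⟨a, rfl⟩
      rwa [one_mul] at h4)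
  refine ⟨ψ, (isTranspose_iff hl₀ hgen₀).mpr fun z => ?_⟩
  refine Eq.trans ?_ (hTΨ z)
  rw [ψ.along_apply, hψ]
  exact congrArg (fun w => T (Ψ w)) (hE z)

lemma cast_pow_sub_one_pos {p e : ℕ} (hp : p.Prime) (he : 0 < e) : 0 < ((p ^ e : ℕ) : ℚ) - 1 := by
  have : 1 < p ^ e := Nat.one_lt_pow he.ne' hp.one_lt
  have : (1 : ℚ) < ((p ^ e : ℕ) : ℚ) := by exact_mod_cast this
  linarith


/-- Multiplication by q - 1 turns the coefficientwise inequality of divisors into nonnegativity of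
the order of the transpose. -/
lemma coeff_le_iff {q r n k : ℚ} (hq : 0 < q - 1) :
    k ≤ n / (q - 1) * r ↔ 0 ≤ k + n * r - q * k := by
  rw [div_mul_eq_mul_div, le_div_iff₀ hq, ← sub_nonneg]
  constructor <;> intro h <;> linarith

theorem exists_isTranspose_iff (hX : IsNormal X) (hY : IsNormal Y) (hp : p.Prime)
    (hXF : IsFFinite p X) (hYF : IsFFinite p Y) (he : 0 < e) (hL : IsInvertibleSheaf L)
    {T : RationalHom π} (hT : T ≠ 0) {φ : RootLinearMap (p ^ e) L} (hφ : φ ≠ 0) {Δ : QDivisor X}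
    (hΔ : ∀ (x : PrimeDivisor X) (n : ℤ), φ.HasOrderAt x.1 n →
      Δ x = (n : ℚ) / (((p ^ e : ℕ) : ℚ) - 1)) {R : WeilDivisor Y}
    (hR : ∀ (y : PrimeDivisor Y) (n : ℤ), T.HasOrderAt y.1 n → R y = n) :
    (∃ ψ, IsTranspose T φ ψ) ↔ R.toQ ≤ pullbackDivisor π Δ := by
  have hq := cast_pow_sub_one_pos hp he
  rw [Finsupp.le_def]
  constructor
  · rintro ⟨ψ, hψ⟩ y
    obtain ⟨n, hn⟩ := RootLinearMap.exists_hasOrderAt hX hp hXF hL.hasLocalGenerators hφ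
      (coheight_apply_eq_one π hX y.2)
    obtain ⟨k, hk⟩ := RationalHom.exists_hasOrderAt hX hY hT y.2
    have h0 := (hψ.hasOrderAt hX hp hXF hYF hL hφ y hn hk).nonneg hY y.2
    rw [pullbackDivisor_apply hX, hΔ ⟨π y.1, _⟩ n hn]
    change ((R y : ℤ) : ℚ) ≤ _
    rw [hR y k hk, coeff_le_iff hq]
    exact_mod_cast h0
  · intro h
    refine exists_isTranspose hX hY hp hXF hYF hL hT hφ fun y n k hn hk => ?_
    have h1 := h y
    rw [pullbackDivisor_apply hX, hΔ ⟨π y.1, _⟩ n hn] at h1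
    change ((R y : ℤ) : ℚ) ≤ _ at h1
    rw [hR y k hk, coeff_le_iff hq] at h1
    exact_mod_cast h1

theorem IsTranspose.hasDivisor_iff (hX : IsNormal X) (hY : IsNormal Y) (hp : p.Prime)
    (hXF : IsFFinite p X) (hYF : IsFFinite p Y) (he : 0 < e) (hL : IsInvertibleSheaf L)
    {T : RationalHom π} (hT : T ≠ 0) {φ : RootLinearMap (p ^ e) L} (hφ : φ ≠ 0) {Δ : QDivisor X}
    (hΔ : ∀ (x : PrimeDivisor X) (n : ℤ), φ.HasOrderAt x.1 n →
      Δ x = (n : ℚ) / (((p ^ e : ℕ) : ℚ) - 1)) {R : WeilDivisor Y}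
    (hR : ∀ (y : PrimeDivisor Y) (n : ℤ), T.HasOrderAt y.1 n → R y = n)
    {ψ : RootLinearMap (p ^ e) ((pullback π).obj L)} (hψ : IsTranspose T φ ψ) (Δ' : QDivisor Y) :
    ψ.HasDivisor Δ' ↔ Δ' = pullbackDivisor π Δ - R.toQ := by
  have hq := cast_pow_sub_one_pos hp he
  refine RootLinearMap.hasDivisor_iff_eq hY hp hYF (hasLocalGenerators_pullback π hL)
    (hψ.ne_zero hL hT hφ) (fun y m hm => ?_) Δ'
  obtain ⟨n, hn⟩ := RootLinearMap.exists_hasOrderAt hX hp hXF hL.hasLocalGenerators hφ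
    (coheight_apply_eq_one π hX y.2)
  obtain ⟨k, hk⟩ := RationalHom.exists_hasOrderAt hX hY hT y.2
  rw [hm.unique hY y.2 (hψ.hasOrderAt hX hp hXF hYF hL hφ y hn hk), Finsupp.sub_apply,
    pullbackDivisor_apply hX, hΔ ⟨π y.1, _⟩ n hn]
  change _ - ((R y : ℤ) : ℚ) = _
  rw [hR y k hk]
  push_cast at hq ⊢
  field_simp
  ring

end TransposeOrder

end FrobeniusTranspose

namespace FrobeniusTranspose

/-! ### Extensions are transposes with respect to the trace -/

section Trace

variable {K M : Type*} [Field K] [Field M] [Algebra K M] [FiniteDimensional K M]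
  [Algebra.IsSeparable K M] {p : ℕ} [hp : Fact p.Prime] [CharP K p]

/-- The trace is the sum of the conjugates, and Frobenius is additive on the algebraic closure. -/
lemma trace_pow_char_pow (e : ℕ) (w : M) :
    Algebra.trace K M (w ^ p ^ e) = Algebra.trace K M w ^ p ^ e := by
  let E := AlgebraicClosure K
  have : CharP E p := charP_of_injective_algebraMap (algebraMap K E).injective p
  apply (algebraMap K E).injective
  rw [(algebraMap K E).map_pow, trace_eq_sum_embeddings E, trace_eq_sum_embeddings E, sum_pow_char_pow]
  simp

variable (K) in
lemma exists_sum_mul_pow (e : ℕ) (z : M) :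
    ∃ (n : ℕ) (c : Fin n → K) (w : Fin n → M), z = ∑ i, algebraMap K M (c i) * w i ^ p ^ e := by
  have : ExpChar K p := ExpChar.prime hp.out
  let b := Module.finBasis K M
  have h := Field.span_map_pow_expChar_pow_eq_top_of_isSeparable p e (F := K) b.span_eq
  have hz : z ∈ Submodule.span K (Set.range fun i => b i ^ p ^ e) := by rw [h]; trivial
  rw [Submodule.mem_span_range_iff_exists_fun] at hz
  obtain ⟨c, rfl⟩ := hz
  exact ⟨_, c, b, Finset.sum_congr rfl fun i _ => Algebra.smul_def _ _⟩

/-- By separability M is spanned over K by q-th powers, and for z = c w^q both sides of the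
transpose identity become φ(c) Tr(w). Conversely, testing ψ(c) - φ(c) against all w uses
nondegeneracy of the trace. -/
lemma forall_algebraMap_iff_forall_trace {e : ℕ} {φ : K →+ K} {ψ : M →+ M}
    (hφ : ∀ r z, φ (r ^ p ^ e * z) = r * φ z) (hψ : ∀ r z, ψ (r ^ p ^ e * z) = r * ψ z) :
    (∀ c, ψ (algebraMap K M c) = algebraMap K M (φ c)) ↔
      ∀ z, Algebra.trace K M (ψ z) = φ (Algebra.trace K M z) := by
  have hmul : ∀ (c : K) (z : M), Algebra.trace K M (algebraMap K M c * z) =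
      c * Algebra.trace K M z := fun c z => by
    rw [← Algebra.smul_def, map_smul, smul_eq_mul]
  constructor
  · intro h z
    obtain ⟨n, c, w, rfl⟩ := exists_sum_mul_pow (p := p) K e z
    simp only [map_sum]
    refine Finset.sum_congr rfl fun i _ => ?_
    rw [hmul, trace_pow_char_pow, mul_comm (c i), hφ, mul_comm (algebraMap K M (c i)), hψ, h,
      mul_comm (w i), hmul, mul_comm]
  · intro h c
    refine eq_of_forall (T := (Algebra.trace K M).toAddMonoidHom) ?_ fun w => ?_
    · intro h0
      exact Algebra.trace_ne_zero K M (LinearMap.ext fun z => DFunLike.congr_fun h0 z)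
    · change Algebra.trace K M (ψ (algebraMap K M c) * w) =
        Algebra.trace K M (algebraMap K M (φ c) * w)
      rw [mul_comm, ← hψ, h, hmul, mul_comm, hmul, trace_pow_char_pow, mul_comm c, hφ, mul_comm]

end Trace

/-! ### Ramification -/

section Ramification

open Scheme.Modules

variable {X Y : Scheme.{u}} [IsIntegral X] [IsIntegral Y] {π : Y ⟶ X} [Surjective π] [IsFinite π]
  {p : ℕ}

variable (π) in
lemma finiteDimensional_functionField :
    let := functionFieldAlgebra π
    FiniteDimensional X.functionField Y.functionField := functionFieldMap_finite π

lemma rationalTrace_ne_zero (hsep : IsGenericallySeparable π) : rationalTrace π ≠ 0 := by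
  let := functionFieldAlgebra π
  have := finiteDimensional_functionField π
  have : Algebra.IsSeparable X.functionField Y.functionField := hsep
  exact Algebra.trace_ne_zero X.functionField Y.functionField

lemma forall_functionFieldMap_iff (hp : p.Prime) (hXF : IsFFinite p X)
    (hsep : IsGenericallySeparable π) {e : ℕ}
    {Φ : X.functionField →+ X.functionField} {Ψ : Y.functionField →+ Y.functionField}
    (hΦ : ∀ r z, Φ (r ^ p ^ e * z) = r * Φ z) (hΨ : ∀ r z, Ψ (r ^ p ^ e * z) = r * Ψ z) :
    (∀ c, Ψ (functionFieldMap π c) = functionFieldMap π (Φ c)) ↔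
      ∀ z, rationalTrace π (Ψ z) = Φ (rationalTrace π z) := by
  let := functionFieldAlgebra π
  have := finiteDimensional_functionField π
  have : Algebra.IsSeparable X.functionField Y.functionField := hsep
  have : Fact p.Prime := ⟨hp⟩
  have := hXF.charP
  exact forall_algebraMap_iff_forall_trace hΦ hΨ

lemma isExtension_iff_isTranspose (hp : p.Prime) (hXF : IsFFinite p X)
    (hsep : IsGenericallySeparable π) {L : X.Modules} (hL : IsInvertibleSheaf L) {e : ℕ}
    (φ : RootLinearMap (p ^ e) L) (ψ : RootLinearMap (p ^ e) ((pullback π).obj L)) :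
    IsExtension φ ψ ↔ IsTranspose (rationalTrace π) φ ψ := by
  obtain ⟨U, l, hgen, hl, -⟩ :=
    exists_isGeneratingSection_pullbackSection π hL (genericPoint X)
  rw [isExtension_iff hl hgen, isTranspose_iff hl hgen]
  exact forall_functionFieldMap_iff hp hXF hsep (φ.along_pow_mul _) (ψ.along_pow_mul _)

lemma isPowFinite_stalk_of_isFFinite (hp : p.Prime) (hF : IsFFinite p X) (x : X) :
    IsPowFinite p (X.presheaf.stalk x) := by
  obtain ⟨Fr, hFr, -, -⟩ := hF.exists_pow hp 1
  obtain ⟨U, hU, hx⟩ := exists_isAffineOpen_mem x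
  have h := isPowFinite_stalk (pow_ne_zero 1 hp.ne_zero) hFr hU (hF.isPowFinite hU 1) hx
  rwa [pow_one] at h

lemma charP_stalk (hF : IsFFinite p X) (x : X) : CharP (X.presheaf.stalk x) p := by
  have := hF.charP
  exact ((algebraMap (X.presheaf.stalk x) X.functionField).charP_iff
    (IsFractionRing.injective _ _) p).mpr this

variable [IsLocallyNoetherian X] [IsLocallyNoetherian Y]

/-- Along a prime divisor, the order of the trace is the length of the relative differentials. -/
theorem length_kaehlerDifferential_eq (hX : IsNormal X) (hY : IsNormal Y) (hp : p.Prime)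
    (hXF : IsFFinite p X) (hYF : IsFFinite p Y) (hsep : IsGenericallySeparable π)
    (y : PrimeDivisor Y) {k : ℤ} (hk : (rationalTrace π).HasOrderAt y.1 k) :
    letI := (π.stalkMap y.1).hom.toAlgebra
    ∃ n : ℕ, Module.length (Y.presheaf.stalk y.1)
      (KaehlerDifferential (X.presheaf.stalk (π y.1)) (Y.presheaf.stalk y.1)) = n ∧ k = n := by
  let := (π.stalkMap y.1).hom.toAlgebra
  let := functionFieldAlgebra π
  have := finiteDimensional_functionField π
  have : Algebra.IsSeparable X.functionField Y.functionField := hsep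
  have : Fact p.Prime := ⟨hp⟩
  have := charP_stalk hXF (π y.1)
  have := charP_stalk hYF y.1
  have := hYF.charP
  have := isDiscreteValuationRing_stalk hX (coheight_apply_eq_one π hX y.2)
  have := isDiscreteValuationRing_stalk hY y.2
  obtain ⟨n, J, hJ, hn, hJn, Φ, hΦ, hΦ1, hΨ⟩ := exists_length_kaehlerDifferential (p := p)
    (A := X.presheaf.stalk (π y.1)) (B := Y.presheaf.stalk y.1) (K := X.functionField)
    (M := Y.functionField) (fun a => (functionFieldMap_algebraMap π y.1 a).symm)
    (isPowFinite_stalk_of_isFFinite hp hXF _) (isPowFinite_stalk_of_isFFinite hp hYF _)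
  refine ⟨n, hn, ?_⟩
  obtain ⟨s, hs, hord, rfl⟩ := hk
  -- The exponent e is irrelevant to the ramification, so the comparison uses e = 1 and the
  -- generator Φ at π(y). Its trace transpose is its extension to K(Y).
  obtain ⟨Ψ, hΨp, hTΨ⟩ := IsSemilinear.exists_transpose (p := p) (functionFieldMap_finite π)
    (rationalTrace π).isSemilinear (RationalHom.toAddHom_ne_zero (rationalTrace_ne_zero hsep)) 1
    (φ := Φ) (by simpa only [pow_one] using hΦ)
  have hext := (forall_functionFieldMap_iff (e := 1) hp hXF hsep
    (by simpa only [pow_one] using hΦ) hΨp).mpr hTΨ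
  have h1 := (hΨ Ψ (by simpa only [pow_one] using hΨp) hext).hasOrder
  have hJ0 : algebraMap _ Y.functionField J ≠ 0 := by simpa using hJ
  have h2 := h1.of_mulLeft (pow_ne_zero _ hJ0)
  -- Since Φ has order 1, this order is s / s^p, while `h2` gives 1 / J^(p-1). Comparing valuations
  -- and cancelling p - 1 yields ord s = ord J.
  have h3 := hasOrder_transpose_stalkSubring (e := 1) hp hYF hΨp hTΨ y.1 hΦ1.hasOrder hs hord
  have h4 := HasOrder.ord_eq hY y.2 le_rfl h3 h2 (div_ne_zero (mul_ne_zero hs (by simp))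
    (pow_ne_zero _ hs)) (div_ne_zero one_ne_zero (pow_ne_zero _ hJ0))
  rw [ord_transpose hX _ y one_ne_zero hs, ord_div _ one_ne_zero (pow_ne_zero _ hJ0), ord_one,
    ord_one, ord_pow _ hJ0, ord_algebraMap y.2 hJ hJn, pow_one,
    Nat.cast_sub hp.one_le] at h4
  have hp1 : (p : ℤ) - 1 ≠ 0 := by
    have := hp.one_lt
    omega
  apply mul_left_cancel₀ hp1
  push_cast at h4
  linarith

end Ramification

end FrobeniusTranspose

namespace FrobeniusTranspose

/-! ### Relative canonical divisors -/

section Avoidance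

variable {X : Scheme.{u}} [IsIntegral X]

lemma not_specializes {x x' : X} (hx : Order.coheight x = 1) (hx' : Order.coheight x' = 1)
    (h : x' ≠ x) : ¬ x' ⤳ x := fun hs => h (eq_of_specializes hx hs (ne_genericPoint hx'))

/-- No prime divisor specializes to a different one, so each unwanted point has a neighbourhood of x
missing it; finitely many are intersected. -/
lemma exists_isAffineOpen_avoiding {x : X} (hx : Order.coheight x = 1) {S : Set X} (hS : S.Finite)
    (hS' : ∀ x' ∈ S, Order.coheight x' = 1 ∧ x' ≠ x) {U₀ : X.Opens} (hU₀ : x ∈ U₀) :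
    ∃ U : X.Opens, IsAffineOpen U ∧ x ∈ U ∧ U ≤ U₀ ∧ ∀ x' ∈ S, x' ∉ U := by
  have key : ∃ W : X.Opens, x ∈ W ∧ W ≤ U₀ ∧ ∀ x' ∈ S, x' ∉ W := by
    induction S, hS using Set.Finite.induction_on with
    | empty => exact ⟨U₀, hU₀, le_rfl, by simp⟩
    | @insert a S _ _ ih =>
      obtain ⟨W, hxW, hW, hWS⟩ := ih fun x' hx' => hS' x' (Set.mem_insert_of_mem _ hx')
      obtain ⟨ha, hax⟩ := hS' a (Set.mem_insert _ _)
      obtain ⟨V, hV, hxV, haV⟩ := not_specializes_iff_exists_open.mp (not_specializes hx ha hax)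
      refine ⟨W ⊓ ⟨V, hV⟩, ⟨hxW, hxV⟩, inf_le_left.trans hW, ?_⟩
      rintro x' (rfl | hx') hmem
      · exact haV hmem.2
      · exact hWS x' hx' hmem.1
  obtain ⟨W, hxW, hW, hWS⟩ := key
  obtain ⟨U, hU, hxU, hUW⟩ := exists_isAffineOpen_mem_and_subset hxW
  exact ⟨U, hU, hxU, (SetLike.coe_subset_coe.mp hUW).trans hW, fun x' hx' h => hWS x' hx' (hUW h)⟩

lemma exists_isUnit_germ_and_not_isUnit_germ {V : X.Opens} (hV : IsAffineOpen V) {y : X}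
    (hy : Order.coheight y = 1) (hyV : y ∈ V) {S : Set X} (hS : S.Finite)
    (hS' : ∀ x ∈ S, Order.coheight x = 1 ∧ x ≠ y) :
    ∃ a : Γ(X, V), IsUnit (X.presheaf.germ V y hyV a) ∧
      ∀ x ∈ S, ∀ hx : x ∈ V, ¬ IsUnit (X.presheaf.germ V x hx a) := by
  obtain ⟨U, -, hyU, -, hUS⟩ := exists_isAffineOpen_avoiding hy hS hS' hyV
  obtain ⟨f, hfU, hyf⟩ := hV.exists_basicOpen_le ⟨y, hyU⟩ hyV
  refine ⟨f, (X.mem_basicOpen f y hyV).mp hyf, fun x hxS hx hu => hUS x hxS ?_⟩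
  exact hfU ((X.mem_basicOpen f x hx).mpr hu)

variable [IsLocallyNoetherian X]

/-- There are rational functions with a prescribed order at one prime divisor and high order at
finitely many others. -/
lemma exists_ord_eq_and_le (hX : IsNormal X) {V : X.Opens} (hV : IsAffineOpen V) {y : X}
    (hy : Order.coheight y = 1) (hyV : y ∈ V) {S : Set X} (hS : S.Finite)
    (hS' : ∀ x ∈ S, Order.coheight x = 1 ∧ x ≠ y) (hSV : ∀ x ∈ S, x ∈ V) (k : ℤ) (N : X → ℤ) :
    ∃ z : X.functionField, z ≠ 0 ∧ Scheme.ord z y = k ∧ ∀ x ∈ S, N x ≤ Scheme.ord z x := by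
  obtain ⟨a, hay, haS⟩ := exists_isUnit_germ_and_not_isUnit_germ hV hy hyV hS hS'
  have := isDiscreteValuationRing_stalk hX hy
  obtain ⟨t, ht⟩ := IsDiscreteValuationRing.exists_irreducible (X.presheaf.stalk y)
  have ht0 : algebraMap _ X.functionField t ≠ 0 := by simpa using ht.ne_zero
  set w := sectionToField V (genericPoint_mem hyV) a with hw
  set τ := algebraMap _ X.functionField t
  have hw0 : w ≠ 0 := by
    rw [hw, ← algebraMap_germ hyV]
    simpa using hay.ne_zero
  have hwy : Scheme.ord w y = 0 := by
    rw [hw, ← algebraMap_germ hyV, ord_algebraMap_isUnit hy hay]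
  have hwS : ∀ x ∈ S, 1 ≤ Scheme.ord w x := by
    intro x hx
    have h1 := haS x hx (hSV x hx)
    have h0 : X.presheaf.germ V x (hSV x hx) a ≠ 0 := by
      intro h0
      have := algebraMap_germ (hSV x hx) a
      rw [h0, map_zero] at this
      exact hw0 this.symm
    rw [isUnit_iff_inv_mem h0, algebraMap_germ, ← hw,
      mem_stalkSubring_iff_ord hX (hS' x hx).1 (inv_ne_zero hw0), ord_inv _ hw0] at h1
    omega
  -- The function w is a unit at y and vanishes on S, so an exponent exceeding all deficits repairs
  -- the orders on S without changing the one at y.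
  let n : ℕ := ∑ x ∈ hS.toFinset, (N x - Scheme.ord (τ ^ k) x).toNat
  refine ⟨τ ^ k * w ^ n, mul_ne_zero (zpow_ne_zero _ ht0) (pow_ne_zero _ hw0), ?_, ?_⟩
  · rw [Scheme.ord_mul (zpow_ne_zero _ ht0) (pow_ne_zero _ hw0), ord_zpow _ ht0, ord_pow _ hw0,
      hwy, ord_algebraMap_irreducible hy ht]
    ring
  · intro x hx
    rw [Scheme.ord_mul (zpow_ne_zero _ ht0) (pow_ne_zero _ hw0), ord_pow _ hw0]
    have h1 : (N x - Scheme.ord (τ ^ k) x).toNat ≤ n :=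
      Finset.single_le_sum (f := fun x => (N x - Scheme.ord (τ ^ k) x).toNat)
        (fun _ _ => Nat.zero_le _) (hS.mem_toFinset.mpr hx)
    have h2 := hwS x hx
    have h3 : (n : ℤ) ≤ n * Scheme.ord w x := le_mul_of_one_le_right (by positivity) h2
    omega

lemma zpow_mul_mem_stalkSubring_iff (hX : IsNormal X) {x : X} (hx : Order.coheight x = 1)
    {t : X.functionField} (ht0 : t ≠ 0) (ht : Scheme.ord t x = 1) (k : ℤ) (h : X.functionField) :
    t ^ k * h ∈ stalkSubring x ↔ (h ≠ 0 → 0 ≤ Scheme.ord h x + k) := by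
  by_cases h0 : h = 0
  · simp [h0]
  · rw [mem_stalkSubring_iff_ord hX hx (mul_ne_zero (zpow_ne_zero _ ht0) h0),
      Scheme.ord_mul (zpow_ne_zero _ ht0) h0, ord_zpow _ ht0, ht]
    simp only [ne_eq, h0, not_false_eq_true, forall_const]
    rw [mul_one, add_comm]

lemma exists_ord_eq_one (hX : IsNormal X) {x : X} (hx : Order.coheight x = 1) :
    ∃ t : X.functionField, t ≠ 0 ∧ Scheme.ord t x = 1 := by
  have := isDiscreteValuationRing_stalk hX hx
  obtain ⟨t, ht⟩ := IsDiscreteValuationRing.exists_irreducible (X.presheaf.stalk x)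
  exact ⟨_, by simpa using ht.ne_zero, ord_algebraMap_irreducible hx ht⟩

lemma finite_notMem_stalkSubring {X : Scheme.{u}} [IsIntegral X] [IsNoetherian X]
    (hX : IsNormal X) (h : X.functionField) :
    {x : X | Order.coheight x = 1 ∧ h ∉ stalkSubring x}.Finite := by
  by_cases h0 : h = 0
  · simp [h0]
  · refine (finite_ord_ne_zero hX h0).subset ?_
    rintro x ⟨hx, hh⟩
    refine ⟨hx, fun h1 => hh ?_⟩
    rw [mem_stalkSubring_iff_ord hX hx h0, h1]

lemma WeilDivisor.finite_ne_zero {X : Scheme.{u}} (D : WeilDivisor X) :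
    {x : X | ∃ hx : Order.coheight x = 1, D ⟨x, hx⟩ ≠ 0}.Finite := by
  refine (D.support.finite_toSet.image Subtype.val).subset ?_
  rintro x ⟨hx, h⟩
  exact ⟨⟨x, hx⟩, by simpa using h, rfl⟩

end Avoidance

section UpperShriek

variable {X Y : Scheme.{u}} [IsIntegral X] [IsIntegral Y] {π : Y ⟶ X} [Surjective π] [IsFinite π]
  [IsNoetherian X] [IsNoetherian Y]

/-- With k the coefficient of K_X, the function z = (s t^k)⁻¹ has the extremal order for which Θ(z ·
) maps (π_* 𝒪_Y)_x into the stalk of 𝒪_X(K_X). After shrinking U this holds over U, so z is a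
section of 𝒪_Y(K_Y). -/
lemma le_of_isUpperShriek (hX : IsNormal X) {KX : WeilDivisor X} {KY : WeilDivisor Y}
    {Θ : RationalHom π}
    (hΘ : ∀ U : X.Opens, IsAffineOpen U → ∀ h : genericPoint Y ∈ π ⁻¹ᵁ U, ∀ z : Y.functionField,
      z ∈ divisorSections KY (π ⁻¹ᵁ U) ↔ ∀ s : Γ(Y, π ⁻¹ᵁ U),
          Θ (z * sectionToField (π ⁻¹ᵁ U) h s) ∈ divisorSections KX U)
    (y : PrimeDivisor Y) {n : ℤ} (hn : Θ.HasOrderAt y.1 n) :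
    n + KX ⟨π y.1, coheight_apply_eq_one π hX y.2⟩ * ramificationIndex π y ≤ KY y := by
  obtain ⟨s, hs, hord, rfl⟩ := hn
  have hx := coheight_apply_eq_one π hX y.2
  set k := KX ⟨π y.1, hx⟩ with hk
  obtain ⟨t, ht0, ht⟩ := exists_ord_eq_one hX hx
  have htk : functionFieldMap π (t ^ k) ≠ 0 := (map_ne_zero _).mpr (zpow_ne_zero _ ht0)
  let z := (s * functionFieldMap π (t ^ k))⁻¹
  have hz0 : z ≠ 0 := inv_ne_zero (mul_ne_zero hs htk)
  have hzB : ∀ b ∈ pushforwardSubring π (π y.1), t ^ k * Θ (z * b) ∈ stalkSubring (π y.1) := by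
    intro b hb
    have h1 := (hord (functionFieldMap π (t ^ k) * z)).mpr (by
      rw [← mul_assoc, mul_inv_cancel₀ (mul_ne_zero hs htk)]; exact Subring.one_mem _) b hb
    rwa [mul_assoc, Θ.isSemilinear] at h1
  obtain ⟨U₀, hU₀, hxU₀⟩ := exists_isAffineOpen_mem (π y.1)
  obtain ⟨m, g, hg⟩ := exists_isSpanning π hU₀ (genericPoint_mem hxU₀)
  set g' := fun i => sectionToField (π ⁻¹ᵁ U₀)
    (genericPoint_mem_preimage π (genericPoint_mem hxU₀)) (g i)
  -- The prime divisors to avoid: those in the support of K_X and the poles of the values of Θ on z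
  -- times generators, except π(y) itself.
  let S : Set X := ({x | ∃ hx : Order.coheight x = 1, KX ⟨x, hx⟩ ≠ 0} ∪
    ⋃ i, {x | Order.coheight x = 1 ∧ Θ (z * g' i) ∉ stalkSubring x}) \ {π y.1}
  have hS : S.Finite := Set.Finite.sdiff (KX.finite_ne_zero.union
    (Set.finite_iUnion fun i => finite_notMem_stalkSubring hX _))
  obtain ⟨U, hU, hxU, hUU₀, hUS⟩ := exists_isAffineOpen_avoiding hx hS (by
    rintro x' ⟨h | h, hne⟩
    · exact ⟨h.1, hne⟩
    · obtain ⟨i, hi⟩ := Set.mem_iUnion.mp h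
      exact ⟨hi.1, hne⟩) hxU₀
  have hgenU := genericPoint_mem_preimage π (genericPoint_mem hxU)
  have hz : z ∈ divisorSections KY (π ⁻¹ᵁ U) := by
    rw [hΘ U hU hgenU]
    intro a h0 x hxU'
    by_cases hxx : x.1 = π y.1
    · have h1 := hzB _ (section_mem_pushforwardSubring π hxU hgenU a)
      rw [zpow_mul_mem_stalkSubring_iff hX hx ht0 ht] at h1
      have h2 := h1 h0
      obtain rfl : x = ⟨π y.1, hx⟩ := Subtype.ext hxx
      exact h2
    · have hK : KX x = 0 := by
        by_contra hK
        exact hUS x.1 ⟨Or.inl ⟨x.2, hK⟩, hxx⟩ hxU'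
      rw [hK, add_zero, ← mem_stalkSubring_iff_ord hX x.2 h0]
      obtain ⟨c, hc, hac⟩ := (hg x.1 (hUU₀ hxU') _).mp (section_mem_pushforwardSubring π hxU' hgenU a)
      have h1 : Θ.toAddHom (z * sectionToField (π ⁻¹ᵁ U) hgenU a) =
          ∑ i, c i * Θ.toAddHom (z * g' i) := by
        rw [hac, Finset.mul_sum, map_sum]
        refine Finset.sum_congr rfl fun i _ => ?_
        rw [mul_left_comm, Θ.isSemilinear]
      rw [Θ.toAddHom_apply] at h1
      rw [h1]
      refine Subring.sum_mem _ fun i _ => Subring.mul_mem _ (hc i) ?_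
      by_contra hi
      exact hUS x.1 ⟨Or.inr (Set.mem_iUnion.mpr ⟨i, x.2, hi⟩), hxx⟩ hxU'
  have h1 := hz hz0 y hxU
  rw [ord_inv _ (mul_ne_zero hs htk), Scheme.ord_mul hs htk,
    ramificationIndex_eq π hX y (zpow_ne_zero _ ht0), ord_zpow _ ht0, ht, mul_one] at h1
  linarith

/-- Take a section z of 𝒪_Y(K_Y) whose order at y is as small as allowed. That Θ(z · ) lands in
𝒪_X(K_X) bounds this order from below by the order of Θ. -/
lemma ge_of_isUpperShriek (hX : IsNormal X) (hY : IsNormal Y) {KX : WeilDivisor X}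
    {KY : WeilDivisor Y} {Θ : RationalHom π}
    (hΘ : ∀ U : X.Opens, IsAffineOpen U → ∀ h : genericPoint Y ∈ π ⁻¹ᵁ U, ∀ z : Y.functionField,
      z ∈ divisorSections KY (π ⁻¹ᵁ U) ↔ ∀ s : Γ(Y, π ⁻¹ᵁ U),
          Θ (z * sectionToField (π ⁻¹ᵁ U) h s) ∈ divisorSections KX U)
    (y : PrimeDivisor Y) {n : ℤ} (hn : Θ.HasOrderAt y.1 n) :
    KY y ≤ n + KX ⟨π y.1, coheight_apply_eq_one π hX y.2⟩ * ramificationIndex π y := by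
  obtain ⟨s, hs, hord, rfl⟩ := hn
  have hx := coheight_apply_eq_one π hX y.2
  set k := KX ⟨π y.1, hx⟩ with hk
  obtain ⟨t, ht0, ht⟩ := exists_ord_eq_one hX hx
  have htk : functionFieldMap π (t ^ k) ≠ 0 := (map_ne_zero _).mpr (zpow_ne_zero _ ht0)
  obtain ⟨U₀, hU₀, hxU₀⟩ := exists_isAffineOpen_mem (π y.1)
  -- Shrinking U cannot remove the other prime divisors over π(y), so z is chosen to satisfy the
  -- section condition there too. The default value 0 is never used, as these points have
  -- codimension one.
  obtain ⟨z, hz0, hzy, hzS⟩ := exists_ord_eq_and_le hY (hU₀.preimage π) y.2 (y := y.1) hxU₀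
    (S := {y' | (Order.coheight y' = 1 ∧ π y' = π y.1) ∧ y' ≠ y.1})
    ((Scheme.Hom.finite_preimage_singleton π (π y.1)).subset fun y' hy' => hy'.1.2)
    (fun y' hy' => ⟨hy'.1.1, hy'.2⟩) (fun y' hy' => by
      change π y' ∈ U₀
      rw [hy'.1.2]; exact hxU₀) (- KY y)
    (fun y' => open Classical in if h : Order.coheight y' = 1 then - KY ⟨y', h⟩ else 0)
  let S : Set X := (Set.image π ({y' | ∃ hx : Order.coheight y' = 1, KY ⟨y', hx⟩ ≠ 0} ∪
    {y' | Order.coheight y' = 1 ∧ z ∉ stalkSubring y'})) \ {π y.1}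
  have hS : S.Finite := Set.Finite.sdiff ((KY.finite_ne_zero.union
    (finite_notMem_stalkSubring hY z)).image _)
  obtain ⟨U, hU, hxU, hUU₀, hUS⟩ := exists_isAffineOpen_avoiding hx hS (by
    rintro _ ⟨⟨y', h | h, rfl⟩, hne⟩
    · exact ⟨coheight_apply_eq_one π hX h.1, hne⟩
    · exact ⟨coheight_apply_eq_one π hX h.1, hne⟩) hxU₀
  have hgenU := genericPoint_mem_preimage π (genericPoint_mem hxU)
  have hz : z ∈ divisorSections KY (π ⁻¹ᵁ U) := by
    intro _ y' hy'U
    by_cases hyy : y' = y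
    · rw [hyy, hzy, neg_add_cancel]
    · by_cases hxx : π y'.1 = π y.1
      · have h1 := hzS y'.1 ⟨⟨y'.2, hxx⟩, fun h => hyy (Subtype.ext h)⟩
        rw [dif_pos y'.2] at h1
        change - KY y' ≤ _ at h1
        linarith
      · have hK : KY y' = 0 := by
          by_contra hK
          exact hUS _ ⟨⟨y'.1, Or.inl ⟨y'.2, hK⟩, rfl⟩, hxx⟩ hy'U
        rw [hK, add_zero, ← mem_stalkSubring_iff_ord hY y'.2 hz0]
        by_contra hi
        exact hUS _ ⟨⟨y'.1, Or.inr ⟨y'.2, hi⟩, rfl⟩, hxx⟩ hy'U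
  rw [hΘ U hU hgenU] at hz
  obtain ⟨m, g, hg⟩ := exists_isSpanning π hU (genericPoint_mem hxU)
  have h1 : s * (functionFieldMap π (t ^ k) * z) ∈ pushforwardSubring π (π y.1) := by
    refine (hord _).mp fun b hb => ?_
    obtain ⟨c, hc, rfl⟩ := (hg _ hxU b).mp hb
    rw [mul_assoc, Θ.isSemilinear, Finset.mul_sum, map_sum, Finset.mul_sum]
    refine Subring.sum_mem _ fun i _ => ?_
    rw [mul_left_comm, Θ.isSemilinear, mul_left_comm]
    refine Subring.mul_mem _ (hc i) ?_
    rw [zpow_mul_mem_stalkSubring_iff hX hx ht0 ht]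
    intro h0
    exact hz (g i) h0 ⟨π y.1, hx⟩ hxU
  have h2 := pushforwardSubring_le π y.1 h1
  rw [mem_stalkSubring_iff_ord hY y.2 (mul_ne_zero hs (mul_ne_zero htk hz0)),
    Scheme.ord_mul hs (mul_ne_zero htk hz0), Scheme.ord_mul htk hz0, hzy,
    ramificationIndex_eq π hX y (zpow_ne_zero _ ht0), ord_zpow _ ht0, ht, mul_one] at h2
  linarith

/-- The two inequalities give K_Y = div Θ + π^*K_X. Writing T = Θ(g · ) gives R = div Θ + div g, so
the difference of the two sides is the principal divisor of g⁻¹; the multiple 1 suffices. -/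
theorem IsUpperShriek.qLinearEquiv (hX : IsNormal X) (hY : IsNormal Y) {KX : WeilDivisor X}
    {KY : WeilDivisor Y} (h : IsUpperShriek π KX KY) {T : RationalHom π} (hT : T ≠ 0)
    {R : WeilDivisor Y} (hR : ∀ (y : PrimeDivisor Y) (n : ℤ), T.HasOrderAt y.1 n → R y = n)
    (Δ : QDivisor X) :
    QLinearEquiv (KY.toQ + (pullbackDivisor π Δ - R.toQ)) (pullbackDivisor π (KX.toQ + Δ)) := by
  obtain ⟨Θ, hΘ0, hΘ⟩ := h
  obtain ⟨g, hg⟩ := IsSemilinear.exists_eq (functionFieldMap_finite π) Θ.isSemilinear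
    (RationalHom.toAddHom_ne_zero hΘ0) T.isSemilinear
  have hg0 : g ≠ 0 := by
    rintro rfl
    apply RationalHom.toAddHom_ne_zero hT
    ext z
    rw [hg, zero_mul, map_zero]
    rfl
  refine ⟨1, one_pos, g⁻¹, inv_ne_zero hg0, fun y => ?_⟩
  obtain ⟨n, hn⟩ := RationalHom.exists_hasOrderAt hX hY hΘ0 y.2
  have hK := le_antisymm (ge_of_isUpperShriek hX hY hΘ y hn) (le_of_isUpperShriek hX hΘ y hn)
  have hRy : R y = n + Scheme.ord g y.1 := by
    refine hR y _ ?_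
    obtain ⟨s, hs, hord, rfl⟩ := hn
    refine ⟨s * g, mul_ne_zero hs hg0, ?_, Scheme.ord_mul hs hg0⟩
    have h1 : T.toAddHom = Θ.toAddHom.comp (AddMonoidHom.mulLeft g) := by
      ext z
      exact hg z
    rw [h1]
    exact hord.mulLeft g
  rw [Finsupp.add_apply, Finsupp.sub_apply, pullbackDivisor_apply hX, pullbackDivisor_apply hX,
    Finsupp.add_apply, ord_inv _ hg0]
  change ((1 : ℕ) : ℚ) * (((KY y : ℤ) : ℚ) + (_ - ((R y : ℤ) : ℚ)) - (((KX _ : ℤ) : ℚ) + _) * _) = _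
  rw [hK, hRy]
  push_cast
  ring

end UpperShriek

end FrobeniusTranspose

end

/-! ### The main theorem -/

open FrobeniusTranspose in
theorem mainTheorem3 {X Y : Scheme.{u}} [IsIntegral X] [IsIntegral Y] [IsNoetherian X]
    [IsNoetherian Y] (hX : IsNormal X) (hY : IsNormal Y) (p : ℕ) (hp : p.Prime)
    (hXF : IsFFinite p X) (hYF : IsFFinite p Y) (π : Y ⟶ X) [IsFinite π] [Surjective π]
    (e : ℕ) (he : 0 < e) (L : X.Modules) (hL : IsInvertibleSheaf L)
    (φ : RootLinearMap (p ^ e) L) (hφ : φ ≠ 0) :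
    ∃ Δ : QDivisor X, (∀ Δ', φ.HasDivisor Δ' ↔ Δ' = Δ) ∧
      (∀ T : RationalHom π, T ≠ 0 →
        ∃ R : WeilDivisor Y, (∀ R', T.HasDivisor R' ↔ R' = R) ∧
          ((∃ φT, IsTranspose T φ φT) ↔ R.toQ ≤ pullbackDivisor π Δ) ∧
          ∀ φT, IsTranspose T φ φT →
            (∀ Δ', φT.HasDivisor Δ' ↔ Δ' = pullbackDivisor π Δ - R.toQ) ∧
            ∀ (KX : WeilDivisor X) (KY : WeilDivisor Y), IsCanonicalDivisor KX →
              IsCanonicalDivisor KY → IsUpperShriek π KX KY →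
              QLinearEquiv (KY.toQ + (pullbackDivisor π Δ - R.toQ))
                (pullbackDivisor π (KX.toQ + Δ))) ∧
      (IsGenericallySeparable π →
        rationalTrace π ≠ 0 ∧
        ∃ Ram : WeilDivisor Y, (∀ R', IsRamificationDivisor π R' ↔ R' = Ram) ∧
          (rationalTrace π).HasDivisor Ram ∧
          ((∃ φbar : RootLinearMap (p ^ e) ((Scheme.Modules.pullback π).obj L),
            IsExtension φ φbar) ↔ Ram.toQ ≤ pullbackDivisor π Δ) ∧
          ∀ φbar : RootLinearMap (p ^ e) ((Scheme.Modules.pullback π).obj L),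
            IsExtension φ φbar →
              ∀ Δ', φbar.HasDivisor Δ' ↔ Δ' = pullbackDivisor π Δ - Ram.toQ) := by
  obtain ⟨Δ, hΔ⟩ := RootLinearMap.exists_divisor hX hp hXF hL.hasLocalGenerators hφ
  refine ⟨Δ, RootLinearMap.hasDivisor_iff_eq hX hp hXF hL.hasLocalGenerators hφ hΔ, ?_, ?_⟩
  · intro T hT
    obtain ⟨R, hR⟩ := RationalHom.exists_divisor hX hY hT
    exact ⟨R, RationalHom.hasDivisor_iff_eq hX hY hT hR,
      exists_isTranspose_iff hX hY hp hXF hYF he hL hT hφ hΔ hR, fun φT h =>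
      ⟨h.hasDivisor_iff hX hY hp hXF hYF he hL hT hφ hΔ hR,
        fun _ _ _ _ hK => hK.qLinearEquiv hX hY hT hR Δ⟩⟩
  · intro hsep
    have hT := rationalTrace_ne_zero hsep
    obtain ⟨R, hR⟩ := RationalHom.exists_divisor hX hY hT
    -- The divisor of the trace has the length of the differentials as its coefficient at each prime
    -- divisor, and these lengths determine the ramification divisor.
    have hram : ∀ R', IsRamificationDivisor π R' ↔ R' = R := by
      have key : ∀ y : PrimeDivisor Y,
          letI := (π.stalkMap y.1).hom.toAlgebra
          ∃ n : ℕ, Module.length (Y.presheaf.stalk y.1)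
            (KaehlerDifferential (X.presheaf.stalk (π y.1)) (Y.presheaf.stalk y.1)) = n ∧
              R y = n := by
        intro y
        obtain ⟨k, hk⟩ := RationalHom.exists_hasOrderAt hX hY hT y.2
        rw [hR y k hk]
        exact length_kaehlerDifferential_eq hX hY hp hXF hYF hsep y hk
      intro R'
      constructor
      · intro h
        ext y
        obtain ⟨n, hn, hn'⟩ := h y
        obtain ⟨m, hm, hm'⟩ := key y
        rw [hn', hm']
        have := hn.symm.trans hm
        exact_mod_cast this
      · rintro rfl
        exact key
    refine ⟨hT, R, hram, (RationalHom.hasDivisor_iff_eq hX hY hT hR R).mpr rfl, ?_, ?_⟩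
    · simp only [isExtension_iff_isTranspose hp hXF hsep hL]
      exact exists_isTranspose_iff hX hY hp hXF hYF he hL hT hφ hΔ hR
    · intro φbar h
      rw [isExtension_iff_isTranspose hp hXF hsep hL] at h
      exact h.hasDivisor_iff hX hY hp hXF hYF he hL hT hφ hΔ hR
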